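/- Let $\tau\colon M\to\mathbb R$ be a smooth submersion (in particular, a smooth fibre bundle), $\dim M=n+1$, and let $\pi\colon J^1\tau\to M$ be its first jet bundle, identified with the affine subbundle $\{z\in TM: d\tau(z)=1\}$ of $TM$, which is modelled on $\operatorname{Ver}(\tau)=\operatorname{Ker}T\tau$. Coordinates $(t,x^1,\dots,x^n)$ on $M$ are always adapted to $\tau$ ($t=\tau$), and $(t,x^i,v^i)$ are the induced coordinates on $J^1\tau$. Let $\Gamma$ be a non-autonomous SODE, i.e. a smooth vector field on $J^1\tau$ with $T\pi(\Gamma(z))=z$ for all $z$, so that locally $$\Gamma=\frac{\partial}{\partial t}+v^i\frac{\partial}{\partial x^i}+f^i(t,x,v)\frac{\partial}{\partial v^i}.$$ *Linearized connection and Jacobi endomorphism.* $\Gamma$ defines a nonlinear connection on $J^1\tau\to M$ with coefficients $\Gamma^i_j=-\frac12\frac{\partial f^i}{\partial v^j}$, $\Gamma^i_0=\frac12v^k\frac{\partial f^i}{\partial v^k}-f^i$. Its linearization is the linear connection $D$ on $\pi^*TM\to J^1\tau$ which, for $u\in TJ^1\tau$ with base components $(u^\mu)=(u^0,u^1,\dots,u^n)$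 and a section $\sigma=\sigma^0\partial_t+\sigma^i\partial_{x^i}$, is $$D_u\sigma=u(\sigma^0)\,\partial_t+\Bigl\{u(\sigma^i)+\sum_{\mu=0}^n u^\mu\Bigl[\Bigl(\Gamma^i_\mu-v^k\tfrac{\partial\Gamma^i_\mu}{\partial v^k}\Bigr)\sigma^0+\tfrac{\partial\Gamma^i_\mu}{\partial v^k}\sigma^k\Bigr]\Bigr\}\partial_{x^i}.$$ The Jacobi endomorphism is the endomorphism $\Phi$ of $\pi^*\operatorname{Ver}(\tau)$ with components $\Phi^i_j=-\frac{\partial f^i}{\partial x^j}-\Gamma^i_k\Gamma^k_j-\Gamma(\Gamma^i_j)$. (Both are independent of the coordinates.) *Distributions.* For $U\subseteq M$ open, a vertical distribution $\mathcal D$ over $U$ is a smooth vector subbundle of $\pi^*\operatorname{Ver}(\tau)$ over $\pi^{-1}(U)$. It is non-trivial if no fibre of it is $0$ or the whole fibre of $\pi^*\operatorname{Ver}(\tau)$; $\Phi$-invariant if $\Phi(\mathcal D)\subseteq\mathcal D$; parallel if $D_u\sigma\in\mathcal D$ for every local smooth section $\sigma$ of $\mathcal D$ and every $u\in TJ^1\tau$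 tangent at a point where $\sigma$ is defined. Two such distributions are complementary if $\mathcal D_1\oplus\mathcal D_2=\pi^*\operatorname{Ver}(\tau)$ over $\pi^{-1}(U)$. *Submersiveness and decoupling.* $\Gamma$ is locally submersive if around every point of $M$ there are adapted coordinates $(t,x^i,x^\alpha)$, with $i=1,\dots,d$, $\alpha=d+1,\dots,n$ and $0<d<n$, in which the equations of the integral curves of $\Gamma$ have the form $\ddot x^i=f^i(t,x^j,\dot x^j)$, $\ddot x^\alpha=f^\alpha(t,x^j,x^\beta,\dot x^j,\dot x^\beta)$. It locally decouples if around every point the coordinates can be chosen so that, furthermore, $\ddot x^\alpha=f^\alpha(t,x^\beta,\dot x^\beta)$. **Theorem.** 1. $\Gamma$ is locally submersive if and only if every point of $M$ has an open neighbourhood over which there exists a non-trivial $\Phi$-invariant parallel vertical distribution. 2. $\Gamma$ locally decouples if and only if every point of $M$ has an open neighbourhood over which there exists a pair of complementary non-trivial $\Phi$-invariant parallel vertical distributions. In particular, if a non-trivial $\Phi$-invariant parallel vertical distribution (respectively, a complementary pair of these) exists over the whole of $M$, then $\Gamma$ is locally submersive (respectively, locally decouples). -/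

import Mathlib

open scoped Manifold ContDiff Topology

noncomputable section

/-- The coordinate model `(t, x)` of an `(n+1)`-dimensional manifold fibred over the real line. -/
abbrev EventModel (n : ℕ) : Type := ℝ × (Fin n → ℝ)

/-- The space of coordinates `(t, x, v)` on the first jet bundle. -/
abbrev JetModel (n : ℕ) : Type := ℝ × (Fin n → ℝ) × (Fin n → ℝ)

section

variable {n : ℕ} {M : Type*} [TopologicalSpace M] [ChartedSpace (EventModel n) M]

/-- A (local) coordinate system `(t, x¹, …, xⁿ)` on `M` adapted to `τ : M → ℝ`: a chart of the
smooth structure of `M` whose first coordinate is `t = τ`. -/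
structure AdaptedChart (τ : M → ℝ) where
  chart : OpenPartialHomeomorph M (EventModel n)
  mem_maximalAtlas : chart ∈ IsManifold.maximalAtlas 𝓘(ℝ, EventModel n) ∞ M
  fst_eq : ∀ m ∈ chart.source, (chart m).1 = τ m

/-- The value of `dτ` on a tangent vector of `M`. -/
def dTime (τ : M → ℝ) (z : TangentBundle 𝓘(ℝ, EventModel n) M) : ℝ :=
  mfderiv 𝓘(ℝ, EventModel n) 𝓘(ℝ, ℝ) τ z.proj z.snd

/-- The first jet bundle `J¹τ`, as the affine subbundle `{z ∈ TM : dτ(z) = 1}` of `TM` (the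
1-jet of a section `γ` of `τ` at `t` is identified with the velocity `γ'(t)`). -/
def JetBundle (n : ℕ) {M : Type*} [TopologicalSpace M] [ChartedSpace (EventModel n) M]
    (τ : M → ℝ) : Type _ :=
  {z : TangentBundle 𝓘(ℝ, EventModel n) M // dTime τ z = 1}

/-- The projection `π = τ₁₀ : J¹τ → M`. -/
def JetBundle.base {τ : M → ℝ} (z : JetBundle n τ) : M := z.1.proj

/-- A vector field along `π : J¹τ → M`, i.e. a (not necessarily smooth) section of `π^*TM`. -/
abbrev FieldAlong (n : ℕ) {M : Type*} [TopologicalSpace M] [ChartedSpace (EventModel n) M]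
    (τ : M → ℝ) : Type _ :=
  (z : JetBundle n τ) → TangentSpace 𝓘(ℝ, EventModel n) z.base

/-- A family of subspaces of the fibres of `π^*TM`. -/
abbrev DistributionAlong (n : ℕ) {M : Type*} [TopologicalSpace M] [ChartedSpace (EventModel n) M]
    (τ : M → ℝ) : Type _ :=
  (z : JetBundle n τ) → Submodule ℝ (TangentSpace 𝓘(ℝ, EventModel n) z.base)

namespace AdaptedChart

variable {τ : M → ℝ} (φ : AdaptedChart (n := n) τ)

/-- The components `(X⁰, X¹, …, Xⁿ)` of a tangent vector `X` at `m`. -/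
def components (m : M) (X : TangentSpace 𝓘(ℝ, EventModel n) m) : EventModel n :=
  mfderiv 𝓘(ℝ, EventModel n) 𝓘(ℝ, EventModel n) φ.chart m X

/-- The tangent vector at `m` with given components. -/
def ofComponents (m : M) (w : EventModel n) : TangentSpace 𝓘(ℝ, EventModel n) m :=
  mfderiv 𝓘(ℝ, EventModel n) 𝓘(ℝ, EventModel n) φ.chart.symm (φ.chart m) w

/-- The tangent vector with coordinates `(t, x)` and components `(1, v)`. -/
def liftTangent (p : JetModel n) : TangentBundle 𝓘(ℝ, EventModel n) M :=
  ⟨φ.chart.symm (p.1, p.2.1),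
    mfderiv 𝓘(ℝ, EventModel n) 𝓘(ℝ, EventModel n) φ.chart.symm (p.1, p.2.1)
      ((1, p.2.2) : EventModel n)⟩

/-- The range of the jet coordinates `(t, x, v)`. -/
def jetTarget : Set (JetModel n) := {p | (p.1, p.2.1) ∈ φ.chart.target}

/-- The fibre coordinates `v` of a tangent vector. -/
def velocity (z : TangentBundle 𝓘(ℝ, EventModel n) M) : Fin n → ℝ :=
  (φ.components z.proj z.snd).2

/-- The coordinates `(t, x, v)` of a point of `J¹τ`. -/
def jetCoord (z : JetBundle n τ) : JetModel n :=
  ((φ.chart z.base).1, (φ.chart z.base).2, φ.velocity z.1)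

theorem dTime_liftTangent [IsManifold 𝓘(ℝ, EventModel n) ∞ M] (p : JetModel n)
    (hp : p ∈ φ.jetTarget) : dTime τ (φ.liftTangent p) = 1 := by
  have hp' : (p.1, p.2.1) ∈ φ.chart.target := hp
  have hsrc := φ.chart.map_target hp'
  have h1 : MDifferentiableAt 𝓘(ℝ, EventModel n) 𝓘(ℝ, EventModel n) φ.chart.symm
      (p.1, p.2.1) :=
    ((contMDiffOn_symm_of_mem_maximalAtlas φ.mem_maximalAtlas).contMDiffAt
      (φ.chart.open_target.mem_nhds hp')).mdifferentiableAt (by simp)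
  have h2 : MDifferentiableAt 𝓘(ℝ, EventModel n) 𝓘(ℝ, EventModel n) φ.chart
      (φ.chart.symm (p.1, p.2.1)) :=
    ((contMDiffOn_of_mem_maximalAtlas φ.mem_maximalAtlas).contMDiffAt
      (φ.chart.open_source.mem_nhds hsrc)).mdifferentiableAt (by simp)
  have h3 : MDifferentiableAt 𝓘(ℝ, EventModel n) 𝓘(ℝ, ℝ) τ (φ.chart.symm (p.1, p.2.1)) := by
    have : MDifferentiableAt 𝓘(ℝ, EventModel n) 𝓘(ℝ, ℝ) (fun m => (φ.chart m).1)
        (φ.chart.symm (p.1, p.2.1)) :=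
      MDifferentiableAt.comp (φ.chart.symm (p.1, p.2.1))
        (g := fun q : EventModel n => q.1) (I' := 𝓘(ℝ, EventModel n))
        (differentiableAt_fst.mdifferentiableAt) h2
    refine this.congr_of_eventuallyEq ?_
    filter_upwards [φ.chart.open_source.mem_nhds hsrc] with m hm
    exact (φ.fst_eq m hm).symm
  have h4 : mfderiv 𝓘(ℝ, EventModel n) 𝓘(ℝ, ℝ) (τ ∘ φ.chart.symm) (p.1, p.2.1)
      = mfderiv 𝓘(ℝ, EventModel n) 𝓘(ℝ, ℝ) (fun q : EventModel n => q.1) (p.1, p.2.1) := by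
    refine Filter.EventuallyEq.mfderiv_eq ?_
    filter_upwards [φ.chart.open_target.mem_nhds hp'] with q hq
    show τ (φ.chart.symm q) = q.1
    rw [← φ.fst_eq _ (φ.chart.map_target hq), φ.chart.right_inv hq]
  rw [mfderiv_comp (p.1, p.2.1) h3 h1] at h4
  have h5 := DFunLike.congr_fun h4 ((1, p.2.2) : EventModel n)
  refine (h5 : _).trans ?_
  rw [mfderiv_eq_fderiv, fderiv_fst]
  rfl

variable [IsManifold 𝓘(ℝ, EventModel n) ∞ M]

/-- The point of `J¹τ` with coordinates `(t, x, v)`. -/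
def jetPoint (p : JetModel n) (hp : p ∈ φ.jetTarget) : JetBundle n τ :=
  ⟨φ.liftTangent p, φ.dTime_liftTangent p hp⟩

open Classical in
/-- The local expression, as a function of the coordinates `(t, x, v)`, of a function on `J¹τ`
(set to zero outside the coordinate range). -/
def localRep {F : Type*} [Zero F] (g : JetBundle n τ → F) (p : JetModel n) : F :=
  if hp : p ∈ φ.jetTarget then g (φ.jetPoint p hp) else 0

/-- The component functions of a vector field along `π` as functions of `(t, x, v)`. -/
def fieldRep (σ : FieldAlong n τ) : JetModel n → EventModel n :=
  φ.localRep fun z => φ.components z.base (σ z)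

end AdaptedChart

variable [IsManifold 𝓘(ℝ, EventModel n) ∞ M]

/-- A non-autonomous second-order differential equation field: a smooth vector field `Γ` on
`J¹τ ⊆ TM` (hence a field of tangent vectors of `TM`, tangent to `J¹τ`) that projects to the
canonical section, `Tπ(Γ(z)) = z`. -/
structure SODE (n : ℕ) {M : Type*} [TopologicalSpace M] [ChartedSpace (EventModel n) M]
    [IsManifold 𝓘(ℝ, EventModel n) ∞ M] (τ : M → ℝ) where
  toFun : (z : JetBundle n τ) → TangentSpace 𝓘(ℝ, EventModel n).tangent z.1
  tangent : ∀ z : JetBundle n τ,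
    mfderiv 𝓘(ℝ, EventModel n).tangent 𝓘(ℝ, ℝ)
      (dTime τ : TangentBundle 𝓘(ℝ, EventModel n) M → ℝ) z.1 (toFun z) = (0 : ℝ)
  projects : ∀ z : JetBundle n τ,
    mfderiv 𝓘(ℝ, EventModel n).tangent 𝓘(ℝ, EventModel n)
      (fun y : TangentBundle 𝓘(ℝ, EventModel n) M => y.proj) z.1 (toFun z) = z.1.snd
  smooth : ∀ φ : AdaptedChart (n := n) τ,
    ContDiffOn ℝ ∞
      (φ.localRep fun z : JetBundle n τ =>
        (mfderiv 𝓘(ℝ, EventModel n).tangent 𝓘(ℝ, Fin n → ℝ) φ.velocity z.1 (toFun z) :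
          Fin n → ℝ)) φ.jetTarget

namespace SODE

variable {τ : M → ℝ} (Γ : SODE n τ) (φ : AdaptedChart (n := n) τ)

/-- The functions `fⁱ(t, x, v)` with `Γ = ∂/∂t + vⁱ ∂/∂xⁱ + fⁱ ∂/∂vⁱ` in the coordinates `φ`. -/
def force : JetModel n → Fin n → ℝ :=
  φ.localRep fun z : JetBundle n τ =>
    (mfderiv 𝓘(ℝ, EventModel n).tangent 𝓘(ℝ, Fin n → ℝ) φ.velocity z.1 (Γ.toFun z) :
      Fin n → ℝ)

end SODE

/-- The coordinate vector `∂/∂xʲ` in the space of jet coordinates. -/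
def dirX (j : Fin n) : JetModel n := (0, Pi.single j 1, 0)

/-- The coordinate vector `∂/∂vʲ` in the space of jet coordinates. -/
def dirV (j : Fin n) : JetModel n := (0, 0, Pi.single j 1)

namespace SODE

variable {τ : M → ℝ} (Γ : SODE n τ) (φ : AdaptedChart (n := n) τ)

/-- The connection coefficients `Γⁱ_j = -½ ∂fⁱ/∂vʲ`. -/
def connCoeff (i j : Fin n) (p : JetModel n) : ℝ :=
  -(1 / 2) * fderiv ℝ (fun q => Γ.force φ q i) p (dirV j)

/-- The connection coefficients `Γⁱ_0 = ½ vᵏ ∂fⁱ/∂vᵏ - fⁱ`. -/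
def connCoeffZero (i : Fin n) (p : JetModel n) : ℝ :=
  (1 / 2) * (∑ k, p.2.2 k * fderiv ℝ (fun q => Γ.force φ q i) p (dirV k)) - Γ.force φ p i

/-- `Γⁱ_μ uᵘ`, the sum over all the coordinates `(t, x)` of the base, for `u = (u⁰, uʲ)`. -/
def connForm (u : EventModel n) (i : Fin n) (p : JetModel n) : ℝ :=
  u.1 * Γ.connCoeffZero φ i p + ∑ j, u.2 j * Γ.connCoeff φ i j p

/-- The components of `D_u σ`, where `D` is the linearization, on `π^*TM`, of the nonlinear
connection of `Γ` on the affine bundle `J¹τ → M`, and `u` is the tangent vector of `J¹τ` with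
components `u = (u⁰, uⁱ, uⁱ_v)` in the frame `∂/∂t, ∂/∂xⁱ, ∂/∂vⁱ`:
`D_u σ = u(σ⁰) ∂/∂t + (u(σⁱ) + u^μ (Γⁱ_{μ0} σ⁰ + Γⁱ_{μk} σᵏ)) ∂/∂xⁱ`, with
`Γⁱ_{μk} = ∂Γⁱ_μ/∂vᵏ`, `Γⁱ_{μ0} = Γⁱ_μ - vᵏ Γⁱ_{μk}`. -/
def covDerivComponents (σ : FieldAlong n τ) (u p : JetModel n) : EventModel n :=
  let s := φ.fieldRep σ
  let G : Fin n → JetModel n → ℝ := fun i => Γ.connForm φ (u.1, u.2.1) i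
  let ds := fderiv ℝ s p u
  (ds.1, fun i => ds.2 i
    + (G i p - ∑ k, p.2.2 k * fderiv ℝ (G i) p (dirV k)) * (s p).1
    + ∑ k, fderiv ℝ (G i) p (dirV k) * (s p).2 k)

/-- The covariant derivative `D_u σ` at `z`, computed in the coordinates `φ`. -/
def covDeriv (σ : FieldAlong n τ) (z : JetBundle n τ) (u : JetModel n) :
    TangentSpace 𝓘(ℝ, EventModel n) z.base :=
  φ.ofComponents z.base (Γ.covDerivComponents φ σ u (φ.jetCoord z))

/-- The derivative of a function of `(t, x, v)` along `Γ = ∂/∂t + vⁱ ∂/∂xⁱ + fⁱ ∂/∂vⁱ`. -/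
def alongFlow (g : JetModel n → ℝ) (p : JetModel n) : ℝ :=
  fderiv ℝ g p ((1, p.2.2, Γ.force φ p) : JetModel n)

/-- `Φⁱ_j = -∂fⁱ/∂xʲ - Γⁱ_k Γᵏ_j - Γ(Γⁱ_j)`. -/
def jacobiCoeff (i j : Fin n) (p : JetModel n) : ℝ :=
  -fderiv ℝ (fun q => Γ.force φ q i) p (dirX j)
    - ∑ k, Γ.connCoeff φ i k p * Γ.connCoeff φ k j p
    - Γ.alongFlow φ (Γ.connCoeff φ i j) p

/-- The Jacobi endomorphism `Φ` at `z` on vertical vectors, computed in the coordinates `φ`. -/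
def jacobi (z : JetBundle n τ) (X : TangentSpace 𝓘(ℝ, EventModel n) z.base) :
    TangentSpace 𝓘(ℝ, EventModel n) z.base :=
  φ.ofComponents z.base
    (0, fun i => ∑ j, Γ.jacobiCoeff φ i j (φ.jetCoord z) * (φ.components z.base X).2 j)

end SODE

/-- Smoothness of a vector field along `π` over a subset `W` (meant to be open) of `J¹τ`. -/
def FieldAlong.SmoothOver {τ : M → ℝ} (σ : FieldAlong n τ) (W : Set (JetBundle n τ)) : Prop :=
  ∀ φ : AdaptedChart (n := n) τ, ∀ z ∈ W, z.base ∈ φ.chart.source →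
    ContDiffAt ℝ ∞ (φ.fieldRep σ) (φ.jetCoord z)

/-- The topology of `J¹τ` as a subspace of `TM`. -/
instance jetBundleTopology (τ : M → ℝ) : TopologicalSpace (JetBundle n τ) :=
  inferInstanceAs (TopologicalSpace {z : TangentBundle 𝓘(ℝ, EventModel n) M // dTime τ z = 1})

/-- The fibre at `m` of `Ver(τ) = Ker(Tτ) ⊆ TM`. -/
def verticalSpace (τ : M → ℝ) (m : M) : Submodule ℝ (TangentSpace 𝓘(ℝ, EventModel n) m) :=
  LinearMap.ker (mfderiv 𝓘(ℝ, EventModel n) 𝓘(ℝ, ℝ) τ m).toLinearMap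

namespace DistributionAlong

variable {τ : M → ℝ} (𝒟 : DistributionAlong n τ) (U : Set M)

/-- `𝒟` is, over `π⁻¹(U)`, a smooth subbundle of `π^*TM`, i.e. it has local smooth frames. -/
def IsSubbundleOver : Prop :=
  ∀ z : JetBundle n τ, z.base ∈ U → ∃ W : Set (JetBundle n τ), IsOpen W ∧ z ∈ W ∧
    ∃ (k : ℕ) (σ : Fin k → FieldAlong n τ), (∀ a, (σ a).SmoothOver W) ∧
      ∀ y ∈ W, LinearIndependent ℝ (fun a => σ a y) ∧
        Submodule.span ℝ (Set.range fun a => σ a y) = 𝒟 y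

/-- `𝒟 ⊆ π^*Ver(τ)` over `π⁻¹(U)`. -/
def IsVerticalOver : Prop :=
  ∀ z : JetBundle n τ, z.base ∈ U → 𝒟 z ≤ verticalSpace τ z.base

/-- The fibres of `𝒟` over `π⁻¹(U)` are neither zero nor all of `π^*Ver(τ)`. -/
def IsNontrivialOver : Prop :=
  ∀ z : JetBundle n τ, z.base ∈ U → 𝒟 z ≠ ⊥ ∧ 𝒟 z ≠ verticalSpace τ z.base

/-- `𝒟` is parallel over `π⁻¹(U)` for the linearized connection `D` of `Γ`: `D_u σ ∈ 𝒟` for all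
local smooth sections `σ` of `𝒟` and all tangent vectors `u` of `J¹τ`. -/
def IsParallelOver (Γ : SODE n τ) : Prop :=
  ∀ (W : Set (JetBundle n τ)) (σ : FieldAlong n τ), IsOpen W → (∀ z ∈ W, z.base ∈ U) →
    σ.SmoothOver W → (∀ z ∈ W, σ z ∈ 𝒟 z) →
    ∀ z ∈ W, ∀ φ : AdaptedChart (n := n) τ, z.base ∈ φ.chart.source →
      ∀ u : JetModel n, Γ.covDeriv φ σ z u ∈ 𝒟 z

/-- `𝒟` (vertical) is invariant under the Jacobi endomorphism over `π⁻¹(U)`. -/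
def IsJacobiInvariantOver (Γ : SODE n τ) : Prop :=
  ∀ z : JetBundle n τ, z.base ∈ U → ∀ φ : AdaptedChart (n := n) τ, z.base ∈ φ.chart.source →
    ∀ X ∈ 𝒟 z, Γ.jacobi φ z X ∈ 𝒟 z

/-- `𝒟` is a non-trivial `Φ`-invariant parallel vertical distribution along `π` over `π⁻¹(U)`. -/
structure IsParallelVertical (Γ : SODE n τ) : Prop where
  subbundle : 𝒟.IsSubbundleOver U
  vertical : 𝒟.IsVerticalOver U
  nontrivial : 𝒟.IsNontrivialOver U
  parallel : 𝒟.IsParallelOver U Γ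
  jacobiInvariant : 𝒟.IsJacobiInvariantOver U Γ

/-- `𝒟₁ ⊕ 𝒟₂ = π^*Ver(τ)` over `π⁻¹(U)`. -/
def AreComplementaryOver (𝒟₁ 𝒟₂ : DistributionAlong n τ) : Prop :=
  ∀ z : JetBundle n τ, z.base ∈ U →
    𝒟₁ z ⊓ 𝒟₂ z = ⊥ ∧ 𝒟₁ z ⊔ 𝒟₂ z = verticalSpace τ z.base

end DistributionAlong

namespace SODE

variable {τ : M → ℝ} (Γ : SODE n τ)

/-- In the coordinates `φ` and for `i ∈ I`, the equation `ẍⁱ = fⁱ(t, x, ẋ)` of `Γ` involves only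
`t` and the `xʲ`, `ẋʲ` with `j ∈ I`. -/
def ClosedSubsystem (φ : AdaptedChart (n := n) τ) (I : Set (Fin n)) : Prop :=
  ∃ g : ℝ → (I → ℝ) → (I → ℝ) → I → ℝ, ∀ p ∈ φ.jetTarget, ∀ i : I,
    Γ.force φ p i = g p.1 (fun j => p.2.1 j) (fun j => p.2.2 j) i

/-- Around every point there are adapted coordinates, split in two non-empty groups
`(x¹, …, xᵈ)` and `(xᵈ⁺¹, …, xⁿ)`, in which the equations of the first group are closed. -/
def LocallySubmersive : Prop :=
  ∀ m : M, ∃ φ : AdaptedChart (n := n) τ, m ∈ φ.chart.source ∧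
    ∃ d : ℕ, 0 < d ∧ d < n ∧ Γ.ClosedSubsystem φ {i | (i : ℕ) < d}

/-- As for `LocallySubmersive`, but with both groups of equations closed. -/
def LocallyDecouples : Prop :=
  ∀ m : M, ∃ φ : AdaptedChart (n := n) τ, m ∈ φ.chart.source ∧
    ∃ d : ℕ, 0 < d ∧ d < n ∧ Γ.ClosedSubsystem φ {i | (i : ℕ) < d} ∧
      Γ.ClosedSubsystem φ {i | d ≤ (i : ℕ)}

end SODE

end

end

/-! Write w = (1, v) and let subscripts denote partial derivatives of the force f. On vertical
sections the linearized connection is D_u s = u(s) − ½ u⁰ f_v s − ½ f_vv(u_x − u⁰ v, s), and the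
Jacobi endomorphism is Φ s = −f_x s − ¼ f_v f_v s + ½ Γ(f_v) s. Both directions of the theorem come
from these two formulas.

Suppose functions y on M satisfy ÿ = g(t, y, ẏ) along Γ. The required distribution is the vertical
kernel of dy. Differentiating the relation in a fibre direction s of this kernel gives dy(f_v s) =
−2 D²y(w, s); a second differentiation controls f_vv and Γ(f_v), and an x-derivative controls f_x.
After substitution all higher derivatives of y and g cancel, so dy annihilates D_u s and Φ s
(`ClosesAt.fderiv_vertCovDeriv_eq_zero`, `ClosesAt.fderiv_vertJacobi_eq_zero`).

Conversely, let a distribution be parallel. In fibre directions D is plain differentiation, so the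
distribution is constant along the fibres of J¹τ → M, which are connected, and it descends to M
(`eq_of_isParallelAt`). Written as the graph of a linear map L, parallelism expresses the
x-derivatives of L through ½ f_vv, and the symmetry of f_vv is exactly the Frobenius condition on
the slices t = const. Hence the distribution is the vertical kernel of some dy
(`exists_ker_fderiv_eq_of_isParallelAt`). When y is used as part of a coordinate system, the
distribution is spanned by the remaining coordinate fields. Parallelism along (1, v) then says that
the forces in the y-directions do not depend on the remaining velocities, and granted this,
Φ-invariance says that they do not depend on the remaining positions either
(`force_eq_of_invariant`). Thus parallelism makes the distribution integrable and Φ-invariance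
closes the subsystem. For a complementary pair, the two families of first integrals together with t
form a chart.

The Frobenius theorem with parameter t (`exists_firstIntegral`) is obtained by transport along rays;
smooth dependence of the transport comes from the inverse function theorem in a Banach space of
curves. -/

/-! ### Calculus on spaces of continuous curves, and integral equations with parameters. -/

section CurveSpace

open Set Filter

variable {K : Type} [TopologicalSpace K] [CompactSpace K]
  {E F : Type} [NormedAddCommGroup E] [NormedSpace ℝ E] [NormedAddCommGroup F] [NormedSpace ℝ F]

/-- Pointwise application of continuous families of operators, as a bounded bilinear map. -/
noncomputable def ContinuousMap.applyBilin (K : Type) [TopologicalSpace K] [CompactSpace K]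
    (E F : Type) [NormedAddCommGroup E] [NormedSpace ℝ E] [NormedAddCommGroup F]
    [NormedSpace ℝ F] : C(K, E →L[ℝ] F) →L[ℝ] C(K, E) →L[ℝ] C(K, F) :=
  LinearMap.mkContinuous₂
    (LinearMap.mk₂ ℝ (fun (T : C(K, E →L[ℝ] F)) (γ : C(K, E)) =>
        (⟨fun s => T s (γ s), T.continuous.clm_apply γ.continuous⟩ : C(K, F)))
      (fun _ _ _ => by ext; simp) (fun _ _ _ => by ext; simp)
      (fun _ _ _ => by ext; simp) (fun _ _ _ => by ext; simp)) 1
    (fun T γ => by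
      rw [ContinuousMap.norm_le _ (by positivity)]
      intro s
      calc ‖T s (γ s)‖ ≤ ‖T s‖ * ‖γ s‖ := (T s).le_opNorm _
        _ ≤ 1 * ‖T‖ * ‖γ‖ := by
          rw [one_mul]
          exact mul_le_mul (T.norm_coe_le_norm s) (γ.norm_coe_le_norm s) (norm_nonneg _)
            (norm_nonneg T))

@[simp]
theorem ContinuousMap.applyBilin_apply (T : C(K, E →L[ℝ] F)) (γ : C(K, E)) (s : K) :
    ContinuousMap.applyBilin K E F T γ s = T s (γ s) := rfl

/-- Pointwise this is the mean value inequality. The estimate is uniform over `K` because `dh` acts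
continuously by postcomposition in the sup norm. -/
theorem ContinuousMap.hasFDerivAt_comp {h : C(E, F)} {dh : C(E, E →L[ℝ] F)}
    (hd : ∀ x, HasFDerivAt h (dh x) x) (γ : C(K, E)) :
    HasFDerivAt (fun γ : C(K, E) => h.comp γ) (ContinuousMap.applyBilin K E F (dh.comp γ)) γ := by
  rw [hasFDerivAt_iff_isLittleO, Asymptotics.isLittleO_iff]
  intro ε hε
  have hc : Continuous fun γ : C(K, E) => dh.comp γ := ContinuousMap.continuous_postcomp dh
  obtain ⟨δ, hδ, hball⟩ := (Metric.continuous_iff (α := C(K, E)) (β := C(K, E →L[ℝ] F))).1 hc γ ε hε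
  filter_upwards [Metric.ball_mem_nhds γ hδ] with η hη
  rw [ContinuousMap.norm_le _ (by positivity)]
  intro s
  have hs : ‖η s - γ s‖ < δ := by
    rw [← dist_eq_norm]
    exact (ContinuousMap.dist_apply_le_dist s).trans_lt hη
  have key : ∀ z ∈ Metric.ball (γ s) δ, ‖dh z - dh (γ s)‖ ≤ ε := by
    intro z hz
    -- Translating `γ` by a constant vector gives a curve through `z` at `s` that is still `δ`-close
    -- to `γ`, so the bound for curves becomes a bound at the point `z`.
    have h1 : dist (γ + ContinuousMap.const K (z - γ s)) γ < δ := by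
      rw [dist_eq_norm, add_sub_cancel_left]
      refine lt_of_le_of_lt ((ContinuousMap.norm_le _ (norm_nonneg (z - γ s))).2 fun _ => le_rfl) ?_
      rwa [← dist_eq_norm]
    have h2 := (ContinuousMap.dist_apply_le_dist s).trans_lt (hball _ h1)
    rw [dist_eq_norm] at h2
    simpa using h2.le
  have := (convex_ball (γ s) δ).norm_image_sub_le_of_norm_hasFDerivWithin_le'
    (fun z _ => (hd z).hasFDerivWithinAt) key (Metric.mem_ball_self hδ)
    (by rwa [Metric.mem_ball, dist_eq_norm] : η s ∈ Metric.ball (γ s) δ)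
  refine this.trans ?_
  gcongr
  exact (η - γ).norm_coe_le_norm s

/-- The derivative of a postcomposition operator is again one, given by `dh` and followed by a
bounded bilinear map. The target space therefore has to vary in the induction. -/
theorem ContinuousMap.contDiff_comp_nat (n : ℕ) : ∀ {F : Type} [NormedAddCommGroup F]
    [NormedSpace ℝ F] (h : C(E, F)), ContDiff ℝ n h →
    ContDiff ℝ n (fun γ : C(K, E) => h.comp γ) := by
  induction n with
  | zero =>
    intro F _ _ h _
    exact contDiff_zero.2 (ContinuousMap.continuous_postcomp h)
  | succ n ih =>
    intro F _ _ h hh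
    have h1 : ContDiff ℝ ((n : WithTop ℕ∞) + 1) h := by exact_mod_cast hh
    obtain ⟨dh, hdh, hd⟩ := contDiff_succ_iff_hasFDerivAt.1 h1
    have hm : ContDiff ℝ n (fun T : C(K, E →L[ℝ] F) => ContinuousMap.applyBilin K E F T) :=
      ContinuousLinearMap.contDiff (𝕜 := ℝ) (E := C(K, E →L[ℝ] F))
        (F := C(K, E) →L[ℝ] C(K, F)) (ContinuousMap.applyBilin K E F)
    have : ContDiff ℝ ((n : WithTop ℕ∞) + 1) (fun γ : C(K, E) => h.comp γ) :=
      contDiff_succ_iff_hasFDerivAt.2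
        ⟨fun γ => ContinuousMap.applyBilin K E F ((⟨dh, hdh.continuous⟩ : C(E, E →L[ℝ] F)).comp γ),
          hm.comp (ih ⟨dh, hdh.continuous⟩ hdh),
          fun γ => ContinuousMap.hasFDerivAt_comp (dh := ⟨dh, hdh.continuous⟩) hd γ⟩
    exact_mod_cast this

theorem ContinuousMap.contDiff_comp (h : C(E, F)) (hh : ContDiff ℝ ∞ h) :
    ContDiff ℝ ∞ (fun γ : C(K, E) => h.comp γ) :=
  contDiff_infty.2 fun n =>
    ContinuousMap.contDiff_comp_nat n h (hh.of_le (by exact_mod_cast le_top))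

/-- The inclusion of the constant curves. -/
noncomputable def constCLM (K : Type) [TopologicalSpace K] [CompactSpace K] (F : Type)
    [NormedAddCommGroup F] [NormedSpace ℝ F] : F →L[ℝ] C(K, F) :=
  LinearMap.mkContinuous
    { toFun := fun x => ContinuousMap.const K x
      map_add' := fun _ _ => rfl
      map_smul' := fun _ _ => rfl } 1
    (fun x => by
      rw [one_mul, ContinuousMap.norm_le _ (norm_nonneg x)]
      exact fun _ => le_rfl)

@[simp]
theorem constCLM_apply (x : F) (s : K) : constCLM K F x s = x := rfl

variable (F) in
/-- The primitive vanishing at `0`, as a bounded operator on curves. -/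
noncomputable def primitiveCLM [CompleteSpace F] : C(Icc (0 : ℝ) 1, F) →L[ℝ] C(Icc (0 : ℝ) 1, F) :=
  LinearMap.mkContinuous
    { toFun := fun γ => ⟨fun s => ∫ r in (0 : ℝ)..s, γ (projIcc 0 1 zero_le_one r),
        (intervalIntegral.continuous_primitive (fun _ _ =>
          (γ.continuous.comp continuous_projIcc).intervalIntegrable _ _) 0).comp
          continuous_subtype_val⟩
      map_add' := fun γ η => by
        ext s
        exact intervalIntegral.integral_add
          ((γ.continuous.comp continuous_projIcc).intervalIntegrable _ _)
          ((η.continuous.comp continuous_projIcc).intervalIntegrable _ _)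
      map_smul' := fun c γ => by
        ext s
        exact intervalIntegral.integral_smul c _ } 1
    (fun γ => by
      rw [ContinuousMap.norm_le _ (by positivity)]
      rintro ⟨s, hs⟩
      refine (intervalIntegral.norm_integral_le_of_norm_le_const
        (C := ‖γ‖) fun r _ => γ.norm_coe_le_norm _).trans ?_
      rw [sub_zero, abs_of_nonneg hs.1, one_mul]
      exact mul_le_of_le_one_right (norm_nonneg _) hs.2)

/-- A smooth map with invertible derivative has a smooth local inverse. -/
theorem exists_openPartialHomeomorph_of_contDiffAt {E F : Type*} [NormedAddCommGroup E]
    [NormedSpace ℝ E] [CompleteSpace E] [NormedAddCommGroup F] [NormedSpace ℝ F] {f : E → F} {a : E}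
    (hf : ∀ᶠ x in 𝓝 a, ContDiffAt ℝ ∞ f x) {f' : E ≃L[ℝ] F}
    (hf' : HasFDerivAt f (f' : E →L[ℝ] F) a) :
    ∃ e : OpenPartialHomeomorph E F, a ∈ e.source ∧ (∀ x, e x = f x) ∧
      (∀ x ∈ e.source, ContDiffAt ℝ ∞ f x) ∧ ∀ y ∈ e.target, ContDiffAt ℝ ∞ e.symm y := by
  have hfa := hf.self_of_nhds
  set e₀ := hfa.toOpenPartialHomeomorph f hf' (by simp)
  have hcoe : ∀ x, e₀ x = f x := fun x =>
    congrFun (hfa.toOpenPartialHomeomorph_coe hf' (by simp)) x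
  have ha : a ∈ e₀.source := hfa.mem_toOpenPartialHomeomorph_source hf' (by simp)
  have hcd : ContinuousAt (fderiv ℝ f) a :=
    (hfa.fderiv_right (m := 0) (by simp)).continuousAt
  have hev : ∀ᶠ x in 𝓝 a, fderiv ℝ f x ∈ range ((↑) : (E ≃L[ℝ] F) → E →L[ℝ] F) :=
    hcd.preimage_mem_nhds (by rw [hf'.fderiv]; exact ContinuousLinearEquiv.nhds f')
  obtain ⟨s, hs, hso, has⟩ := eventually_nhds_iff.1 (hf.and hev)
  -- The inverse is smooth only where the derivative is invertible, so the source is cut down to an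
  -- open set on which `f` is smooth with invertible derivative.
  refine ⟨e₀.restrOpen s hso, ⟨ha, has⟩, hcoe, fun x hx => (hs x hx.2).1, fun y hy => ?_⟩
  have hy' : e₀.symm y ∈ s := by
    have := (e₀.restrOpen s hso).map_target hy
    exact this.2
  obtain ⟨g', hg'⟩ := (hs _ hy').2
  have hyt : y ∈ e₀.target := ((e₀.restrOpen s hso).symm.map_source hy).1 |> fun _ => hy.1
  refine e₀.contDiffAt_symm hyt (f₀' := g') ?_ ?_
  · rw [hg', show (e₀ : E → F) = f from funext hcoe]
    exact ((hs _ hy').1.differentiableAt (by simp)).hasFDerivAt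
  · rw [show (e₀ : E → F) = f from funext hcoe]
    exact (hs _ hy').1

/-- Smooth dependence on parameters for an integral equation whose right-hand side vanishes at the
central parameter. -/
theorem exists_contDiff_family_of_integralEquation {P B : Type} [NormedAddCommGroup P]
    [NormedSpace ℝ P] [CompleteSpace P] [NormedAddCommGroup B] [NormedSpace ℝ B] [CompleteSpace B]
    (h : P × ℝ × B → B) (hh : ContDiff ℝ ∞ h) (p₀ : P) (h0 : ∀ s b, h (p₀, s, b) = 0)
    (c : P →L[ℝ] B) :
    ∃ γ : P → C(Icc (0 : ℝ) 1, B), (∀ᶠ p in 𝓝 p₀, ContDiffAt ℝ ∞ γ p) ∧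
      γ p₀ = ContinuousMap.const _ (c p₀) ∧
      ∀ᶠ p in 𝓝 p₀, ∀ s : Icc (0 : ℝ) 1,
        γ p s = c p + ∫ r in (0 : ℝ)..s, h (p, projIcc 0 1 zero_le_one r,
          γ p (projIcc 0 1 zero_le_one r)) ∧
        ∀ u, fderiv ℝ γ p u s = c u + ∫ r in (0 : ℝ)..s, fderiv ℝ h (p, projIcc 0 1 zero_le_one r,
          γ p (projIcc 0 1 zero_le_one r)) (u, 0, fderiv ℝ γ p u (projIcc 0 1 zero_le_one r)) := by
  set I := Icc (0 : ℝ) 1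
  set hC : C(P × ℝ × B, B) := ⟨h, hh.continuous⟩
  set ιP : P →L[ℝ] C(I, P × ℝ × B) :=
    (ContinuousLinearMap.inl ℝ P (ℝ × B)).compLeftContinuous ℝ I ∘L constCLM I P
  set ιB : C(I, B) →L[ℝ] C(I, P × ℝ × B) :=
    ((ContinuousLinearMap.inr ℝ P (ℝ × B)).comp
      (ContinuousLinearMap.inr ℝ ℝ B)).compLeftContinuous ℝ I
  set z₀ : C(I, P × ℝ × B) := ⟨fun s => (0, (s : ℝ), 0), by fun_prop⟩
  set Z : P × C(I, B) → C(I, P × ℝ × B) := fun x => ιP x.1 + ιB x.2 + z₀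
  have hZ : ∀ p γ (s : I), Z (p, γ) s = (p, (s : ℝ), γ s) := by
    intro p γ s
    simp [Z, ιP, ιB, z₀]
  have hZs : ContDiff ℝ ∞ Z :=
    ((ιP.contDiff.comp contDiff_fst).add (ιB.contDiff.comp contDiff_snd)).add contDiff_const
  set G : P × C(I, B) → C(I, B) := fun x => constCLM I B (c x.1) + primitiveCLM B (hC.comp (Z x))
  have hG : ContDiff ℝ ∞ G :=
    ((constCLM I B ∘L c).contDiff.comp contDiff_fst).add
      ((primitiveCLM B).contDiff.comp ((ContinuousMap.contDiff_comp hC hh).comp hZs))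
  have hGapp : ∀ p γ (s : I), G (p, γ) s = c p + ∫ r in (0 : ℝ)..s,
      h (p, projIcc 0 1 zero_le_one r, γ (projIcc 0 1 zero_le_one r)) := by
    intro p γ s
    refine congrArg (c p + ·) (intervalIntegral.integral_congr fun r _ => ?_)
    exact congrArg h (hZ p γ (projIcc 0 1 zero_le_one r))
  have hG0 : ∀ γ, G (p₀, γ) = ContinuousMap.const _ (c p₀) := by
    intro γ
    ext s
    rw [hGapp]
    simp [h0]
  set γ₀ : C(I, B) := ContinuousMap.const _ (c p₀)
  set G' := fderiv ℝ G (p₀, γ₀)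
  have hG' : HasFDerivAt G G' (p₀, γ₀) := (hG.differentiable (by simp) _).hasFDerivAt
  -- At `p₀` the right-hand side does not depend on the curve, so the partial derivative in the
  -- curve vanishes. This makes the derivative of `Ψ` unipotent, with the explicit inverse used
  -- below.
  have hG'B : ∀ η : C(I, B), G' (0, η) = 0 := by
    have h1 : HasFDerivAt (fun γ : C(I, B) => G (p₀, γ))
        (G' ∘L ContinuousLinearMap.inr ℝ P C(I, B)) γ₀ :=
      HasFDerivAt.comp γ₀ hG' (hasFDerivAt_prodMk_right p₀ γ₀)
    have h2 : HasFDerivAt (fun γ : C(I, B) => G (p₀, γ)) (0 : C(I, B) →L[ℝ] C(I, B)) γ₀ := by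
      rw [show (fun γ : C(I, B) => G (p₀, γ)) = fun _ => γ₀ from funext hG0]
      exact hasFDerivAt_const _ _
    intro η
    exact DFunLike.congr_fun (h1.unique h2) η
  have hsplit : ∀ (p : P) (η : C(I, B)), G' (p, η) = G' (p, 0) := by
    intro p η
    rw [show ((p, η) : P × C(I, B)) = (p, 0) + (0, η) by simp, map_add, hG'B, add_zero]
  set Ψ : P × C(I, B) → P × C(I, B) := fun x => (x.1, x.2 - G x)
  have hΨ : ContDiff ℝ ∞ Ψ := contDiff_fst.prodMk (contDiff_snd.sub hG)
  set Ψ' : (P × C(I, B)) ≃L[ℝ] (P × C(I, B)) := ContinuousLinearEquiv.equivOfInverse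
    ((ContinuousLinearMap.fst ℝ P C(I, B)).prod (ContinuousLinearMap.snd ℝ P C(I, B) - G'))
    ((ContinuousLinearMap.fst ℝ P C(I, B)).prod (ContinuousLinearMap.snd ℝ P C(I, B) + G'))
    (by
      rintro ⟨p, η⟩
      simp only [ContinuousLinearMap.prod_apply, ContinuousLinearMap.coe_fst',
        add_apply, sub_apply, ContinuousLinearMap.coe_snd',
        hsplit p η, hsplit p (η - G' (p, 0)), sub_add_cancel])
    (by
      rintro ⟨p, η⟩
      simp only [ContinuousLinearMap.prod_apply, ContinuousLinearMap.coe_fst',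
        add_apply, sub_apply, ContinuousLinearMap.coe_snd',
        hsplit p η, hsplit p (η + G' (p, 0)), add_sub_cancel_right])
  have hΨ' : HasFDerivAt Ψ (Ψ' : P × C(I, B) →L[ℝ] P × C(I, B)) (p₀, γ₀) :=
    hasFDerivAt_fst.prodMk (hasFDerivAt_snd.sub hG')
  obtain ⟨e, hmem, he, -, hes⟩ := exists_openPartialHomeomorph_of_contDiffAt
    (Filter.Eventually.of_forall fun x => hΨ.contDiffAt) hΨ'
  have hcenter : e (p₀, γ₀) = (p₀, 0) := by
    rw [he]
    simp only [Ψ, hG0]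
    rw [sub_self]
  have htarget : ∀ᶠ p in 𝓝 p₀, ((p, 0) : P × C(I, B)) ∈ e.target := by
    have hc : ContinuousAt (fun p : P => ((p, 0) : P × C(I, B))) p₀ := by fun_prop
    exact hc.preimage_mem_nhds (e.open_target.mem_nhds (hcenter ▸ e.map_source hmem))
  have hfst : ∀ p, ((p, 0) : P × C(I, B)) ∈ e.target → e.symm (p, 0) = (p, (e.symm (p, 0)).2) ∧
      (e.symm (p, 0)).2 = G (p, (e.symm (p, 0)).2) := by
    intro p hp
    have h1 := e.right_inv hp
    rw [he] at h1
    have h2 : (e.symm (p, 0)).1 = p := congrArg Prod.fst h1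
    have h3 : (e.symm (p, 0)).2 - G (e.symm (p, 0)) = 0 := congrArg Prod.snd h1
    have h4 : e.symm (p, 0) = (p, (e.symm (p, 0)).2) := Prod.ext h2 rfl
    exact ⟨h4, by rw [← h4]; exact sub_eq_zero.1 h3⟩
  -- The equation `Ψ (p, γ) = (p, 0)` says that `γ` solves the integral equation with parameter `p`.
  -- Differentiating this fixed point identity later yields the linearized equation.
  set γ : P → C(I, B) := fun p => (e.symm (p, 0)).2
  have hγ : ∀ p, ((p, 0) : P × C(I, B)) ∈ e.target → ContDiffAt ℝ ∞ γ p := fun p hp =>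
    contDiffAt_snd.comp p ((hes _ hp).comp p (contDiffAt_id.prodMk contDiffAt_const))
  refine ⟨γ, ?_, ?_, ?_⟩
  · filter_upwards [htarget] with p hp using hγ p hp
  · show (e.symm (p₀, 0)).2 = _
    rw [← hcenter, e.left_inv hmem]
  · filter_upwards [htarget.eventually_nhds] with p hp' s
    have hp := hp'.self_of_nhds
    have hfix : γ =ᶠ[𝓝 p] fun p => G (p, γ p) := by
      filter_upwards [hp'] with x hx using (hfst x hx).2
    refine ⟨?_, fun u => ?_⟩
    · conv_lhs => rw [show γ p = G (p, γ p) from (hfst p hp).2]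
      exact hGapp _ _ _
    set dhC : C(P × ℝ × B, P × ℝ × B →L[ℝ] B) := ⟨fderiv ℝ h, hh.continuous_fderiv (by simp)⟩
    have hγ' : HasFDerivAt γ (fderiv ℝ γ p) p := ((hγ p hp).differentiableAt (by simp)).hasFDerivAt
    have hZ' : HasFDerivAt (fun p => Z (p, γ p)) (ιP + ιB ∘L fderiv ℝ γ p) p :=
      (ιP.hasFDerivAt.add (ιB.hasFDerivAt.comp p hγ')).add_const z₀
    have hN₀ := ContinuousMap.hasFDerivAt_comp (K := I) (h := hC) (dh := dhC)
      (fun x => (hh.differentiable (by simp) x).hasFDerivAt) (Z (p, γ p))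
    have hN : HasFDerivAt (fun p => hC.comp (Z (p, γ p)))
        (ContinuousMap.applyBilin I _ _ (dhC.comp (Z (p, γ p))) ∘L (ιP + ιB ∘L fderiv ℝ γ p)) p :=
      HasFDerivAt.comp (g := fun η : C(I, P × ℝ × B) => hC.comp η) p hN₀ hZ'
    have hG2 : HasFDerivAt (fun p => G (p, γ p)) _ p :=
      ((constCLM I B ∘L c).hasFDerivAt).add ((primitiveCLM B).hasFDerivAt.comp p hN)
    have := DFunLike.congr_fun (DFunLike.congr_fun
      ((hγ'.congr_of_eventuallyEq hfix.symm).unique hG2) u) s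
    rw [this]
    refine congrArg (c u + ·) (intervalIntegral.integral_congr fun r _ => ?_)
    show fderiv ℝ h (Z (p, γ p) (projIcc 0 1 zero_le_one r)) _ = _
    rw [hZ]
    congr 1
    simp [ιP, ιB]

/-- A map that is smooth near a point agrees there with a globally smooth one. -/
theorem exists_contDiff_eventuallyEq {E F : Type*} [NormedAddCommGroup E] [NormedSpace ℝ E]
    [FiniteDimensional ℝ E] [NormedAddCommGroup F] [NormedSpace ℝ F] {f : E → F} {a : E}
    (hf : ∀ᶠ x in 𝓝 a, ContDiffAt ℝ ∞ f x) : ∃ g : E → F, ContDiff ℝ ∞ g ∧ g =ᶠ[𝓝 a] f := by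
  obtain ⟨ε, hε, hball⟩ := Metric.eventually_nhds_iff_ball.1 hf
  set φ : ContDiffBump a := ⟨ε / 4, ε / 2, by positivity, by linarith⟩
  refine ⟨fun x => φ x • f x, contDiff_iff_contDiffAt.2 fun x => ?_, ?_⟩
  · by_cases hx : x ∈ Metric.ball a ε
    · exact φ.contDiffAt.smul (hball x hx)
    · have hx' : x ∉ tsupport φ := by
        rw [φ.tsupport_eq]
        intro h
        exact hx (Metric.closedBall_subset_ball (by show ε / 2 < ε; linarith) h)
      refine (contDiffAt_const (c := (0 : F))).congr_of_eventuallyEq ?_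
      filter_upwards [(isClosed_tsupport φ).isOpen_compl.mem_nhds hx'] with y hy
      simp [image_eq_zero_of_notMem_tsupport hy]
  · filter_upwards [φ.eventuallyEq_one] with x hx
    simp [hx]

end CurveSpace

/-! ### The Frobenius theorem with parameters. -/

section Frobenius

open Set Filter

variable {T A B : Type} [NormedAddCommGroup T] [NormedSpace ℝ T]
  [NormedAddCommGroup A] [NormedSpace ℝ A] [NormedAddCommGroup B] [NormedSpace ℝ B]

/-- Along a solution of `x' = L(t, a₀ + s a, x) a`, the solution `ζ` of the equation linearized in
the direction `α` is `s L(t, a₀ + s a, x) α`, if `L` satisfies the integrability condition. -/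
theorem linearized_eq_of_integrable {L : T × A × B → A →L[ℝ] B} (hL : ContDiff ℝ ∞ L)
    {t : T} {a₀ a : A} {x ζ : ℝ → B} (α : A)
    (hint : ∀ s ∈ Icc (0 : ℝ) 1,
      fderiv ℝ L (t, a₀ + s • a, x s) (0, a, L (t, a₀ + s • a, x s) a) α =
      fderiv ℝ L (t, a₀ + s • a, x s) (0, α, L (t, a₀ + s • a, x s) α) a)
    (hx : ∀ s ∈ Icc (0 : ℝ) 1, HasDerivAt x (L (t, a₀ + s • a, x s) a) s)
    (hζ : ∀ s ∈ Icc (0 : ℝ) 1, HasDerivAt ζ (L (t, a₀ + s • a, x s) α +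
      fderiv ℝ L (t, a₀ + s • a, x s) (0, s • α, ζ s) a) s) (hζ0 : ζ 0 = 0) :
    ∀ s ∈ Icc (0 : ℝ) 1, ζ s = s • L (t, a₀ + s • a, x s) α := by
  set z : ℝ → T × A × B := fun s => (t, a₀ + s • a, x s)
  have hz : ∀ s ∈ Icc (0 : ℝ) 1, HasDerivAt z (0, a, L (z s) a) s := by
    intro s hs
    have h1 : HasDerivAt (fun s : ℝ => a₀ + s • a) a s := by
      simpa using ((hasDerivAt_id s).smul_const a).const_add a₀
    exact (hasDerivAt_const s t).prodMk (h1.prodMk (hx s hs))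
  have hLz : ∀ s ∈ Icc (0 : ℝ) 1,
      HasDerivAt (fun s => L (z s) α) (fderiv ℝ L (z s) (0, a, L (z s) a) α) s := by
    intro s hs
    have h1 := ((hL.differentiable (by simp) (z s)).hasFDerivAt).comp_hasDerivAt s (hz s hs)
    simpa using h1.clm_apply (hasDerivAt_const s α)
  -- By integrability the defect `W` solves a homogeneous linear equation. Since it starts at zero,
  -- Grönwall's inequality forces it to vanish.
  set W : ℝ → B := fun s => ζ s - s • L (z s) α
  have hW : ∀ s ∈ Icc (0 : ℝ) 1, HasDerivAt W (fderiv ℝ L (z s) (0, 0, W s) a) s := by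
    intro s hs
    refine HasDerivAt.congr_deriv ((hζ s hs).sub ((hasDerivAt_id s).smul (hLz s hs))) ?_
    symm
    have e1 : ((0, 0, W s) : T × A × B) = (0, s • α, ζ s) - s • (0, α, L (z s) α) := by
      simp [W]
    rw [e1, map_sub, map_smul, sub_apply, smul_apply, ← hint s hs]
    simp only [id, one_smul]
    show _ = L (z s) α + fderiv ℝ L (z s) (0, s • α, ζ s) a - _
    abel
  have hzc : ContinuousOn z (Icc 0 1) := fun s hs => (hz s hs).continuousAt.continuousWithinAt
  obtain ⟨C, hC⟩ := isCompact_Icc.exists_bound_of_continuousOn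
    ((hL.continuous_fderiv (by simp)).comp_continuousOn hzc)
  have hbound : ∀ s ∈ Icc (0 : ℝ) 1,
      ‖fderiv ℝ L (z s) (0, 0, W s) a‖ ≤ (C * ‖a‖) * ‖W s‖ + 0 := by
    intro s hs
    have h1 : ‖((0, 0, W s) : T × A × B)‖ = ‖W s‖ := by simp [Prod.norm_def]
    calc ‖fderiv ℝ L (z s) (0, 0, W s) a‖
        ≤ ‖fderiv ℝ L (z s)‖ * ‖((0, 0, W s) : T × A × B)‖ * ‖a‖ :=
          (fderiv ℝ L (z s)).le_opNorm₂ _ _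
      _ ≤ C * ‖W s‖ * ‖a‖ := by rw [h1]; gcongr; exact hC s hs
      _ = _ := by ring
  intro s hs
  have := norm_le_gronwallBound_of_norm_deriv_right_le (δ := 0)
    (fun s hs => (hW s hs).continuousAt.continuousWithinAt)
    (fun s hs => (hW s (Ico_subset_Icc_self hs)).hasDerivWithinAt)
    (by simp [W, hζ0]) (fun s hs => hbound s (Ico_subset_Icc_self hs)) s hs
  rw [gronwallBound_ε0_δ0] at this
  exact sub_eq_zero.1 (norm_le_zero_iff.1 this)

/-- Frobenius theorem for a smooth total differential equation `db = L(t, a, b) da`, depending on a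
parameter `t`: there is a smooth submersion to `B` that is constant along the solutions. -/
theorem exists_firstIntegral_of_contDiff [CompleteSpace T] [CompleteSpace A] [CompleteSpace B]
    {L : T × A × B → A →L[ℝ] B} (hL : ContDiff ℝ ∞ L)
    (q₀ : T × A × B)
    (hint : ∀ᶠ q in 𝓝 q₀, ∀ α β, fderiv ℝ L q (0, α, L q α) β = fderiv ℝ L q (0, β, L q β) α) :
    ∃ y : T × A × B → B, (∀ᶠ q in 𝓝 q₀, ContDiffAt ℝ ∞ y q) ∧
      (∀ᶠ q in 𝓝 q₀, ∀ α, fderiv ℝ y q (0, α, L q α) = 0) ∧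
      ∀ β, fderiv ℝ y q₀ (0, 0, β) = β := by
  obtain ⟨t₀, a₀, b₀⟩ := q₀
  -- Along the ray s ↦ a₀ + s a the total differential equation becomes x' = L(t, a₀ + s a, x) a.
  -- Its right-hand side vanishes for a = 0, so `(t₀, 0, b₀)` can serve as central parameter.
  set h : (T × A × B) × ℝ × B → B := fun x => L (x.1.1, a₀ + x.2.1 • x.1.2.1, x.2.2) x.1.2.1
  have hh : ContDiff ℝ ∞ h := by
    refine ContDiff.clm_apply (hL.comp ?_) (by fun_prop)
    fun_prop
  have hh' : ∀ (t : T) (a : A) (c : B) (s : ℝ) (b : B) (α : A) (β γ : B),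
      fderiv ℝ h ((t, a, c), s, b) ((0, α, γ), 0, β) = L (t, a₀ + s • a, b) α +
        fderiv ℝ L (t, a₀ + s • a, b) (0, s • α, β) a := by
    intro t a c s b α β γ
    have hl : ∀ {E : Type} [NormedAddCommGroup E] [NormedSpace ℝ E] (x u : E),
        HasDerivAt (fun r : ℝ => x + r • u) u 0 := fun x u => by
      simpa using ((hasDerivAt_id (0 : ℝ)).smul_const u).const_add x
    set ℓ : ℝ → (T × A × B) × ℝ × B := fun r => ((t, a, c), s, b) + r • ((0, α, γ), 0, β)
    have hℓ0 : ℓ 0 = ((t, a, c), s, b) := by simp [ℓ]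
    have h1 : HasDerivAt (h ∘ ℓ) (fderiv ℝ h (ℓ 0) ((0, α, γ), 0, β)) 0 :=
      (hh.differentiable (by simp) _).hasFDerivAt.comp_hasDerivAt 0 (hl _ _)
    have hu : HasDerivAt (fun r : ℝ => (t, a₀ + s • (a + r • α), b + r • β)) (0, s • α, β) 0 :=
      (hasDerivAt_const _ _).prodMk ((((hl a α).const_smul s).const_add a₀).prodMk (hl b β))
    have h2 := ((hL.differentiable (by simp) _).hasFDerivAt.comp_hasDerivAt 0 hu).clm_apply (hl a α)
    have h3 : HasDerivAt (h ∘ ℓ) _ 0 := h2.congr_of_eventuallyEq (Eventually.of_forall fun r => by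
      simp [h, ℓ])
    have := h1.unique h3
    rw [hℓ0] at this
    rw [this]
    simp [add_comm]
  set c : T × A × B →L[ℝ] B :=
    ContinuousLinearMap.snd ℝ A B ∘L ContinuousLinearMap.snd ℝ T (A × B)
  obtain ⟨γ, hγs, hγ0, hγ⟩ := exists_contDiff_family_of_integralEquation h hh (t₀, 0, b₀)
    (by simp [h]) c
  have hone : (1 : ℝ) ∈ Icc (0 : ℝ) 1 := ⟨zero_le_one, le_rfl⟩
  -- `F (t, a, b)` is the value over a₀ + a of the solution that starts at b over a₀.
  set F : T × A × B → B := fun p => γ p ⟨1, hone⟩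
  have hF : ∀ᶠ p in 𝓝 (t₀, 0, b₀), ContDiffAt ℝ ∞ F p := by
    filter_upwards [hγs] with p hp
    exact (ContinuousMap.evalCLM ℝ (⟨1, hone⟩ : Icc (0 : ℝ) 1)).contDiff.contDiffAt.comp p hp
  have hFd : ∀ᶠ p in 𝓝 ((t₀, 0, b₀) : T × A × B), ∀ α,
      fderiv ℝ F p (0, α, 0) = L (p.1, a₀ + p.2.1, F p) α := by
    obtain ⟨ε, hε, hball⟩ := Metric.eventually_nhds_iff_ball.1 hint
    have hnear : ∀ᶠ p in 𝓝 ((t₀, 0, b₀) : T × A × B),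
        dist p (t₀, 0, b₀) < ε ∧ dist (γ p) (γ (t₀, 0, b₀)) < ε :=
      Filter.inter_mem (Metric.ball_mem_nhds _ hε)
        (hγs.self_of_nhds.continuousAt.preimage_mem_nhds (Metric.ball_mem_nhds _ hε))
    filter_upwards [hγs, hγ, hnear] with p hp hpγ hpn α
    obtain ⟨t, a, b⟩ := p
    -- The whole transport path has to stay in the ball where the integrability condition is
    -- available.
    have hgood : ∀ s (hs : s ∈ Icc (0 : ℝ) 1),
        (t, a₀ + s • a, γ (t, a, b) ⟨s, hs⟩) ∈ Metric.ball (t₀, a₀, b₀) ε := by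
      intro s hs
      have hd := hpn.1
      simp only [Prod.dist_eq, max_lt_iff, dist_zero_right] at hd
      have h1 : dist (γ (t, a, b) ⟨s, hs⟩) b₀ < ε := by
        have := (ContinuousMap.dist_apply_le_dist (⟨s, hs⟩ : Icc (0 : ℝ) 1)).trans_lt hpn.2
        rwa [hγ0] at this
      have h2 : dist (a₀ + s • a) a₀ < ε := by
        rw [dist_eq_norm, add_sub_cancel_left, norm_smul, Real.norm_of_nonneg hs.1]
        exact (mul_le_of_le_one_left (norm_nonneg _) hs.2).trans_lt hd.2.1
      simp only [Metric.mem_ball, Prod.dist_eq, max_lt_iff]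
      exact ⟨hd.1, h2, h1⟩
    set P : ℝ → Icc (0 : ℝ) 1 := projIcc 0 1 zero_le_one
    have hP : Continuous P := continuous_projIcc
    set p : T × A × B := (t, a, b)
    set ζ₀ := fderiv ℝ γ p (0, α, 0)
    set x : ℝ → B := fun s => c p + ∫ r in (0 : ℝ)..s, h (p, P r, γ p (P r))
    set ζ : ℝ → B := fun s => c (0, α, 0) + ∫ r in (0 : ℝ)..s,
      fderiv ℝ h (p, P r, γ p (P r)) ((0, α, 0), 0, ζ₀ (P r))
    have hxγ : ∀ s (hs : s ∈ Icc (0 : ℝ) 1), γ p ⟨s, hs⟩ = x s := fun s hs => (hpγ ⟨s, hs⟩).1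
    have hζγ : ∀ s (hs : s ∈ Icc (0 : ℝ) 1), ζ₀ ⟨s, hs⟩ = ζ s := fun s hs =>
      (hpγ ⟨s, hs⟩).2 (0, α, 0)
    have hPs : ∀ s (hs : s ∈ Icc (0 : ℝ) 1), P s = ⟨s, hs⟩ := fun s hs => projIcc_of_mem _ hs
    have hpath : Continuous fun r => (p, (P r : ℝ), γ p (P r)) := by fun_prop
    have hx : ∀ s ∈ Icc (0 : ℝ) 1, HasDerivAt x (L (t, a₀ + s • a, x s) a) s := by
      intro s hs
      have h1 := ((hh.continuous.comp hpath).integral_hasStrictDerivAt 0 s).hasDerivAt.const_add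
        (c p)
      refine h1.congr_deriv ?_
      simp only [Function.comp, hPs s hs, hxγ s hs]
      rfl
    have hζ : ∀ s ∈ Icc (0 : ℝ) 1, HasDerivAt ζ (L (t, a₀ + s • a, x s) α +
        fderiv ℝ L (t, a₀ + s • a, x s) (0, s • α, ζ s) a) s := by
      intro s hs
      have hcont : Continuous fun r => fderiv ℝ h (p, P r, γ p (P r)) ((0, α, 0), 0, ζ₀ (P r)) :=
        ((hh.continuous_fderiv (by simp)).comp hpath).clm_apply (by fun_prop)
      have h1 := (hcont.integral_hasStrictDerivAt 0 s).hasDerivAt.const_add (c (0, α, 0))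
      refine h1.congr_deriv ?_
      simp only [hPs s hs, hxγ s hs, hζγ s hs]
      exact hh' _ _ _ _ _ _ _ _
    have hlin := linearized_eq_of_integrable hL α (fun s hs => (hball _ (by
      rw [← hxγ s hs]; exact hgood s hs)) a α) hx hζ (by simp [ζ, c]) 1 hone
    rw [one_smul, one_smul, ← hxγ 1 hone, ← hζγ 1 hone] at hlin
    have hFp : HasFDerivAt F
        (ContinuousMap.evalCLM ℝ (⟨1, hone⟩ : Icc (0 : ℝ) 1) ∘L fderiv ℝ γ p) p :=
      HasFDerivAt.comp (g := fun η : C(Icc (0 : ℝ) 1, B) => η ⟨1, hone⟩) p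
        (ContinuousLinearMap.hasFDerivAt (E := C(Icc (0 : ℝ) 1, B))
          (ContinuousMap.evalCLM ℝ (⟨1, hone⟩ : Icc (0 : ℝ) 1)))
        (hp.differentiableAt (by simp)).hasFDerivAt
    rw [hFp.fderiv]
    exact hlin
  have hF0 : ∀ᶠ x in 𝓝 (t₀, b₀), F (x.1, 0, x.2) = x.2 := by
    have hc : ContinuousAt (fun x : T × B => ((x.1, 0, x.2) : T × A × B)) (t₀, b₀) := by fun_prop
    filter_upwards [hc.eventually hγ] with x hx
    have := (hx ⟨1, hone⟩).1
    refine this.trans ?_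
    simp [h, c]
  -- The first integral is the last component of the inverse of `Ψ`: it sends a point to the initial
  -- value over a₀ of the solution through it.
  set Ψ : T × A × B → T × A × B := fun p => (p.1, a₀ + p.2.1, F p)
  have hΨ : ∀ᶠ p in 𝓝 (t₀, 0, b₀), ContDiffAt ℝ ∞ Ψ p := by
    filter_upwards [hF] with p hp
    exact contDiffAt_fst.prodMk ((by fun_prop : ContDiffAt ℝ ∞ (fun p : T × A × B => a₀ + p.2.1) p
      ).prodMk hp)
  have hΨd : ∀ p, DifferentiableAt ℝ F p →
      HasFDerivAt Ψ ((ContinuousLinearMap.fst ℝ T (A × B)).prod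
        ((ContinuousLinearMap.fst ℝ A B ∘L ContinuousLinearMap.snd ℝ T (A × B)).prod
          (fderiv ℝ F p))) p := by
    intro p hp
    refine hasFDerivAt_fst.prodMk (HasFDerivAt.prodMk ?_ hp.hasFDerivAt)
    exact ((ContinuousLinearMap.fst ℝ A B ∘L
      ContinuousLinearMap.snd ℝ T (A × B)).hasFDerivAt).const_add a₀
  have hFp₀ : DifferentiableAt ℝ F (t₀, 0, b₀) := hF.self_of_nhds.differentiableAt (by simp)
  have hF' : ∀ τ α β, fderiv ℝ F (t₀, 0, b₀) (τ, α, β) = L (t₀, a₀, b₀) α + β := by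
    intro τ α β
    have hb : F (t₀, 0, b₀) = b₀ := hF0.self_of_nhds
    have h1 := hFd.self_of_nhds α
    rw [hb] at h1
    have h2 : HasFDerivAt (fun x : T × B => ((x.1, 0, x.2) : T × A × B))
        ((ContinuousLinearMap.fst ℝ T B).prod ((0 : T × B →L[ℝ] A).prod
          (ContinuousLinearMap.snd ℝ T B))) (t₀, b₀) :=
      hasFDerivAt_fst.prodMk ((hasFDerivAt_const _ _).prodMk hasFDerivAt_snd)
    have h3 := (HasFDerivAt.comp (t₀, b₀) hFp₀.hasFDerivAt h2).congr_of_eventuallyEq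
      (hF0.mono fun x hx => hx.symm)
    have h4 : fderiv ℝ F (t₀, 0, b₀) (τ, 0, β) = β :=
      DFunLike.congr_fun (h3.unique hasFDerivAt_snd) (τ, β)
    rw [show ((τ, α, β) : T × A × B) = (0, α, 0) + (τ, 0, β) by simp, map_add, h1, h4, add_zero]
  set L₀ := L (t₀, a₀, b₀)
  set Ψ' : (T × A × B) ≃L[ℝ] (T × A × B) := ContinuousLinearEquiv.equivOfInverse
    ((ContinuousLinearMap.fst ℝ T (A × B)).prod
        ((ContinuousLinearMap.fst ℝ A B ∘L ContinuousLinearMap.snd ℝ T (A × B)).prod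
          (fderiv ℝ F (t₀, 0, b₀))))
    ((ContinuousLinearMap.fst ℝ T (A × B)).prod
        ((ContinuousLinearMap.fst ℝ A B ∘L ContinuousLinearMap.snd ℝ T (A × B)).prod
          (c - L₀ ∘L ContinuousLinearMap.fst ℝ A B ∘L ContinuousLinearMap.snd ℝ T (A × B))))
    (by rintro ⟨τ, α, β⟩; simp [hF', c]) (by rintro ⟨τ, α, β⟩; simp [hF', c])
  obtain ⟨e, hmem, he, -, hes⟩ := exists_openPartialHomeomorph_of_contDiffAt hΨ (f' := Ψ')
    (hΨd _ hFp₀)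
  have he0 : e (t₀, 0, b₀) = (t₀, a₀, b₀) := by
    rw [he]
    simp only [Ψ, add_zero]
    rw [show F (t₀, 0, b₀) = b₀ from hF0.self_of_nhds]
  have hq₀ : (t₀, a₀, b₀) ∈ e.target := he0 ▸ e.map_source hmem
  have hsymm0 : e.symm (t₀, a₀, b₀) = (t₀, 0, b₀) := by rw [← he0, e.left_inv hmem]
  have hys : ∀ q ∈ e.target, ContDiffAt ℝ ∞ (fun q => c (e.symm q)) q := fun q hq =>
    c.contDiff.contDiffAt.comp q (hes q hq)
  have hchain : ∀ p ∈ e.source, DifferentiableAt ℝ F p → ∀ u,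
      fderiv ℝ (fun q => c (e.symm q)) (Ψ p) (u.1, u.2.1, fderiv ℝ F p u) = c u := by
    intro p hp hFp u
    have hp' : Ψ p ∈ e.target := he p ▸ e.map_source hp
    have h1 : HasFDerivAt (fun p => c (e.symm (Ψ p))) _ p :=
      HasFDerivAt.comp (g := fun q => c (e.symm q)) p
        ((hys _ hp').differentiableAt (by simp)).hasFDerivAt (hΨd p hFp)
    have h2 : HasFDerivAt (fun p => c (e.symm (Ψ p))) c p := by
      refine c.hasFDerivAt.congr_of_eventuallyEq ?_
      filter_upwards [e.open_source.mem_nhds hp] with x hx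
      rw [← he, e.left_inv hx]
    exact DFunLike.congr_fun (h1.unique h2) u
  refine ⟨fun q => c (e.symm q), ?_, ?_, fun β => ?_⟩
  · filter_upwards [e.open_target.mem_nhds hq₀] with q hq using hys q hq
  · have hc : Tendsto e.symm (𝓝 (t₀, a₀, b₀)) (𝓝 (t₀, 0, b₀)) := by
      have := (e.continuousAt_symm hq₀).tendsto
      rwa [hsymm0] at this
    filter_upwards [e.open_target.mem_nhds hq₀, hc.eventually (hFd.and hF)] with q hq hq' α
    have hΨq : Ψ (e.symm q) = q := by rw [← he, e.right_inv hq]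
    have h1 := hchain _ (e.map_target hq) (hq'.2.differentiableAt (by simp)) (0, α, 0)
    rw [hq'.1 α] at h1
    have h2 : ((e.symm q).1, a₀ + (e.symm q).2.1, F (e.symm q)) = q := hΨq
    rw [h2, hΨq] at h1
    simpa [c] using h1
  · have h1 := hchain _ hmem hFp₀ (0, 0, β)
    rw [hF', map_zero, zero_add, ← he, he0] at h1
    simpa [c] using h1

/-- Local version of `exists_firstIntegral_of_contDiff`. -/
theorem exists_firstIntegral [FiniteDimensional ℝ T] [FiniteDimensional ℝ A]
    [FiniteDimensional ℝ B] {L : T × A × B → A →L[ℝ] B} {q₀ : T × A × B}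
    (hL : ∀ᶠ q in 𝓝 q₀, ContDiffAt ℝ ∞ L q)
    (hint : ∀ᶠ q in 𝓝 q₀, ∀ α β, fderiv ℝ L q (0, α, L q α) β = fderiv ℝ L q (0, β, L q β) α) :
    ∃ y : T × A × B → B, (∀ᶠ q in 𝓝 q₀, ContDiffAt ℝ ∞ y q) ∧
      (∀ᶠ q in 𝓝 q₀, ∀ α, fderiv ℝ y q (0, α, L q α) = 0) ∧
      ∀ β, fderiv ℝ y q₀ (0, 0, β) = β := by
  have := FiniteDimensional.complete ℝ T
  have := FiniteDimensional.complete ℝ A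
  have := FiniteDimensional.complete ℝ B
  obtain ⟨L', hL', heq⟩ := exists_contDiff_eventuallyEq hL
  obtain ⟨y, h1, h2, h3⟩ := exists_firstIntegral_of_contDiff hL' q₀ (by
    filter_upwards [heq.eventually_nhds, hint] with q hq hq'
    have hq2 : L' =ᶠ[𝓝 q] L := hq
    rw [hq2.fderiv_eq, hq2.self_of_nhds]
    exact hq')
  refine ⟨y, h1, ?_, h3⟩
  filter_upwards [h2, heq] with q hq hq'
  rwa [← hq']

end Frobenius

/-! ### Differential consequences of a closed subsystem, in coordinates. -/

section ModelCalculus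

open Set Filter

variable {n : ℕ}

/-- The base point `(t, x)` of `(t, x, v)`. -/
def jetPos (p : JetModel n) : EventModel n := (p.1, p.2.1)

/-- The velocity `(1, v)` of `(t, x, v)`. -/
def jetVel (p : JetModel n) : EventModel n := (1, p.2.2)

/-- In coordinates, the covariant derivative `D_u σ` of a vertical section `σ` with components `s`,
for the equation `ẍ = f(t, x, ẋ)`. -/
noncomputable def vertCovDeriv (f : JetModel n → Fin n → ℝ) (s : JetModel n → Fin n → ℝ)
    (u p : JetModel n) : Fin n → ℝ :=
  fderiv ℝ s p u - (1 / 2 : ℝ) • u.1 • fderiv ℝ f p (0, 0, s p) -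
    (1 / 2 : ℝ) • fderiv ℝ (fderiv ℝ f) p (0, 0, u.2.1 - u.1 • p.2.2) (0, 0, s p)

/-- In coordinates, the Jacobi endomorphism of the equation `ẍ = f(t, x, ẋ)`. -/
noncomputable def vertJacobi (f : JetModel n → Fin n → ℝ) (p : JetModel n) (s : Fin n → ℝ) :
    Fin n → ℝ :=
  -fderiv ℝ f p (0, s, 0) - (1 / 4 : ℝ) • fderiv ℝ f p (0, 0, fderiv ℝ f p (0, 0, s)) +
    (1 / 2 : ℝ) • fderiv ℝ (fderiv ℝ f) p (1, p.2.2, f p) (0, 0, s)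

theorem natCast_le_infty (k : ℕ) : (k : WithTop ℕ∞) ≤ ∞ := by
  exact_mod_cast le_top

theorem hasDerivAt_line {E : Type*} [NormedAddCommGroup E] [NormedSpace ℝ E] (x u : E) :
    HasDerivAt (fun r : ℝ => x + r • u) u 0 := by
  simpa using ((hasDerivAt_id (0 : ℝ)).smul_const u).const_add x

theorem hasDerivAt_comp_line {E F : Type*} [NormedAddCommGroup E] [NormedSpace ℝ E]
    [NormedAddCommGroup F] [NormedSpace ℝ F] {f : E → F} {x : E} (hf : DifferentiableAt ℝ f x)
    (u : E) : HasDerivAt (fun r : ℝ => f (x + r • u)) (fderiv ℝ f x u) 0 := by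
  have h0 : x = x + (0 : ℝ) • u := by simp
  have h1 : HasFDerivAt f (fderiv ℝ f x) (x + (0 : ℝ) • u) := by
    rw [← h0]; exact hf.hasFDerivAt
  exact h1.comp_hasDerivAt (0 : ℝ) (hasDerivAt_line x u)

theorem tendsto_line {E : Type*} [NormedAddCommGroup E] [NormedSpace ℝ E] (x u : E) :
    Tendsto (fun r : ℝ => x + r • u) (𝓝 0) (𝓝 x) := by
  have := (hasDerivAt_line x u).continuousAt.tendsto
  simpa using this

/-- The functions `y` satisfy, along the solutions of `ẍ = f(t, x, ẋ)`, the equation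
`ÿ = g(t, y, ẏ)`, at the point `p`. -/
def ClosesAt {F : Type*} [NormedAddCommGroup F] [NormedSpace ℝ F] (f : JetModel n → Fin n → ℝ)
    (y : EventModel n → F) (g : ℝ × F × F → F) (p : JetModel n) : Prop :=
  fderiv ℝ (fderiv ℝ y) (jetPos p) (jetVel p) (jetVel p) + fderiv ℝ y (jetPos p) (0, f p) =
    g (p.1, y (jetPos p), fderiv ℝ y (jetPos p) (jetVel p))

variable {F : Type*} [NormedAddCommGroup F] [NormedSpace ℝ F] {f : JetModel n → Fin n → ℝ}
  {y : EventModel n → F} {g : ℝ × F × F → F} {p : JetModel n}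

theorem hasDerivAt_jetVel_line (p X : JetModel n) :
    HasDerivAt (fun r : ℝ => jetVel (p + r • X)) (0, X.2.2) 0 :=
  (hasDerivAt_const 0 (1 : ℝ)).prodMk (hasDerivAt_line p.2.2 X.2.2)

theorem hasDerivAt_comp_jetPos_line {G : Type*} [NormedAddCommGroup G] [NormedSpace ℝ G]
    {k : EventModel n → G} (hk : DifferentiableAt ℝ k (jetPos p)) (X : JetModel n) :
    HasDerivAt (fun r : ℝ => k (jetPos (p + r • X))) (fderiv ℝ k (jetPos p) (jetPos X)) 0 :=
  hasDerivAt_comp_line hk (jetPos X)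

theorem hasDerivAt_zero_prodMk {s : ℝ → Fin n → ℝ} {s' : Fin n → ℝ} (hs : HasDerivAt s s' 0) :
    HasDerivAt (fun r => ((0, s r) : EventModel n)) (0, s') 0 :=
  (hasDerivAt_const 0 (0 : ℝ)).prodMk hs

/-- The derivative of the base data `(t, y, ẏ)` along a line. -/
theorem hasDerivAt_reduced_line (hy : ContDiffAt ℝ 3 y (jetPos p)) (X : JetModel n) :
    HasDerivAt (fun r : ℝ => ((p + r • X).1, y (jetPos (p + r • X)),
        fderiv ℝ y (jetPos (p + r • X)) (jetVel (p + r • X))))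
      (X.1, fderiv ℝ y (jetPos p) (jetPos X),
        fderiv ℝ (fderiv ℝ y) (jetPos p) (jetPos X) (jetVel p) +
          fderiv ℝ y (jetPos p) (0, X.2.2)) 0 := by
  have h1 : DifferentiableAt ℝ (fderiv ℝ y) (jetPos p) :=
    (hy.fderiv_right (m := 2) (by norm_num)).differentiableAt (by simp)
  refine (hasDerivAt_line p.1 X.1).prodMk ((hasDerivAt_comp_jetPos_line
    (hy.differentiableAt (by simp)) X).prodMk ?_)
  have := (hasDerivAt_comp_jetPos_line h1 X).clm_apply (hasDerivAt_jetVel_line p X)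
  simpa using this

/-- This is the chain rule along `X`. The velocity occurs twice in D²y(w, w), and the symmetry of
D²y merges the two contributions into the factor 2. -/
theorem ClosesAt.fderiv_eq (hy : ContDiffAt ℝ 3 y (jetPos p)) (hf : DifferentiableAt ℝ f p)
    (hg : DifferentiableAt ℝ g (p.1, y (jetPos p), fderiv ℝ y (jetPos p) (jetVel p)))
    (hc : ∀ᶠ p' in 𝓝 p, ClosesAt f y g p') (X : JetModel n) :
    fderiv ℝ (fderiv ℝ (fderiv ℝ y)) (jetPos p) (jetPos X) (jetVel p) (jetVel p) +
        (2 : ℝ) • fderiv ℝ (fderiv ℝ y) (jetPos p) (jetVel p) (0, X.2.2) +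
        fderiv ℝ (fderiv ℝ y) (jetPos p) (jetPos X) (0, f p) +
        fderiv ℝ y (jetPos p) (0, fderiv ℝ f p X) =
      fderiv ℝ g (p.1, y (jetPos p), fderiv ℝ y (jetPos p) (jetVel p))
        (X.1, fderiv ℝ y (jetPos p) (jetPos X),
          fderiv ℝ (fderiv ℝ y) (jetPos p) (jetPos X) (jetVel p) +
            fderiv ℝ y (jetPos p) (0, X.2.2)) := by
  have hy1 := hy.fderiv_right (m := 2) (by norm_num)
  have hy2 := hy1.fderiv_right (m := 1) (by norm_num)
  have hw := hasDerivAt_jetVel_line p X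
  have h1 := (((hasDerivAt_comp_jetPos_line (hy2.differentiableAt (by simp)) X).clm_apply
    hw).clm_apply hw).add ((hasDerivAt_comp_jetPos_line (hy1.differentiableAt (by simp))
    X).clm_apply (hasDerivAt_zero_prodMk (hasDerivAt_comp_line hf X)))
  have h0 : p + (0 : ℝ) • X = p := by simp
  have h2 : HasDerivAt (fun r : ℝ => g ((p + r • X).1, y (jetPos (p + r • X)),
        fderiv ℝ y (jetPos (p + r • X)) (jetVel (p + r • X)))) _ 0 :=
    HasFDerivAt.comp_hasDerivAt (0 : ℝ) (by simpa only [h0] using hg.hasFDerivAt)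
      (hasDerivAt_reduced_line hy X)
  have h3 := h1.unique (h2.congr_of_eventuallyEq ((tendsto_line p X).eventually hc))
  rw [← h3]
  simp only [h0, add_apply]
  have hsym : IsSymmSndFDerivAt ℝ y (jetPos p) := hy.isSymmSndFDerivAt (by simp; norm_num)
  rw [hsym (jetVel p) (0, X.2.2), two_smul]
  abel

/-- The relation is differentiated in the fibre direction `s`, then along `X`. Second derivatives of
`g` would be multiplied by dy(0, s), so they drop out; the vanishing of dy(0, s) is needed only at
`p`. -/
theorem ClosesAt.fderiv_fderiv_eq (hy : ContDiffAt ℝ 4 y (jetPos p)) (hf : ContDiffAt ℝ 2 f p)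
    (hg : ContDiffAt ℝ 2 g (p.1, y (jetPos p), fderiv ℝ y (jetPos p) (jetVel p)))
    (hc : ∀ᶠ p' in 𝓝 p, ClosesAt f y g p') {s : Fin n → ℝ}
    (hs : fderiv ℝ y (jetPos p) (0, s) = 0) (X : JetModel n) :
    (2 : ℝ) • (fderiv ℝ (fderiv ℝ (fderiv ℝ y)) (jetPos p) (jetPos X) (jetVel p) (0, s) +
        fderiv ℝ (fderiv ℝ y) (jetPos p) (0, X.2.2) (0, s)) +
        fderiv ℝ (fderiv ℝ y) (jetPos p) (jetPos X) (0, fderiv ℝ f p (0, 0, s)) +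
        fderiv ℝ y (jetPos p) (0, fderiv ℝ (fderiv ℝ f) p X (0, 0, s)) =
      fderiv ℝ g (p.1, y (jetPos p), fderiv ℝ y (jetPos p) (jetVel p))
        (0, 0, fderiv ℝ (fderiv ℝ y) (jetPos p) (jetPos X) (0, s)) := by
  have hy3 : ContDiffAt ℝ 3 y (jetPos p) := hy.of_le (by norm_num)
  have hy1 := hy3.fderiv_right (m := 2) (by norm_num)
  have hy2 := hy1.fderiv_right (m := 1) (by norm_num)
  have hf1 := hf.fderiv_right (m := 1) (by norm_num)
  have hg1 := hg.fderiv_right (m := 1) (by norm_num)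
  have hposc : ContinuousAt (jetPos : JetModel n → _) p := by unfold jetPos; fun_prop
  have hev : ∀ᶠ p' in 𝓝 p, (2 : ℝ) • fderiv ℝ (fderiv ℝ y) (jetPos p') (jetVel p') (0, s) +
      fderiv ℝ y (jetPos p') (0, fderiv ℝ f p' (0, 0, s)) =
      fderiv ℝ g (p'.1, y (jetPos p'), fderiv ℝ y (jetPos p') (jetVel p'))
        (0, 0, fderiv ℝ y (jetPos p') (0, s)) := by
    have hredc : ContinuousAt (fun p : JetModel n => (p.1, y (jetPos p),
        fderiv ℝ y (jetPos p) (jetVel p))) p := by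
      refine continuousAt_fst.prodMk (ContinuousAt.prodMk ?_ (ContinuousAt.clm_apply ?_ ?_))
      · exact ContinuousAt.comp' hy.continuousAt hposc
      · exact ContinuousAt.comp' hy1.continuousAt hposc
      · unfold jetVel; fun_prop
    filter_upwards [hposc.eventually (hy3.eventually (by simp)), hf.eventually (by simp),
      hredc.eventually (hg.eventually (by simp)), hc.eventually_nhds] with p' h1 h2 h3 h4
    have := ClosesAt.fderiv_eq h1 (h2.differentiableAt (by simp)) (h3.differentiableAt (by simp))
      h4 (0, 0, s)
    have hz : jetPos ((0, 0, s) : JetModel n) = 0 := rfl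
    simpa [hz] using this
  have h0 : p + (0 : ℝ) • X = p := by simp
  have h1 := ((((hasDerivAt_comp_jetPos_line (hy2.differentiableAt (by simp)) X).clm_apply
    (hasDerivAt_jetVel_line p X)).clm_apply (hasDerivAt_const 0 ((0, s) : EventModel n))
    ).const_smul (2 : ℝ)).add ((hasDerivAt_comp_jetPos_line (hy1.differentiableAt (by simp))
    X).clm_apply (hasDerivAt_zero_prodMk ((hasDerivAt_comp_line (hf1.differentiableAt (by simp))
      X).clm_apply (hasDerivAt_const 0 ((0, 0, s) : JetModel n)))))
  have h2 : HasDerivAt (fun r : ℝ => fderiv ℝ g ((p + r • X).1, y (jetPos (p + r • X)),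
        fderiv ℝ y (jetPos (p + r • X)) (jetVel (p + r • X)))) _ 0 :=
    HasFDerivAt.comp_hasDerivAt (0 : ℝ)
      (by simpa only [h0] using (hg1.differentiableAt (by simp)).hasFDerivAt)
      (hasDerivAt_reduced_line hy3 X)
  have h3 := h2.clm_apply ((hasDerivAt_const 0 (0 : ℝ)).prodMk ((hasDerivAt_const 0 (0 : F)).prodMk
    ((hasDerivAt_comp_jetPos_line (hy1.differentiableAt (by simp)) X).clm_apply
      (hasDerivAt_const 0 ((0, s) : EventModel n)))))
  have h4 := h1.unique (h3.congr_of_eventuallyEq ((tendsto_line p X).eventually hev))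
  simpa [h0, hs, Prod.mk_zero_zero, -Prod.mk_eq_zero, add_assoc] using h4

/-- The sections annihilated by `dy` are stable under covariant differentiation. -/
theorem ClosesAt.fderiv_vertCovDeriv_eq_zero (hy : ContDiffAt ℝ 4 y (jetPos p))
    (hf : ContDiffAt ℝ 2 f p)
    (hg : ContDiffAt ℝ 2 g (p.1, y (jetPos p), fderiv ℝ y (jetPos p) (jetVel p)))
    (hc : ∀ᶠ p' in 𝓝 p, ClosesAt f y g p') {s : JetModel n → Fin n → ℝ}
    (hsd : DifferentiableAt ℝ s p) (hs : ∀ᶠ p' in 𝓝 p, fderiv ℝ y (jetPos p') (0, s p') = 0)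
    (u : JetModel n) : fderiv ℝ y (jetPos p) (0, vertCovDeriv f s u p) = 0 := by
  have hy3 : ContDiffAt ℝ 3 y (jetPos p) := hy.of_le (by norm_num)
  have hy1 := hy3.fderiv_right (m := 2) (by norm_num)
  have hs0 := hs.self_of_nhds
  have h0 : p + (0 : ℝ) • u = p := by simp
  have h1 := (hasDerivAt_comp_jetPos_line (hy1.differentiableAt (by simp)) u).clm_apply
    (hasDerivAt_zero_prodMk (hasDerivAt_comp_line hsd u))
  have h2 := h1.unique ((hasDerivAt_const 0 (0 : F)).congr_of_eventuallyEq
    ((tendsto_line p u).eventually hs))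
  simp only [h0] at h2
  have h3 := ClosesAt.fderiv_eq hy3 (hf.differentiableAt (by simp)) (hg.differentiableAt (by simp))
    hc (0, 0, s p)
  set e := u.2.1 - u.1 • p.2.2
  have h4 := ClosesAt.fderiv_fderiv_eq hy hf hg hc hs0 (0, 0, e)
  have hz : ∀ e : Fin n → ℝ, jetPos ((0, 0, e) : JetModel n) = 0 := fun _ => rfl
  simp only [hz, map_zero, zero_apply, zero_add, add_zero, hs0, Prod.mk_zero_zero] at h3 h4
  set Y := fderiv ℝ y (jetPos p)
  set Y2 := fderiv ℝ (fderiv ℝ y) (jetPos p)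
  have hlin : ∀ a b : Fin n → ℝ, Y (0, a - b) = Y (0, a) - Y (0, b) := fun a b => by
    rw [← map_sub]; simp
  have hsm : ∀ (c : ℝ) (a : Fin n → ℝ), Y (0, c • a) = c • Y (0, a) := fun c a => by
    rw [← map_smul]; simp
  -- The horizontal part of `u` splits into a multiple of the velocity and a vertical remainder,
  -- matching the f_v and f_vv terms of the connection. The three values of D²y then cancel by
  -- linearity.
  have hu : jetPos u = u.1 • jetVel p + (0, e) := by
    simp [jetPos, jetVel, e]
  have h5 : Y (0, fderiv ℝ s p u) = - Y2 (jetPos u) (0, s p) := by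
    rw [eq_neg_iff_add_eq_zero, add_comm]; exact h2
  have h6 : Y (0, fderiv ℝ f p (0, 0, s p)) = -((2 : ℝ) • Y2 (jetVel p) (0, s p)) := by
    rw [eq_neg_iff_add_eq_zero, add_comm]; exact h3
  have h7 : Y (0, fderiv ℝ (fderiv ℝ f) p (0, 0, e) (0, 0, s p)) =
      -((2 : ℝ) • Y2 (0, e) (0, s p)) := by
    rw [eq_neg_iff_add_eq_zero, add_comm]; exact h4
  rw [vertCovDeriv, hlin, hlin, hsm, hsm, hsm, h5, h6, h7, hu]
  simp only [map_add, map_smul, add_apply, smul_apply]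
  module

/-- The kernel of `dy` on vertical vectors is stable under the Jacobi endomorphism. -/
theorem ClosesAt.fderiv_vertJacobi_eq_zero (hy : ContDiffAt ℝ 4 y (jetPos p))
    (hf : ContDiffAt ℝ 2 f p)
    (hg : ContDiffAt ℝ 2 g (p.1, y (jetPos p), fderiv ℝ y (jetPos p) (jetVel p)))
    (hc : ∀ᶠ p' in 𝓝 p, ClosesAt f y g p')
    (hsurj : ∀ z, ∃ e : Fin n → ℝ, fderiv ℝ y (jetPos p) (0, e) = z) {s : Fin n → ℝ}
    (hs : fderiv ℝ y (jetPos p) (0, s) = 0) :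
    fderiv ℝ y (jetPos p) (0, vertJacobi f p s) = 0 := by
  have hy3 : ContDiffAt ℝ 3 y (jetPos p) := hy.of_le (by norm_num)
  have hy1 := hy3.fderiv_right (m := 2) (by norm_num)
  have hy2 := hy1.fderiv_right (m := 1) (by norm_num)
  have hI := ClosesAt.fderiv_eq hy3 (hf.differentiableAt (by simp)) (hg.differentiableAt (by simp))
    hc
  have hII := ClosesAt.fderiv_fderiv_eq hy hf hg hc hs (1, p.2.2, f p)
  have hsym : IsSymmSndFDerivAt ℝ y (jetPos p) := hy.isSymmSndFDerivAt (by simp; norm_num)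
  -- Full symmetry of D³y: one transposition comes from the second derivative of dy, the other from
  -- differentiating the symmetry of D²y.
  have hsym3 : ∀ a : EventModel n, fderiv ℝ (fderiv ℝ (fderiv ℝ y)) (jetPos p) a (jetVel p)
      (jetVel p) = fderiv ℝ (fderiv ℝ (fderiv ℝ y)) (jetPos p) (jetVel p) (jetVel p) a := by
    intro a
    have hs1 : IsSymmSndFDerivAt ℝ (fderiv ℝ y) (jetPos p) := hy1.isSymmSndFDerivAt (by simp)
    rw [hs1 a (jetVel p)]
    have hev : ∀ᶠ q in 𝓝 (jetPos p), fderiv ℝ (fderiv ℝ y) q a (jetVel p) =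
        fderiv ℝ (fderiv ℝ y) q (jetVel p) a := by
      filter_upwards [hy3.eventually (by simp)] with q hq
      exact (hq.isSymmSndFDerivAt (by simp; norm_num)) _ _
    have hd : ∀ b c : EventModel n, HasDerivAt (fun r : ℝ => fderiv ℝ (fderiv ℝ y)
        (jetPos p + r • jetVel p) b c) (fderiv ℝ (fderiv ℝ (fderiv ℝ y)) (jetPos p) (jetVel p) b c)
        0 := fun b c => by
      simpa using ((hasDerivAt_comp_line (hy2.differentiableAt (by simp)) (jetVel p)).clm_apply
        (hasDerivAt_const 0 b)).clm_apply (hasDerivAt_const 0 c)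
    exact (hd a (jetVel p)).unique ((hd (jetVel p) a).congr_of_eventuallyEq
      ((tendsto_line _ _).eventually hev))
  -- The term f_v f_v s requires f_v on a vector outside the kernel of dy. Since dy(f_v s) = −2
  -- D²y(w, s), the choice of `e` puts `k` = f_v s + 2e into the kernel, so f_v is computed
  -- separately on `k` and on `e`.
  obtain ⟨e, he⟩ := hsurj (fderiv ℝ (fderiv ℝ y) (jetPos p) (jetVel p) (0, s))
  set k := fderiv ℝ f p (0, 0, s) + (2 : ℝ) • e
  have hV := fun a => hI (0, 0, a)
  have hX := hI (0, s, 0)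
  have hz : ∀ e : Fin n → ℝ, jetPos ((0, 0, e) : JetModel n) = 0 := fun _ => rfl
  have hz' : jetPos ((0, s, 0) : JetModel n) = (0, s) := rfl
  have hz'' : jetPos ((1, p.2.2, f p) : JetModel n) = jetVel p := rfl
  have hz3 : jetVel ((1, p.2.2, f p) : JetModel n) = (1, f p) := rfl
  simp only [hz, hz', hz'', map_zero, zero_apply, zero_add, add_zero, hs, Prod.mk_zero_zero,
    smul_zero, hsym3] at hV hX hII
  have hs' := hsym (0, s) (jetVel p)
  have hs2 := hsym (0, f p) (0, s)
  set Y := fderiv ℝ y (jetPos p)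
  set Y2 := fderiv ℝ (fderiv ℝ y) (jetPos p)
  set Y3 := fderiv ℝ (fderiv ℝ (fderiv ℝ y)) (jetPos p)
  set G := fderiv ℝ g (p.1, y (jetPos p), Y (jetVel p))
  rw [hs'] at hX
  rw [hs2] at hII
  have hadd : ∀ a b : Fin n → ℝ, Y (0, a + b) = Y (0, a) + Y (0, b) := fun a b => by
    rw [← map_add]; simp
  have hlin : ∀ a b : Fin n → ℝ, Y (0, a - b) = Y (0, a) - Y (0, b) := fun a b => by
    rw [← map_sub]; simp
  have hneg : ∀ a : Fin n → ℝ, Y (0, -a) = -Y (0, a) := fun a => by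
    rw [← map_neg]; simp
  have hsm : ∀ (c : ℝ) (a : Fin n → ℝ), Y (0, c • a) = c • Y (0, a) := fun c a => by
    rw [← map_smul]; simp
  have hfs := hV s
  rw [hs, Prod.mk_zero_zero, Prod.mk_zero_zero, map_zero] at hfs
  have hk : Y (0, k) = 0 := by
    rw [hadd, hsm, he, add_comm]; exact hfs
  have hfk := hV k
  rw [hk, Prod.mk_zero_zero, Prod.mk_zero_zero, map_zero] at hfk
  have hfe := hV e
  rw [he] at hfe
  have hfsk : fderiv ℝ f p (0, 0, s) = k - (2 : ℝ) • e := by simp [k]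
  have hsplit : ∀ c : EventModel n,
      Y2 c (0, k - (2 : ℝ) • e) = Y2 c (0, k) - (2 : ℝ) • Y2 c (0, e) :=
    fun c => by rw [← map_smul, ← map_sub]; simp
  have hsplit' : fderiv ℝ f p (0, 0, k - (2 : ℝ) • e) =
      fderiv ℝ f p (0, 0, k) - (2 : ℝ) • fderiv ℝ f p (0, 0, e) := by
    rw [← map_smul, ← map_sub]; simp
  rw [hfsk, hsplit] at hII
  rw [vertJacobi, hfsk, hsplit']
  simp only [hadd, hlin, hneg, hsm]
  have e1 : Y (0, fderiv ℝ f p (0, s, 0)) = G (0, 0, Y2 (jetVel p) (0, s)) -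
      Y3 (jetVel p) (jetVel p) (0, s) - Y2 (0, s) (0, f p) := by rw [← hX]; abel
  have e2 : Y (0, fderiv ℝ f p (0, 0, k)) = -((2 : ℝ) • Y2 (jetVel p) (0, k)) := by
    rw [eq_neg_iff_add_eq_zero, add_comm]; exact hfk
  have e3 : Y (0, fderiv ℝ f p (0, 0, e)) = G (0, 0, Y2 (jetVel p) (0, s)) -
      (2 : ℝ) • Y2 (jetVel p) (0, e) := by rw [← hfe]; abel
  have e4 : Y (0, fderiv ℝ (fderiv ℝ f) p (1, p.2.2, f p) (0, 0, s)) =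
      G (0, 0, Y2 (jetVel p) (0, s)) - ((2 : ℝ) • (Y3 (jetVel p) (jetVel p) (0, s) +
        Y2 (0, s) (0, f p)) + (Y2 (jetVel p) (0, k) - (2 : ℝ) • Y2 (jetVel p) (0, e))) := by
    rw [← hII]; abel
  rw [e1, e2, e3, e4]
  module

end ModelCalculus

/-! ### Parallel families of subspaces: independence of velocities and integrability. -/

section ModelDistributions

open Set Filter

variable {n : ℕ}

/-- A family of subspaces that is spanned near `p` by a smooth frame. -/
def HasSmoothFrameAt (K : JetModel n → Submodule ℝ (Fin n → ℝ)) (p : JetModel n) : Prop :=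
  ∃ (k : ℕ) (σ : Fin k → JetModel n → Fin n → ℝ), ∀ᶠ p' in 𝓝 p,
    (∀ a, ContDiffAt ℝ ∞ (σ a) p') ∧ LinearIndependent ℝ (fun a => σ a p') ∧
      Submodule.span ℝ (range fun a => σ a p') = K p'

/-- A family of subspaces that is stable at `p` under covariant differentiation. -/
def IsParallelAt (f : JetModel n → Fin n → ℝ) (K : JetModel n → Submodule ℝ (Fin n → ℝ))
    (p : JetModel n) : Prop :=
  ∀ s : JetModel n → Fin n → ℝ, (∀ᶠ p' in 𝓝 p, ContDiffAt ℝ ∞ s p' ∧ s p' ∈ K p') →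
    ∀ u, vertCovDeriv f s u p ∈ K p

variable {f : JetModel n → Fin n → ℝ} {K : JetModel n → Submodule ℝ (Fin n → ℝ)} {p : JetModel n}

theorem exists_equiv_prod_of_submodule (S : Submodule ℝ (Fin n → ℝ)) :
    ∃ (d : ℕ) (T : (Fin n → ℝ) ≃L[ℝ] (Fin (Module.finrank ℝ S) → ℝ) × (Fin d → ℝ)),
      d + Module.finrank ℝ S = n ∧ ∀ s, (T s).2 = 0 ↔ s ∈ S := by
  obtain ⟨C, hC⟩ := S.exists_isCompl
  have e₁ : S ≃ₗ[ℝ] (Fin (Module.finrank ℝ S) → ℝ) := LinearEquiv.ofFinrankEq _ _ (by simp)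
  have e₂ : C ≃ₗ[ℝ] (Fin (Module.finrank ℝ C) → ℝ) := LinearEquiv.ofFinrankEq _ _ (by simp)
  refine ⟨Module.finrank ℝ C, ((Submodule.prodEquivOfIsCompl S C hC).symm.trans
    (e₁.prodCongr e₂)).toContinuousLinearEquiv, ?_, fun s => ?_⟩
  · rw [add_comm, Submodule.finrank_add_eq_of_isCompl hC]
    simp
  · have : (((Submodule.prodEquivOfIsCompl S C hC).symm.trans
        (e₁.prodCongr e₂)).toContinuousLinearEquiv s).2 =
        e₂ ((Submodule.prodEquivOfIsCompl S C hC).symm s).2 := rfl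
    rw [this, LinearEquiv.map_eq_zero_iff, Submodule.prodEquivOfIsCompl_symm_apply_snd_eq_zero]

/-- A family of subspaces with smooth frames is locally the family of the graphs of a smooth family
of linear maps. -/
theorem HasSmoothFrameAt.exists_graph (hK : HasSmoothFrameAt K p) :
    ∃ (d : ℕ) (T : (Fin n → ℝ) ≃L[ℝ] (Fin (Module.finrank ℝ (K p)) → ℝ) × (Fin d → ℝ))
      (L : JetModel n → (Fin (Module.finrank ℝ (K p)) → ℝ) →L[ℝ] (Fin d → ℝ)),
      d + Module.finrank ℝ (K p) = n ∧
      ∀ᶠ p' in 𝓝 p, ContDiffAt ℝ ∞ L p' ∧ ∀ s, s ∈ K p' ↔ (T s).2 = L p' (T s).1 := by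
  obtain ⟨d, T, hd, hT⟩ := exists_equiv_prod_of_submodule (K p)
  obtain ⟨k, σ, hσ⟩ := hK
  have hp := hσ.self_of_nhds
  obtain rfl : k = Module.finrank ℝ (K p) := by
    rw [← hp.2.2, finrank_span_eq_card hp.2.1, Fintype.card_fin]
  set A := Fin (Module.finrank ℝ (K p)) → ℝ
  set B := Fin d → ℝ
  set S : JetModel n → A →L[ℝ] (Fin n → ℝ) := fun p' =>
    ∑ a, (ContinuousLinearMap.proj a : A →L[ℝ] ℝ).smulRight (σ a p')
  have hS : ∀ p' c, S p' c = ∑ a, c a • σ a p' := fun p' c => by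
    simp [S]
    rfl
  have hSK : ∀ p', Submodule.span ℝ (range fun a => σ a p') = K p' → ∀ s, s ∈ K p' ↔
      ∃ c, S p' c = s := by
    intro p' h s
    rw [← h, Submodule.mem_span_range_iff_exists_fun]
    simp only [hS]
    exact Iff.rfl
  have hSs : ∀ p', (∀ a, ContDiffAt ℝ ∞ (σ a) p') → ContDiffAt ℝ ∞ S p' := by
    intro p' h
    refine ContDiffAt.sum fun a _ => ?_
    exact (ContinuousLinearMap.smulRightL ℝ A (Fin n → ℝ)
      (ContinuousLinearMap.proj a : A →L[ℝ] ℝ)).contDiff.contDiffAt.comp p' (h a)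
  set T₁ : (Fin n → ℝ) →L[ℝ] A := ContinuousLinearMap.fst ℝ A B ∘L (T : (Fin n → ℝ) →L[ℝ] A × B)
  set T₂ : (Fin n → ℝ) →L[ℝ] B := ContinuousLinearMap.snd ℝ A B ∘L (T : (Fin n → ℝ) →L[ℝ] A × B)
  -- At `p` the frame has no component in the complement, so its first block is invertible, and it
  -- stays so nearby. The graph map is the second block times the inverse of the first.
  set SA : JetModel n → A →L[ℝ] A := fun p' => T₁ ∘L S p'
  have hSA : ∀ p', (∀ a, ContDiffAt ℝ ∞ (σ a) p') → ContDiffAt ℝ ∞ SA p' := fun p' h =>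
    contDiffAt_const.clm_comp (hSs p' h)
  have hinj : Function.Injective (SA p) := by
    rw [injective_iff_map_eq_zero]
    intro c hc
    have h1 : S p c ∈ K p := (hSK p hp.2.2 _).2 ⟨c, rfl⟩
    have h2 : T (S p c) = 0 := Prod.ext hc ((hT _).2 h1)
    have h3 : ∑ a, c a • σ a p = 0 := by rw [← hS]; exact (T.map_eq_zero_iff).1 h2
    exact funext fun a => Fintype.linearIndependent_iff.1 hp.2.1 c h3 a
  obtain ⟨e, he⟩ : ∃ e : A ≃L[ℝ] A, (e : A →L[ℝ] A) = SA p :=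
    ⟨(LinearEquiv.ofInjectiveEndo (SA p : A →ₗ[ℝ] A) hinj).toContinuousLinearEquiv, by ext; rfl⟩
  have hev : ∀ᶠ p' in 𝓝 p, SA p' ∈ range ((↑) : (A ≃L[ℝ] A) → A →L[ℝ] A) :=
    (hSA p hp.1).continuousAt.preimage_mem_nhds (by rw [← he]; exact ContinuousLinearEquiv.nhds e)
  refine ⟨d, T, fun p' => (T₂ ∘L S p') ∘L (SA p').inverse, hd, ?_⟩
  filter_upwards [hσ, hev] with p' hp' ⟨e', he'⟩
  refine ⟨?_, fun s => ?_⟩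
  · refine (contDiffAt_const.clm_comp (hSs p' hp'.1)).clm_comp ?_
    have h1 : ContDiffAt ℝ ∞ ContinuousLinearMap.inverse (SA p') := by
      rw [← he']; exact contDiffAt_map_inverse e'
    exact h1.comp p' (hSA p' hp'.1)
  · rw [← he', ContinuousLinearMap.inverse_equiv, hSK p' hp'.2.2]
    have hSA' : ∀ c, e' c = (T (S p' c)).1 := fun c => DFunLike.congr_fun he' c
    constructor
    · rintro ⟨c, rfl⟩
      show (T (S p' c)).2 = (T (S p' (e'.symm (T (S p' c)).1))).2
      rw [← hSA', e'.symm_apply_apply]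
    · intro h
      refine ⟨e'.symm (T s).1, T.injective (Prod.ext ?_ h.symm)⟩
      rw [← hSA', e'.apply_symm_apply]

/-- The derivative of the graph function of a parallel family of subspaces. -/
theorem IsParallelAt.fderiv_graph {d k : ℕ}
    {T : (Fin n → ℝ) ≃L[ℝ] (Fin k → ℝ) × (Fin d → ℝ)}
    {L : JetModel n → (Fin k → ℝ) →L[ℝ] (Fin d → ℝ)} (hK : IsParallelAt f K p)
    (hL : ∀ᶠ p' in 𝓝 p, ContDiffAt ℝ ∞ L p' ∧ ∀ s, s ∈ K p' ↔ (T s).2 = L p' (T s).1)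
    (u : JetModel n) (α : Fin k → ℝ) :
    let s := T.symm (α, L p α)
    let z := (1 / 2 : ℝ) • u.1 • fderiv ℝ f p (0, 0, s) +
      (1 / 2 : ℝ) • fderiv ℝ (fderiv ℝ f) p (0, 0, u.2.1 - u.1 • p.2.2) (0, 0, s)
    fderiv ℝ L p u α = (T z).2 - L p (T z).1 := by
  intro s z
  have hLp := hL.self_of_nhds
  -- Sections with constant first component are tested. Their derivative lies in the complement, so
  -- membership of the covariant derivative in the graph determines the derivative of `L`.
  have h1 := hK (fun p' => T.symm (α, L p' α)) (by
    filter_upwards [hL] with p' hp'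
    refine ⟨T.symm.contDiff.contDiffAt.comp p'
      (contDiffAt_const.prodMk (hp'.1.clm_apply contDiffAt_const)), ?_⟩
    rw [hp'.2]; simp) u
  rw [hLp.2] at h1
  have hd : HasFDerivAt (fun p' => T.symm (α, L p' α)) _ p :=
    T.symm.hasFDerivAt.comp p ((hasFDerivAt_const α p).prodMk
      ((hLp.1.differentiableAt (by simp)).hasFDerivAt.clm_apply (hasFDerivAt_const α p)))
  have h2 : fderiv ℝ (fun p' => T.symm (α, L p' α)) p u = T.symm (0, fderiv ℝ L p u α) := by
    rw [hd.fderiv]; simp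
  have h3 : vertCovDeriv f (fun p' => T.symm (α, L p' α)) u p =
      T.symm (0, fderiv ℝ L p u α) - z := by
    rw [vertCovDeriv, h2, sub_sub]
  rw [h3] at h1
  simp only [map_sub, Prod.fst_sub, Prod.snd_sub, T.apply_symm_apply] at h1
  have h4 : fderiv ℝ L p u α - (T z).2 = - L p (T z).1 := by simpa using h1
  rw [sub_eq_iff_eq_add] at h4
  rw [h4]; abel

/-- Parallel subbundles do not depend on the velocities. -/
theorem eq_of_isParallelAt {O : Set (EventModel n)}
    (hframe : ∀ p, jetPos p ∈ O → HasSmoothFrameAt K p)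
    (hpar : ∀ p, jetPos p ∈ O → IsParallelAt f K p)
    {q : EventModel n} (hq : q ∈ O) (v v' : Fin n → ℝ) : K (q.1, q.2, v) = K (q.1, q.2, v') := by
  have hloc : IsLocallyConstant fun v => K (q.1, q.2, v) := by
    rw [IsLocallyConstant.iff_eventually_eq]
    intro v
    obtain ⟨d, T, L, -, hL⟩ := (hframe (q.1, q.2, v) hq).exists_graph
    have hc : ContinuousAt (fun v : Fin n → ℝ => (q.1, q.2, v)) v := by fun_prop
    obtain ⟨ε, hε, hball⟩ := Metric.eventually_nhds_iff_ball.1 (hc.eventually hL.eventually_nhds)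
    have hd : ∀ w ∈ Metric.ball v ε, HasFDerivAt (fun v => L (q.1, q.2, v))
        (0 : (Fin n → ℝ) →L[ℝ] (Fin (Module.finrank ℝ (K (q.1, q.2, v))) → ℝ) →L[ℝ]
          (Fin d → ℝ)) w := by
      intro w hw
      have h1 := ((hball w hw).self_of_nhds.1.differentiableAt (by simp)).hasFDerivAt
      have h2 : HasFDerivAt (fun v : Fin n → ℝ => ((q.1, q.2, v) : JetModel n))
          ((0 : (Fin n → ℝ) →L[ℝ] ℝ).prod ((0 : (Fin n → ℝ) →L[ℝ] (Fin n → ℝ)).prod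
            (ContinuousLinearMap.id ℝ _))) w :=
        (hasFDerivAt_const _ _).prodMk ((hasFDerivAt_const _ _).prodMk (hasFDerivAt_id _))
      refine (HasFDerivAt.comp w h1 h2).congr_fderiv ?_
      ext1 e
      ext1 α
      -- For a purely fibre direction both connection terms vanish, so `L` has zero derivative in
      -- `v`.
      have := (hpar (q.1, q.2, w) hq).fderiv_graph (hball w hw) (0, 0, e) α
      simpa [Prod.mk_zero_zero] using this
    filter_upwards [Metric.ball_mem_nhds v hε] with w hw
    have hconst : L (q.1, q.2, w) = L (q.1, q.2, v) :=
      (convex_ball v ε).is_const_of_fderivWithin_eq_zero (𝕜 := ℝ)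
        (f := fun v => L (q.1, q.2, v))
        (fun x hx => (hd x hx).differentiableAt.differentiableWithinAt)
        (fun x hx => ((hd x hx).hasFDerivWithinAt).fderivWithin
          (Metric.isOpen_ball.uniqueDiffWithinAt hx)) hw (Metric.mem_ball_self hε)
    ext s
    rw [(hball w hw).self_of_nhds.2, (hball v (Metric.mem_ball_self hε)).self_of_nhds.2, hconst]
  -- Local constancy becomes global because the whole fibre ℝⁿ is connected.
  exact hloc.apply_eq_of_preconnectedSpace v v'

/-- Parallel subbundles are, locally, the vertical kernels of the differential of a smooth map. -/
theorem exists_ker_fderiv_eq_of_isParallelAt (hframe : HasSmoothFrameAt K p)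
    (hf : ∀ᶠ p' in 𝓝 p, ContDiffAt ℝ ∞ f p') (hpar : ∀ᶠ p' in 𝓝 p, IsParallelAt f K p') :
    ∃ (d : ℕ) (y : EventModel n → Fin d → ℝ), d + Module.finrank ℝ (K p) = n ∧
      ∀ᶠ q in 𝓝 (jetPos p), ContDiffAt ℝ ∞ y q ∧
        ∀ s, fderiv ℝ y q (0, s) = 0 ↔ s ∈ K (q.1, q.2, p.2.2) := by
  obtain ⟨d, T, L, hdim, hL⟩ := hframe.exists_graph
  set A := Fin (Module.finrank ℝ (K p)) → ℝ
  set B := Fin d → ℝ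
  set T' : (ℝ × A × B) ≃L[ℝ] EventModel n := (ContinuousLinearEquiv.refl ℝ ℝ).prodCongr T.symm
  -- The velocity is frozen at its value at `p`, which turns `L` into the coefficient of a total
  -- differential equation in x with parameter t.
  set ι : ℝ × A × B → JetModel n := fun x => (x.1, T.symm x.2, p.2.2)
  have hι : ∀ x, HasFDerivAt ι ((ContinuousLinearMap.fst ℝ ℝ (A × B)).prod
      (((T.symm : A × B →L[ℝ] (Fin n → ℝ)) ∘L ContinuousLinearMap.snd ℝ ℝ (A × B)).prod 0)) x := by
    intro x
    exact hasFDerivAt_fst.prodMk ((((T.symm : A × B →L[ℝ] (Fin n → ℝ)) ∘L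
      ContinuousLinearMap.snd ℝ ℝ (A × B)).hasFDerivAt).prodMk (hasFDerivAt_const _ _))
  have hιs : ContDiff ℝ ∞ ι :=
    contDiff_fst.prodMk ((T.symm.contDiff.comp contDiff_snd).prodMk contDiff_const)
  set x₀ : ℝ × A × B := (p.1, T p.2.1)
  have hι0 : ι x₀ = p := by simp [ι, x₀]
  set Λ : ℝ × A × B → A →L[ℝ] B := fun x => L (ι x)
  have hcι : Tendsto ι (𝓝 x₀) (𝓝 p) := by
    have := hιs.continuous.tendsto x₀
    rwa [hι0] at this
  obtain ⟨y₀, hy₀, hyL, hy0⟩ := exists_firstIntegral (L := Λ) (q₀ := x₀) (by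
    filter_upwards [hcι.eventually hL] with x hx
    exact hx.1.comp x hιs.contDiffAt) (by
    filter_upwards [hcι.eventually (hL.eventually_nhds.and (hf.and hpar))] with x hx α β
    have hd : HasFDerivAt Λ _ x :=
      (hx.1.self_of_nhds.1.differentiableAt (by simp)).hasFDerivAt.comp x (hι x)
    have hg := fun u α => hx.2.2.fderiv_graph hx.1 u α
    have hsym : IsSymmSndFDerivAt ℝ f (ι x) := 
      (hx.2.1.of_le (natCast_le_infty 2)).isSymmSndFDerivAt (by simp)
    have key : ∀ α, fderiv ℝ Λ x (0, α, Λ x α) = fderiv ℝ L (ι x) (0, T.symm (α, Λ x α), 0) := by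
      intro α
      rw [hd.fderiv]
      simp
    -- With u⁰ = 0 only ½ f_vv(u_x, s) is left, so exchanging the two vectors is harmless by
    -- symmetry of the second derivative. This is the Frobenius condition.
    rw [key, key, hg, hg]
    simp only [zero_smul, smul_zero, zero_add, sub_zero]
    rw [hsym (0, 0, T.symm (α, Λ x α))])
  have hcT : Tendsto T'.symm (𝓝 (jetPos p)) (𝓝 x₀) := T'.symm.continuous.tendsto (jetPos p)
  -- The derivative of `y₀` in the B-directions is the identity at the centre, hence still injective
  -- nearby. So dy has no larger vertical kernel than the graph.
  have hinj : ∀ᶠ x in 𝓝 x₀, ∀ β, fderiv ℝ y₀ x (0, 0, β) = 0 → β = 0 := by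
    set j : B →L[ℝ] ℝ × A × B := ContinuousLinearMap.inr ℝ ℝ (A × B) ∘L
      ContinuousLinearMap.inr ℝ A B
    have hc : ContinuousAt (fun x => fderiv ℝ y₀ x ∘L j) x₀ :=
      (hy₀.self_of_nhds.fderiv_right (m := 0) (by simp)).continuousAt.clm_comp continuousAt_const
    have h0 : fderiv ℝ y₀ x₀ ∘L j = (ContinuousLinearEquiv.refl ℝ B : B →L[ℝ] B) := by
      ext1 β
      exact hy0 β
    have hev := hc.preimage_mem_nhds (by
      rw [h0]; exact ContinuousLinearEquiv.nhds (ContinuousLinearEquiv.refl ℝ B))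
    filter_upwards [hev] with x ⟨e, he⟩ β hβ
    have : e β = 0 := (DFunLike.congr_fun he β).trans hβ
    simpa using this
  refine ⟨d, fun q => y₀ (T'.symm q), hdim, ?_⟩
  filter_upwards [hcT.eventually (hy₀.and (hyL.and (hinj.and (hcι.eventually hL))))]
    with q ⟨h1, h2, h3, h4⟩
  have hιq : ι (T'.symm q) = (q.1, q.2, p.2.2) := by
    show (q.1, T.symm (T q.2), p.2.2) = _
    rw [T.symm_apply_apply]
  refine ⟨h1.comp q T'.symm.contDiff.contDiffAt, fun s => ?_⟩
  have hd : HasFDerivAt (fun q => y₀ (T'.symm q)) _ q :=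
    (h1.differentiableAt (by simp)).hasFDerivAt.comp q T'.symm.hasFDerivAt
  have h5 : fderiv ℝ (fun q => y₀ (T'.symm q)) q (0, s) =
      fderiv ℝ y₀ (T'.symm q) (0, 0, (T s).2 - L (q.1, q.2, p.2.2) (T s).1) := by
    have h6 := h2 (T s).1
    rw [hd.fderiv]
    show fderiv ℝ y₀ (T'.symm q) (0, T s) = _
    have h7 : ((0, T s) : ℝ × A × B) = (0, (T s).1, Λ (T'.symm q) (T s).1) +
        (0, 0, (T s).2 - Λ (T'.symm q) (T s).1) := by simp
    rw [h7, map_add, h6, zero_add]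
    simp only [Λ, hιq]
  rw [h5, ← hιq, h4.2, ← sub_eq_zero (a := (T s).2)]
  exact ⟨h3 _, fun h => by rw [h, Prod.mk_zero_zero, Prod.mk_zero_zero, map_zero]⟩

end ModelDistributions

/-! ### Coordinate-free forms of the connection and of the Jacobi endomorphism. -/

section CoordinateFormulas

open Set Filter

variable {n : ℕ} {M : Type*} [TopologicalSpace M] [ChartedSpace (EventModel n) M]
  [IsManifold 𝓘(ℝ, EventModel n) ∞ M] {τ : M → ℝ} (Γ : SODE n τ) (φ : AdaptedChart (n := n) τ)

theorem sum_smul_single (a : Fin n → ℝ) : ∑ k, a k • (Pi.single k 1 : Fin n → ℝ) = a := by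
  conv_rhs => rw [← Finset.univ_sum_single a]
  exact Finset.sum_congr rfl fun k _ => by rw [← Pi.single_smul, smul_eq_mul, mul_one]

theorem sum_smul_dirV (a : Fin n → ℝ) : ∑ k, a k • dirV k = ((0, 0, a) : JetModel n) := by
  refine Prod.ext ?_ (Prod.ext ?_ ?_) <;> simp [Prod.fst_sum, Prod.snd_sum, dirV, sum_smul_single]

theorem sum_smul_dirX (a : Fin n → ℝ) : ∑ k, a k • dirX k = ((0, a, 0) : JetModel n) := by
  refine Prod.ext ?_ (Prod.ext ?_ ?_) <;> simp [Prod.fst_sum, Prod.snd_sum, dirX, sum_smul_single]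

theorem sum_mul_clm_dirV (ℓ : JetModel n →L[ℝ] ℝ) (a : Fin n → ℝ) :
    ∑ k, a k * ℓ (dirV k) = ℓ (0, 0, a) := by
  rw [← sum_smul_dirV, map_sum]
  simp

theorem sum_mul_clm_dirX (ℓ : JetModel n →L[ℝ] ℝ) (a : Fin n → ℝ) :
    ∑ k, a k * ℓ (dirX k) = ℓ (0, a, 0) := by
  rw [← sum_smul_dirX, map_sum]
  simp

theorem fderiv_coord {f : JetModel n → Fin n → ℝ} {p : JetModel n} (hf : DifferentiableAt ℝ f p)
    (i : Fin n) (u : JetModel n) : fderiv ℝ (fun q => f q i) p u = fderiv ℝ f p u i := by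
  have := ((ContinuousLinearMap.proj (R := ℝ) (φ := fun _ : Fin n => ℝ) i).hasFDerivAt).comp p
    hf.hasFDerivAt
  exact DFunLike.congr_fun this.fderiv u

namespace SODE

variable {Γ φ} {p : JetModel n}

theorem connCoeff_eq (hf : DifferentiableAt ℝ (Γ.force φ) p) (i j : Fin n) :
    Γ.connCoeff φ i j p = -(1 / 2) * fderiv ℝ (Γ.force φ) p (dirV j) i := by
  rw [connCoeff, fderiv_coord hf]

theorem connForm_eq (hf : DifferentiableAt ℝ (Γ.force φ) p) (u : EventModel n) (i : Fin n) :
    Γ.connForm φ u i p = u.1 * ((1 / 2) * fderiv ℝ (Γ.force φ) p (0, 0, p.2.2) i -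
      Γ.force φ p i) - (1 / 2) * fderiv ℝ (Γ.force φ) p (0, 0, u.2) i := by
  have h1 : ∑ j, u.2 j * Γ.connCoeff φ i j p =
      -(1 / 2) * fderiv ℝ (Γ.force φ) p (0, 0, u.2) i := by
    rw [← fderiv_coord hf, ← sum_mul_clm_dirV, Finset.mul_sum]
    exact Finset.sum_congr rfl fun j _ => by rw [connCoeff]; ring
  rw [connForm, connCoeffZero, h1, sum_mul_clm_dirV, fderiv_coord hf]
  ring

/-- The explicit v in Γⁱ₀ contributes ½ f_v s, which combines with −f_v s to −½ f_v s. The second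
derivatives collect into a single term in the direction u_x − u⁰ v. -/
theorem fderiv_connForm (hf : ContDiffAt ℝ 2 (Γ.force φ) p) (u : EventModel n) (i : Fin n)
    (s : Fin n → ℝ) :
    fderiv ℝ (Γ.connForm φ u i) p (0, 0, s) =
      -(1 / 2) * u.1 * fderiv ℝ (Γ.force φ) p (0, 0, s) i -
        (1 / 2) * fderiv ℝ (fderiv ℝ (Γ.force φ)) p (0, 0, u.2 - u.1 • p.2.2) (0, 0, s) i := by
  have hf1 := (hf.fderiv_right (m := 1) (by norm_num)).differentiableAt (by simp)
  have hf0 := hf.differentiableAt (by simp)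
  have hsym : IsSymmSndFDerivAt ℝ (Γ.force φ) p := hf.isSymmSndFDerivAt (by simp)
  have hev : Γ.connForm φ u i =ᶠ[𝓝 p] fun p => u.1 * ((1 / 2) * fderiv ℝ (Γ.force φ) p
      (0, 0, p.2.2) i - Γ.force φ p i) - (1 / 2) * fderiv ℝ (Γ.force φ) p (0, 0, u.2) i := by
    filter_upwards [hf.eventually (by simp)] with p' hp'
    exact connForm_eq (hp'.differentiableAt (by simp)) u i
  set D := fderiv ℝ (fderiv ℝ (Γ.force φ)) p
  have hproj : ∀ {g : ℝ → Fin n → ℝ} {g' : Fin n → ℝ}, HasDerivAt g g' 0 →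
      HasDerivAt (fun r => g r i) (g' i) 0 := fun h => (hasDerivAt_pi.1 h) i
  have hline := hasDerivAt_comp_line hf1 ((0, 0, s) : JetModel n)
  have h1 : HasDerivAt (fun r : ℝ => ((0, 0, (p + r • ((0, 0, s) : JetModel n)).2.2) : JetModel n))
      (0, 0, s) 0 :=
    (hasDerivAt_const 0 (0 : ℝ)).prodMk ((hasDerivAt_const 0 (0 : Fin n → ℝ)).prodMk
      (hasDerivAt_line p.2.2 s))
  have h2 := ((((hproj (hline.clm_apply h1)).const_mul (1 / 2 : ℝ)).sub
    (hproj (hasDerivAt_comp_line hf0 ((0, 0, s) : JetModel n)))).const_mul u.1).sub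
    ((hproj (hline.clm_apply (hasDerivAt_const 0 ((0, 0, u.2) : JetModel n)))).const_mul
      (1 / 2 : ℝ))
  have hd : DifferentiableAt ℝ (fun p : JetModel n => u.1 * ((1 / 2) * fderiv ℝ (Γ.force φ) p
      (0, 0, p.2.2) i - Γ.force φ p i) - (1 / 2) * fderiv ℝ (Γ.force φ) p (0, 0, u.2) i) p := by
    have ha : DifferentiableAt ℝ (fun p : JetModel n => fderiv ℝ (Γ.force φ) p (0, 0, p.2.2)) p :=
      hf1.clm_apply (by fun_prop)
    have hb : DifferentiableAt ℝ (fun p : JetModel n => fderiv ℝ (Γ.force φ) p (0, 0, u.2)) p :=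
      hf1.clm_apply (by fun_prop)
    have ha' := differentiableAt_pi.1 ha i
    have hb' := differentiableAt_pi.1 hb i
    have hc' := differentiableAt_pi.1 hf0 i
    exact (((ha'.const_mul _).sub hc').const_mul _).sub (hb'.const_mul _)
  have h3 := (hasDerivAt_comp_line hd ((0, 0, s) : JetModel n)).unique h2
  rw [hev.fderiv_eq, h3]
  have h4 : ((0, 0, u.2 - u.1 • p.2.2) : JetModel n) = (0, 0, u.2) - u.1 • (0, 0, p.2.2) := by simp
  have h5 : D (0, 0, u.2 - u.1 • p.2.2) (0, 0, s) =
      D (0, 0, s) (0, 0, u.2) - u.1 • D (0, 0, s) (0, 0, p.2.2) := by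
    rw [hsym _ (0, 0, s), h4, map_sub, map_smul]
  rw [h5]
  simp [D]
  ring

/-- The covariant derivative of vertical sections in coordinates. -/
theorem covDerivComponents_of_vertical (hf : ContDiffAt ℝ 2 (Γ.force φ) p) {σ : FieldAlong n τ}
    (hσ : DifferentiableAt ℝ (φ.fieldRep σ) p) (hv : ∀ᶠ p' in 𝓝 p, (φ.fieldRep σ p').1 = 0)
    (u : JetModel n) :
    Γ.covDerivComponents φ σ u p =
      (0, vertCovDeriv (Γ.force φ) (fun p' => (φ.fieldRep σ p').2) u p) := by
  have h1 : (fderiv ℝ (φ.fieldRep σ) p u).1 = 0 := by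
    have ha := (hasFDerivAt_fst.comp p hσ.hasFDerivAt).unique
      ((hasFDerivAt_const (0 : ℝ) p).congr_of_eventuallyEq hv)
    exact DFunLike.congr_fun ha u
  have h2 : fderiv ℝ (fun p' => (φ.fieldRep σ p').2) p u = (fderiv ℝ (φ.fieldRep σ) p u).2 := by
    rw [hσ.hasFDerivAt.snd.fderiv]
    rfl
  refine Prod.ext h1 (funext fun i => ?_)
  simp only [covDerivComponents, vertCovDeriv, h2, hv.self_of_nhds, mul_zero, add_zero]
  rw [Finset.sum_congr rfl fun k _ => mul_comm _ _, sum_mul_clm_dirV, fderiv_connForm hf]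
  simp only [Pi.sub_apply, Pi.smul_apply, smul_eq_mul]
  ring

/-- The Jacobi endomorphism in coordinates. -/
theorem sum_jacobiCoeff_mul (hf : ContDiffAt ℝ 2 (Γ.force φ) p) (s : Fin n → ℝ) :
    (fun i => ∑ j, Γ.jacobiCoeff φ i j p * s j) = vertJacobi (Γ.force φ) p s := by
  have hf1 := (hf.fderiv_right (m := 1) (by norm_num)).differentiableAt (by simp)
  have hf0 := hf.differentiableAt (by simp)
  funext i
  have hA : ∑ j, s j * fderiv ℝ (fun q => Γ.force φ q i) p (dirX j) =
      fderiv ℝ (Γ.force φ) p (0, s, 0) i := by rw [sum_mul_clm_dirX, fderiv_coord hf0]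
  have hB : ∑ j, s j * ∑ k, Γ.connCoeff φ i k p * Γ.connCoeff φ k j p =
      (1 / 4) * fderiv ℝ (Γ.force φ) p (0, 0, fderiv ℝ (Γ.force φ) p (0, 0, s)) i := by
    have hk : ∀ k, ∑ j, s j * Γ.connCoeff φ k j p =
        -(1 / 2) * fderiv ℝ (Γ.force φ) p (0, 0, s) k := fun k => by
      rw [← fderiv_coord hf0, ← sum_mul_clm_dirV, Finset.mul_sum]
      exact Finset.sum_congr rfl fun j _ => by rw [connCoeff]; ring
    simp only [Finset.mul_sum]
    rw [Finset.sum_comm]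
    rw [← fderiv_coord hf0, ← sum_mul_clm_dirV, Finset.mul_sum]
    refine Finset.sum_congr rfl fun k _ => ?_
    calc ∑ j, s j * (Γ.connCoeff φ i k p * Γ.connCoeff φ k j p)
        = Γ.connCoeff φ i k p * ∑ j, s j * Γ.connCoeff φ k j p := by
          rw [Finset.mul_sum]; exact Finset.sum_congr rfl fun j _ => by ring
      _ = _ := by rw [hk, connCoeff]; ring
  have hC : ∑ j, s j * Γ.alongFlow φ (Γ.connCoeff φ i j) p =
      -(1 / 2) * fderiv ℝ (fderiv ℝ (Γ.force φ)) p (1, p.2.2, Γ.force φ p) (0, 0, s) i := by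
    have hj : ∀ j, Γ.alongFlow φ (Γ.connCoeff φ i j) p =
        -(1 / 2) * fderiv ℝ (fderiv ℝ (Γ.force φ)) p (1, p.2.2, Γ.force φ p) (dirV j) i := by
      intro j
      have hev : Γ.connCoeff φ i j =ᶠ[𝓝 p] fun p =>
          -(1 / 2) * fderiv ℝ (Γ.force φ) p (dirV j) i := by
        filter_upwards [hf.eventually (by simp)] with p' hp'
        exact connCoeff_eq (hp'.differentiableAt (by simp)) i j
      have hd : HasFDerivAt (fun p => fderiv ℝ (Γ.force φ) p (dirV j)) _ p :=
        hf1.hasFDerivAt.clm_apply (hasFDerivAt_const (dirV j) p)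
      have hd' := (((ContinuousLinearMap.proj (R := ℝ) (φ := fun _ : Fin n => ℝ)
        i).hasFDerivAt).comp p hd).const_mul (-(1 / 2) : ℝ)
      rw [alongFlow, hev.fderiv_eq]
      refine (DFunLike.congr_fun hd'.fderiv _).trans ?_
      simp
    simp only [hj]
    have := sum_mul_clm_dirV ((ContinuousLinearMap.proj (R := ℝ) (φ := fun _ : Fin n => ℝ) i) ∘L
      fderiv ℝ (fderiv ℝ (Γ.force φ)) p (1, p.2.2, Γ.force φ p)) s
    simp only [ContinuousLinearMap.comp_apply, ContinuousLinearMap.proj_apply] at this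
    rw [← this, Finset.mul_sum]
    exact Finset.sum_congr rfl fun j _ => by ring
  calc ∑ j, Γ.jacobiCoeff φ i j p * s j
      = -∑ j, s j * fderiv ℝ (fun q => Γ.force φ q i) p (dirX j) -
        ∑ j, s j * ∑ k, Γ.connCoeff φ i k p * Γ.connCoeff φ k j p -
        ∑ j, s j * Γ.alongFlow φ (Γ.connCoeff φ i j) p := by
        rw [← Finset.sum_neg_distrib, ← Finset.sum_sub_distrib, ← Finset.sum_sub_distrib]
        exact Finset.sum_congr rfl fun j _ => by rw [jacobiCoeff]; ring
    _ = _ := by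
      rw [hA, hB, hC, vertJacobi]
      simp only [Pi.sub_apply, Pi.add_apply, Pi.neg_apply, Pi.smul_apply, smul_eq_mul]
      ring

end SODE

end CoordinateFormulas

/-! ### Jet coordinates on J¹τ and changes of adapted charts. -/

section JetBundleCoordinates

set_option linter.unusedSectionVars false

open Set Filter

variable {n : ℕ} {M : Type*} [TopologicalSpace M] [ChartedSpace (EventModel n) M]
  [IsManifold 𝓘(ℝ, EventModel n) ∞ M] {τ : M → ℝ}

namespace AdaptedChart

variable (φ ψ : AdaptedChart (n := n) τ)

theorem mdifferentiable : φ.chart.MDifferentiable 𝓘(ℝ, EventModel n) 𝓘(ℝ, EventModel n) :=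
  ⟨(contMDiffOn_of_mem_maximalAtlas φ.mem_maximalAtlas).mdifferentiableOn (by simp),
    (contMDiffOn_symm_of_mem_maximalAtlas φ.mem_maximalAtlas).mdifferentiableOn (by simp)⟩

variable {φ ψ}

theorem components_add (m : M) (X Y : TangentSpace 𝓘(ℝ, EventModel n) m) :
    φ.components m (X + Y) = φ.components m X + φ.components m Y :=
  map_add (mfderiv 𝓘(ℝ, EventModel n) 𝓘(ℝ, EventModel n) φ.chart m) X Y

theorem components_ofComponents {m : M} (hm : m ∈ φ.chart.source) (w : EventModel n) :
    φ.components m (φ.ofComponents m w) = w := by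
  have h := φ.mdifferentiable.comp_symm_deriv (φ.chart.map_source hm)
  rw [φ.chart.left_inv hm] at h
  exact DFunLike.congr_fun h w

theorem ofComponents_components {m : M} (hm : m ∈ φ.chart.source)
    (X : TangentSpace 𝓘(ℝ, EventModel n) m) :
    φ.ofComponents m (φ.components m X) = X :=
  DFunLike.congr_fun (φ.mdifferentiable.symm_comp_deriv hm) X

/-- The isomorphism between the tangent space at `m` and the space of components. -/
noncomputable def componentsEquiv {m : M} (hm : m ∈ φ.chart.source) :
    TangentSpace 𝓘(ℝ, EventModel n) m ≃ₗ[ℝ] EventModel n :=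
  { (mfderiv 𝓘(ℝ, EventModel n) 𝓘(ℝ, EventModel n) φ.chart m).toLinearMap with
    toFun := φ.components m
    invFun := φ.ofComponents m
    left_inv := ofComponents_components hm
    right_inv := components_ofComponents hm }

/-- Since τ is the first coordinate of every adapted chart, its differential reads off the first
component. Verticality and the normalization dτ = 1 thus look the same in all adapted charts. -/
theorem mfderiv_tau_eq {m : M} (hm : m ∈ φ.chart.source) (X : TangentSpace 𝓘(ℝ, EventModel n) m) :
    mfderiv 𝓘(ℝ, EventModel n) 𝓘(ℝ, ℝ) τ m X = (φ.components m X).1 := by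
  have hev : τ =ᶠ[𝓝 m] fun m => (φ.chart m).1 := by
    filter_upwards [φ.chart.open_source.mem_nhds hm] with m' hm' using (φ.fst_eq m' hm').symm
  have h1 : HasMFDerivAt 𝓘(ℝ, EventModel n) 𝓘(ℝ, EventModel n) φ.chart m
      (mfderiv 𝓘(ℝ, EventModel n) 𝓘(ℝ, EventModel n) φ.chart m) :=
    (φ.mdifferentiable.mdifferentiableAt hm).hasMFDerivAt
  have h2 : HasMFDerivAt 𝓘(ℝ, EventModel n) 𝓘(ℝ, ℝ) (Prod.fst : EventModel n → ℝ) (φ.chart m)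
      (ContinuousLinearMap.fst ℝ ℝ (Fin n → ℝ)) := hasFDerivAt_fst.hasMFDerivAt
  rw [hev.mfderiv_eq]
  exact DFunLike.congr_fun (h2.comp m h1).mfderiv X

theorem mem_verticalSpace_iff {m : M} (hm : m ∈ φ.chart.source)
    (X : TangentSpace 𝓘(ℝ, EventModel n) m) :
    X ∈ verticalSpace τ m ↔ (φ.components m X).1 = 0 := by
  rw [← mfderiv_tau_eq hm]
  exact Iff.rfl

theorem components_velocity {z : JetBundle n τ} (hz : z.base ∈ φ.chart.source) :
    φ.components z.base z.1.snd = jetVel (φ.jetCoord z) :=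
  Prod.ext ((mfderiv_tau_eq hz _).symm.trans z.2) rfl

theorem jetCoord_mem {z : JetBundle n τ} (hz : z.base ∈ φ.chart.source) :
    φ.jetCoord z ∈ φ.jetTarget := φ.chart.map_source hz

theorem jetPos_jetCoord (z : JetBundle n τ) : jetPos (φ.jetCoord z) = φ.chart z.base := rfl

theorem base_jetPoint_mem {p : JetModel n} (hp : p ∈ φ.jetTarget) :
    (φ.jetPoint p hp).base ∈ φ.chart.source := φ.chart.map_target hp

theorem chart_base_jetPoint {p : JetModel n} (hp : p ∈ φ.jetTarget) :
    φ.chart (φ.jetPoint p hp).base = jetPos p := φ.chart.right_inv hp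

theorem jetCoord_jetPoint {p : JetModel n} (hp : p ∈ φ.jetTarget) :
    φ.jetCoord (φ.jetPoint p hp) = p := by
  have h0 := chart_base_jetPoint hp
  have h1 : φ.components (φ.jetPoint p hp).base (φ.jetPoint p hp).1.snd = jetVel p :=
    DFunLike.congr_fun (φ.mdifferentiable.comp_symm_deriv (x := jetPos p) hp) (jetVel p)
  have e1 : (φ.chart (φ.jetPoint p hp).base).1 = p.1 := congrArg Prod.fst h0
  have e2 : (φ.chart (φ.jetPoint p hp).base).2 = p.2.1 := congrArg Prod.snd h0
  have e3 : (φ.components (φ.jetPoint p hp).base (φ.jetPoint p hp).1.snd).2 = p.2.2 :=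
    congrArg Prod.snd h1
  exact Prod.ext e1 (Prod.ext e2 e3)

theorem jetPoint_jetCoord {z : JetBundle n τ} (hz : z.base ∈ φ.chart.source) :
    φ.jetPoint (φ.jetCoord z) (jetCoord_mem hz) = z := by
  have h1 := φ.ofComponents_components hz z.1.snd
  rw [components_velocity hz] at h1
  have h2 : φ.chart.symm (jetPos (φ.jetCoord z)) = z.base := φ.chart.left_inv hz
  refine Subtype.ext ?_
  show (⟨φ.chart.symm (jetPos (φ.jetCoord z)),
    mfderiv 𝓘(ℝ, EventModel n) 𝓘(ℝ, EventModel n) φ.chart.symm (jetPos (φ.jetCoord z))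
      (jetVel (φ.jetCoord z))⟩ : TangentBundle 𝓘(ℝ, EventModel n) M) = z.1
  -- The two base points are equal only propositionally; generalizing over them lets the tangent
  -- vectors be compared in the model space.
  have h3 : ∀ (m : M) (X : TangentSpace 𝓘(ℝ, EventModel n) m), m = z.base →
      (show EventModel n from X) = (show EventModel n from z.1.snd) →
      (⟨m, X⟩ : TangentBundle 𝓘(ℝ, EventModel n) M) = z.1 := by
    rintro m X rfl h
    exact congrArg (fun X => (⟨z.base, X⟩ : TangentBundle 𝓘(ℝ, EventModel n) M)) h
  exact h3 _ _ h2 h1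

theorem localRep_jetCoord {F : Type*} [Zero F] (g : JetBundle n τ → F) {z : JetBundle n τ}
    (hz : z.base ∈ φ.chart.source) : φ.localRep g (φ.jetCoord z) = g z := by
  rw [localRep, dif_pos (jetCoord_mem hz), jetPoint_jetCoord hz]

theorem fieldRep_jetCoord (σ : FieldAlong n τ) {z : JetBundle n τ}
    (hz : z.base ∈ φ.chart.source) : φ.fieldRep σ (φ.jetCoord z) = φ.components z.base (σ z) :=
  localRep_jetCoord _ hz

theorem fieldRep_of_mem (σ : FieldAlong n τ) {p : JetModel n} (hp : p ∈ φ.jetTarget) :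
    φ.fieldRep σ p = φ.components (φ.jetPoint p hp).base (σ (φ.jetPoint p hp)) := dif_pos hp

theorem isOpen_jetTarget : IsOpen φ.jetTarget :=
  φ.chart.open_target.preimage (by fun_prop : Continuous fun p : JetModel n => (p.1, p.2.1))

theorem isOpen_base_preimage {U : Set M} (hU : IsOpen U) :
    IsOpen {z : JetBundle n τ | z.base ∈ U} :=
  hU.preimage ((FiberBundle.continuous_proj (EventModel n)
    (TangentSpace 𝓘(ℝ, EventModel n) (M := M))).comp continuous_subtype_val)

theorem contMDiffOn_components :
    ContMDiffOn 𝓘(ℝ, EventModel n).tangent 𝓘(ℝ, EventModel n) ∞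
      (fun z : TangentBundle 𝓘(ℝ, EventModel n) M => φ.components z.proj z.snd)
      {z | z.proj ∈ φ.chart.source} := by
  have h1 := (contMDiffOn_of_mem_maximalAtlas φ.mem_maximalAtlas).contMDiffOn_tangentMapWithin
    (m := ∞) (by simp) φ.chart.open_source.uniqueMDiffOn
  have h2 := (contMDiff_snd_tangentBundle_modelSpace (EventModel n)
    𝓘(ℝ, EventModel n) (n := ∞)).comp_contMDiffOn h1
  refine h2.congr fun z hz => ?_
  show mfderiv 𝓘(ℝ, EventModel n) 𝓘(ℝ, EventModel n) φ.chart z.proj z.snd =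
    mfderivWithin 𝓘(ℝ, EventModel n) 𝓘(ℝ, EventModel n) φ.chart φ.chart.source z.proj z.snd
  rw [mfderivWithin_of_isOpen φ.chart.open_source hz]

theorem continuousOn_jetCoord :
    ContinuousOn φ.jetCoord {z : JetBundle n τ | z.base ∈ φ.chart.source} := by
  have h1 : ContinuousOn (fun z : JetBundle n τ => φ.chart z.base)
      {z : JetBundle n τ | z.base ∈ φ.chart.source} :=
    φ.chart.continuousOn.comp ((FiberBundle.continuous_proj (EventModel n)
      (TangentSpace 𝓘(ℝ, EventModel n) (M := M))).comp continuous_subtype_val).continuousOn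
      fun z hz => hz
  have h2 : ContinuousOn (fun z : JetBundle n τ => φ.components z.1.proj z.1.snd)
      {z : JetBundle n τ | z.base ∈ φ.chart.source} :=
    φ.contMDiffOn_components.continuousOn.comp continuous_subtype_val.continuousOn fun z hz => hz
  exact h1.fst.prodMk (h1.snd.prodMk h2.snd)

theorem continuousOn_liftTangent : ContinuousOn φ.liftTangent φ.jetTarget := by
  have h1 := (contMDiffOn_symm_of_mem_maximalAtlas
    φ.mem_maximalAtlas).continuousOn_tangentMapWithin (by simp) φ.chart.open_target.uniqueMDiffOn
  have h2 : Continuous fun p : JetModel n =>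
      (⟨jetPos p, jetVel p⟩ : TangentBundle 𝓘(ℝ, EventModel n) (EventModel n)) := by
    have := (tangentBundleModelSpaceHomeomorph 𝓘(ℝ, EventModel n)).symm.continuous
    have h3 : Continuous fun p : JetModel n =>
      ((jetPos p, jetVel p) : ModelProd (EventModel n) (EventModel n)) := by
      unfold jetPos jetVel; exact Continuous.prodMk (by fun_prop) (by fun_prop)
    exact this.comp h3
  refine (h1.comp h2.continuousOn fun p hp => hp).congr fun p hp => ?_
  show (⟨_, mfderiv 𝓘(ℝ, EventModel n) 𝓘(ℝ, EventModel n) φ.chart.symm (jetPos p) (jetVel p)⟩ :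
    TangentBundle 𝓘(ℝ, EventModel n) M) =
    ⟨_, mfderivWithin 𝓘(ℝ, EventModel n) 𝓘(ℝ, EventModel n) φ.chart.symm φ.chart.target
      (jetPos p) (jetVel p)⟩
  rw [mfderivWithin_of_isOpen φ.chart.open_target hp]

/-- Together with `exists_isOpen_of_eventually`, this moves local statements between open sets of
jets and neighbourhoods in the space of coordinates. -/
theorem eventually_jetPoint_mem {W : Set (JetBundle n τ)} (hW : IsOpen W) {z : JetBundle n τ}
    (hz : z.base ∈ φ.chart.source) (hzW : z ∈ W) :
    ∀ᶠ p in 𝓝 (φ.jetCoord z), ∃ hp : p ∈ φ.jetTarget, φ.jetPoint p hp ∈ W := by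
  obtain ⟨W', hW', rfl⟩ := isOpen_induced_iff.1 hW
  have h1 := φ.continuousOn_liftTangent.isOpen_inter_preimage isOpen_jetTarget hW'
  have h2 : φ.jetCoord z ∈ φ.jetTarget ∩ φ.liftTangent ⁻¹' W' := by
    refine ⟨jetCoord_mem hz, ?_⟩
    show (φ.jetPoint (φ.jetCoord z) (jetCoord_mem hz)).1 ∈ W'
    rw [jetPoint_jetCoord hz]
    exact hzW
  filter_upwards [h1.mem_nhds h2] with p hp
  exact ⟨hp.1, hp.2⟩

theorem exists_isOpen_of_eventually {P : JetModel n → Prop} {z : JetBundle n τ}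
    (hz : z.base ∈ φ.chart.source) (hP : ∀ᶠ p in 𝓝 (φ.jetCoord z), P p) :
    ∃ W : Set (JetBundle n τ), IsOpen W ∧ z ∈ W ∧
      ∀ y ∈ W, y.base ∈ φ.chart.source ∧ P (φ.jetCoord y) := by
  obtain ⟨S, hS, hSo, hzS⟩ := eventually_nhds_iff.1 hP
  exact ⟨_, φ.continuousOn_jetCoord.isOpen_inter_preimage
    (isOpen_base_preimage φ.chart.open_source) hSo, ⟨hz, hzS⟩, fun y hy => ⟨hy.1, hS _ hy.2⟩⟩

variable (φ ψ) in
/-- The change of coordinates from `φ` to `ψ`. -/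
noncomputable def transition : EventModel n → EventModel n := fun q => ψ.chart (φ.chart.symm q)

theorem contDiffAt_transition {m : M} (h1 : m ∈ φ.chart.source) (h2 : m ∈ ψ.chart.source) :
    ContDiffAt ℝ ∞ (φ.transition ψ) (φ.chart m) := by
  rw [← contMDiffAt_iff_contDiffAt]
  have ha := contMDiffAt_symm_of_mem_maximalAtlas φ.mem_maximalAtlas (φ.chart.map_source h1)
  have hb : ContMDiffAt 𝓘(ℝ, EventModel n) 𝓘(ℝ, EventModel n) ∞ ψ.chart
      (φ.chart.symm (φ.chart m)) := by
    rw [φ.chart.left_inv h1]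
    exact contMDiffAt_of_mem_maximalAtlas ψ.mem_maximalAtlas h2
  exact hb.comp _ ha

theorem components_eq_fderiv_transition {m : M} (h1 : m ∈ φ.chart.source)
    (h2 : m ∈ ψ.chart.source) (X : TangentSpace 𝓘(ℝ, EventModel n) m) :
    ψ.components m X = fderiv ℝ (φ.transition ψ) (φ.chart m) (φ.components m X) := by
  have hev : ψ.chart =ᶠ[𝓝 m] fun m => φ.transition ψ (φ.chart m) := by
    filter_upwards [φ.chart.open_source.mem_nhds h1] with m' hm'
    rw [transition, φ.chart.left_inv hm']
  have ha := (φ.mdifferentiable.mdifferentiableAt h1).hasMFDerivAt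
  have hb := ((contDiffAt_transition h1 h2).differentiableAt (by simp)).hasFDerivAt.hasMFDerivAt
  exact DFunLike.congr_fun ((hb.comp m ha).congr_of_eventuallyEq hev).mfderiv X

end AdaptedChart

namespace SODE

variable {Γ : SODE n τ} {φ ψ : AdaptedChart (n := n) τ}

theorem contDiffAt_force {p : JetModel n} (hp : p ∈ φ.jetTarget) :
    ContDiffAt ℝ ∞ (Γ.force φ) p :=
  (Γ.smooth φ).contDiffAt (AdaptedChart.isOpen_jetTarget.mem_nhds hp)

theorem force_jetCoord {z : JetBundle n τ} (hz : z.base ∈ φ.chart.source) :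
    Γ.force φ (φ.jetCoord z) =
      mfderiv 𝓘(ℝ, EventModel n).tangent 𝓘(ℝ, Fin n → ℝ) φ.velocity z.1 (Γ.toFun z) :=
  AdaptedChart.localRep_jetCoord _ hz

/-- The transformation law of the forces under a change of adapted coordinates. -/
theorem force_transition {z : JetBundle n τ} (h1 : z.base ∈ φ.chart.source)
    (h2 : z.base ∈ ψ.chart.source) :
    Γ.force ψ (ψ.jetCoord z) =
      (fderiv ℝ (fderiv ℝ (φ.transition ψ)) (φ.chart z.base) (jetVel (φ.jetCoord z))
        (jetVel (φ.jetCoord z)) +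
        fderiv ℝ (φ.transition ψ) (φ.chart z.base) (0, Γ.force φ (φ.jetCoord z))).2 := by
  set I := 𝓘(ℝ, EventModel n)
  have hop : {y : TangentBundle I M | y.proj ∈ φ.chart.source} ∈ 𝓝 z.1 :=
    (φ.chart.open_source.preimage (FiberBundle.continuous_proj (EventModel n)
      (TangentSpace I (M := M)))).mem_nhds h1
  have hop2 : {y : TangentBundle I M | y.proj ∈ ψ.chart.source} ∈ 𝓝 z.1 :=
    (ψ.chart.open_source.preimage (FiberBundle.continuous_proj (EventModel n)
      (TangentSpace I (M := M)))).mem_nhds h2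
  set C₂ : TangentBundle I M → EventModel n := fun y => φ.components y.proj y.snd
  have hC₂ : MDifferentiableAt I.tangent I C₂ z.1 :=
    (φ.contMDiffOn_components.contMDiffAt hop).mdifferentiableAt (by simp)
  have hproj : MDifferentiableAt I.tangent I
      (fun y : TangentBundle I M => y.proj) z.1 :=
    (Bundle.contMDiff_proj (TangentSpace I (M := M)) (n := ∞)).mdifferentiableAt (by simp)
  have hchart : MDifferentiableAt I I φ.chart z.1.proj := φ.mdifferentiable.mdifferentiableAt h1
  set C₁ : TangentBundle I M → EventModel n := fun y => φ.chart y.proj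
  have hC₁ : HasMFDerivAt I.tangent I C₁ z.1 _ :=
    HasMFDerivAt.comp (g := φ.chart) z.1 hchart.hasMFDerivAt hproj.hasMFDerivAt
  -- The derivative of the base coordinates along Γ is the velocity, since Γ projects to the
  -- canonical section. That of the components is (0, f), whose zero expresses tangency to J¹τ. The
  -- velocity in `ψ` is a function of these two, and the chain rule finishes.
  have hC₁Γ : mfderiv I.tangent I C₁ z.1 (Γ.toFun z) = jetVel (φ.jetCoord z) := by
    rw [hC₁.mfderiv, ← AdaptedChart.components_velocity h1]
    exact congrArg (φ.components z.base) (Γ.projects z)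
  have hfst : HasMFDerivAt I.tangent 𝓘(ℝ, ℝ) (fun y => (C₂ y).1) z.1 _ :=
    HasMFDerivAt.comp (g := (Prod.fst : EventModel n → ℝ)) z.1
      hasFDerivAt_fst.hasMFDerivAt hC₂.hasMFDerivAt
  have hsnd : HasMFDerivAt I.tangent 𝓘(ℝ, Fin n → ℝ) (fun y => (C₂ y).2) z.1 _ :=
    HasMFDerivAt.comp (g := (Prod.snd : EventModel n → Fin n → ℝ)) z.1
      hasFDerivAt_snd.hasMFDerivAt hC₂.hasMFDerivAt
  have hC₂Γ : mfderiv I.tangent I C₂ z.1 (Γ.toFun z) =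
      ((0, Γ.force φ (φ.jetCoord z)) : EventModel n) := by
    refine Prod.ext ?_ ?_
    · have hev : (dTime τ : TangentBundle I M → ℝ) =ᶠ[𝓝 z.1] fun y => (C₂ y).1 := by
        filter_upwards [hop] with y hy using AdaptedChart.mfderiv_tau_eq hy y.snd
      have ha := Γ.tangent z
      rw [hev.mfderiv_eq, hfst.mfderiv] at ha
      exact ha
    · show _ = Γ.force φ (φ.jetCoord z)
      rw [force_jetCoord h1]
      exact (DFunLike.congr_fun hsnd.mfderiv (Γ.toFun z)).symm
  set χ := φ.transition ψ
  have hχ : ContDiffAt ℝ ∞ χ (φ.chart z.base) := AdaptedChart.contDiffAt_transition h1 h2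
  have hχ' := ((hχ.fderiv_right (m := ∞) (by simp)).differentiableAt (by simp)).hasFDerivAt
  set C : TangentBundle I M → EventModel n × EventModel n := fun y => (C₁ y, C₂ y)
  have hC : MDifferentiableAt I.tangent 𝓘(ℝ, EventModel n × EventModel n) C z.1 :=
    hC₁.mdifferentiableAt.prodMk_space hC₂
  have hCΓ : mfderiv I.tangent 𝓘(ℝ, EventModel n × EventModel n) C z.1 (Γ.toFun z) =
      (((jetVel (φ.jetCoord z)), ((0, Γ.force φ (φ.jetCoord z)) : EventModel n)) :
        EventModel n × EventModel n) := by
    have ha : HasMFDerivAt I.tangent I C₁ z.1 _ :=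
      HasMFDerivAt.comp (g := (Prod.fst : EventModel n × EventModel n → EventModel n)) z.1
        hasFDerivAt_fst.hasMFDerivAt hC.hasMFDerivAt
    have hb : HasMFDerivAt I.tangent I C₂ z.1 _ :=
      HasMFDerivAt.comp (g := (Prod.snd : EventModel n × EventModel n → EventModel n)) z.1
        hasFDerivAt_snd.hasMFDerivAt hC.hasMFDerivAt
    exact Prod.ext ((DFunLike.congr_fun ha.mfderiv (Γ.toFun z)).symm.trans hC₁Γ)
      ((DFunLike.congr_fun hb.mfderiv (Γ.toFun z)).symm.trans hC₂Γ)
  set D : EventModel n × EventModel n →L[ℝ] (Fin n → ℝ) :=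
    ContinuousLinearMap.snd ℝ ℝ (Fin n → ℝ) ∘L
    (fderiv ℝ χ (C z.1).1 ∘L ContinuousLinearMap.snd ℝ (EventModel n) (EventModel n) +
      (fderiv ℝ (fderiv ℝ χ) (φ.chart z.base) ∘L
        ContinuousLinearMap.fst ℝ (EventModel n) (EventModel n)).flip (C z.1).2)
  have hH : HasFDerivAt (fun x : EventModel n × EventModel n => (fderiv ℝ χ x.1 x.2).2) D (C z.1) :=
    ((HasFDerivAt.comp (g := fderiv ℝ χ) (C z.1) hχ' hasFDerivAt_fst).clm_apply
      hasFDerivAt_snd).snd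
  have hev : ψ.velocity =ᶠ[𝓝 z.1] fun y => (fderiv ℝ χ (C y).1 (C y).2).2 := by
    filter_upwards [hop, hop2] with y hy hy'
    exact congrArg Prod.snd (AdaptedChart.components_eq_fderiv_transition hy hy' y.snd)
  have hvel := (HasMFDerivAt.comp z.1 hH.hasMFDerivAt hC.hasMFDerivAt).congr_of_eventuallyEq hev
  rw [force_jetCoord h2, hvel.mfderiv]
  refine (congrArg D hCΓ).trans ?_
  have hw : (C z.1).2 = jetVel (φ.jetCoord z) := AdaptedChart.components_velocity h1
  show (fderiv ℝ χ (C z.1).1 (0, Γ.force φ (φ.jetCoord z)) +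
    fderiv ℝ (fderiv ℝ χ) (φ.chart z.base) (jetVel (φ.jetCoord z)) (C z.1).2).2 = _
  rw [hw, add_comm]
  rfl

end SODE

end JetBundleCoordinates

/-! ### From closed subsystems to parallel invariant distributions. -/

section CoordinateDistributions

set_option linter.unusedSectionVars false

open Set Filter

variable {n : ℕ} {M : Type*} [TopologicalSpace M] [ChartedSpace (EventModel n) M]
  [IsManifold 𝓘(ℝ, EventModel n) ∞ M] {τ : M → ℝ}

namespace AdaptedChart

variable {φ ψ : AdaptedChart (n := n) τ} {I : Set (Fin n)}

/-- A field along `π` is smooth if its components in one coordinate system are. -/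
theorem smoothOver_of_components {S : JetModel n → EventModel n} {W : Set (JetBundle n τ)}
    (hW : ∀ z ∈ W, z.base ∈ φ.chart.source) (hS : ∀ z ∈ W, ContDiffAt ℝ ∞ S (φ.jetCoord z)) :
    FieldAlong.SmoothOver (n := n) (τ := τ)
      (fun z => φ.ofComponents z.base (S (φ.jetCoord z))) W := by
  intro φ' z hzW hz'
  have hz := hW z hzW
  have hχ := contDiffAt_transition hz' hz
  have hχ' : ContDiffAt ℝ ∞ (φ.transition φ') (φ'.transition φ (φ'.chart z.base)) := by
    rw [transition, φ'.chart.left_inv hz']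
    exact contDiffAt_transition hz hz'
  have hpos : ContDiffAt ℝ ∞ (jetPos : JetModel n → EventModel n) (φ'.jetCoord z) := by
    unfold jetPos; fun_prop
  have hvel : ContDiffAt ℝ ∞ (jetVel : JetModel n → EventModel n) (φ'.jetCoord z) := by
    unfold jetVel; fun_prop
  have hχp : ContDiffAt ℝ ∞ (fun p => φ'.transition φ (jetPos p)) (φ'.jetCoord z) :=
    ContDiffAt.comp (g := φ'.transition φ) _ hχ hpos
  -- `J` is the induced change of jet coordinates. The components of the field in the new chart are
  -- obtained from `S` by precomposing with `J` and applying the differential of the base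
  -- transition.
  set J : JetModel n → JetModel n := fun p => ((φ'.transition φ (jetPos p)).1,
    (φ'.transition φ (jetPos p)).2, (fderiv ℝ (φ'.transition φ) (jetPos p) (jetVel p)).2)
  have hJ : ContDiffAt ℝ ∞ J (φ'.jetCoord z) := by
    refine hχp.fst.prodMk (hχp.snd.prodMk (ContDiffAt.snd (ContDiffAt.clm_apply ?_ hvel)))
    exact ContDiffAt.comp (φ'.jetCoord z) (g := fderiv ℝ (φ'.transition φ))
      (hχ.fderiv_right (m := ∞) (by simp)) hpos
  have hJz : ∀ y : JetBundle n τ, y.base ∈ φ'.chart.source → y.base ∈ φ.chart.source →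
      J (φ'.jetCoord y) = φ.jetCoord y := by
    intro y hy' hy
    have h1 : φ'.transition φ (jetPos (φ'.jetCoord y)) = φ.chart y.base := by
      rw [jetPos_jetCoord, transition, φ'.chart.left_inv hy']
    have h2 : (fderiv ℝ (φ'.transition φ) (φ'.chart y.base) (jetVel (φ'.jetCoord y))).2 =
        φ.velocity y.1 := by
      rw [← components_velocity hy']
      exact (congrArg Prod.snd (components_eq_fderiv_transition hy' hy y.1.snd)).symm
    have e1 : (J (φ'.jetCoord y)).1 = (φ.jetCoord y).1 := (congrArg Prod.fst h1 :)
    have e2 : (J (φ'.jetCoord y)).2.1 = (φ.jetCoord y).2.1 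
      := (congrArg Prod.snd h1 :)
    exact Prod.ext e1 (Prod.ext e2 h2)
  have hSz : ContDiffAt ℝ ∞ S (J (φ'.jetCoord z)) := by
    rw [hJz z hz' hz]; exact hS z hzW
  have h1 : ContDiffAt ℝ ∞ (fun p : JetModel n =>
      fderiv ℝ (φ.transition φ') (φ'.transition φ (jetPos p)) (S (J p))) (φ'.jetCoord z) := by
    refine ContDiffAt.clm_apply ?_ (hSz.comp _ hJ)
    exact ContDiffAt.comp (φ'.jetCoord z) (g := fderiv ℝ (φ.transition φ'))
      (hχ'.fderiv_right (m := ∞) (by simp)) hχp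
  refine h1.congr_of_eventuallyEq ?_
  filter_upwards [eventually_jetPoint_mem (isOpen_base_preimage φ.chart.open_source) hz' hz]
    with p ⟨hp, hpφ⟩
  have hp' := base_jetPoint_mem hp
  have h2 := hJz _ hp' hpφ
  rw [jetCoord_jetPoint hp] at h2
  rw [fieldRep_of_mem _ hp, components_eq_fderiv_transition hpφ hp', components_ofComponents hpφ,
    h2]
  rfl

/-- The field along `π` with constant components. -/
noncomputable def constField (ψ : AdaptedChart (n := n) τ) (w : EventModel n) : FieldAlong n τ :=
  fun z => ψ.ofComponents z.base w

theorem smoothOver_constField (w : EventModel n) :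
    (ψ.constField w).SmoothOver {z | z.base ∈ ψ.chart.source} :=
  smoothOver_of_components (φ := ψ) (S := fun _ => w) (fun _ hz => hz) fun _ _ => contDiffAt_const

/-- The distribution spanned by the coordinate fields `∂/∂xⁱ` with `i ∉ I`. -/
noncomputable def coordDistribution (ψ : AdaptedChart (n := n) τ) (I : Set (Fin n)) :
    DistributionAlong n τ := fun z =>
  { carrier := {X | (ψ.components z.base X).1 = 0 ∧ ∀ i ∈ I, (ψ.components z.base X).2 i = 0}
    add_mem' := fun {X Y} hX hY => by
      have h : ψ.components z.base (X + Y) = _ := components_add z.base X Y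
      refine ⟨by rw [h]; exact (congrArg₂ (· + ·) hX.1 hY.1).trans (add_zero 0), fun i hi => ?_⟩
      rw [h]
      exact (congrArg₂ (· + ·) (hX.2 i hi) (hY.2 i hi)).trans (add_zero 0)
    zero_mem' := by
      have h : ψ.components z.base 0 = 0 :=
        map_zero (mfderiv 𝓘(ℝ, EventModel n) 𝓘(ℝ, EventModel n) ψ.chart z.base)
      exact ⟨by rw [h]; rfl, fun i _ => by rw [h]; rfl⟩
    smul_mem' := fun c X hX => by
      have h : ψ.components z.base (c • X) = c • ψ.components z.base X :=
        map_smul (mfderiv 𝓘(ℝ, EventModel n) 𝓘(ℝ, EventModel n) ψ.chart z.base) c X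
      refine ⟨by rw [h]; exact (congrArg (c * ·) hX.1).trans (mul_zero c), fun i hi => ?_⟩
      rw [h]
      exact (congrArg (c * ·) (hX.2 i hi)).trans (mul_zero c) }

theorem mem_coordDistribution {z : JetBundle n τ}
    {X : TangentSpace 𝓘(ℝ, EventModel n) z.base} : X ∈ ψ.coordDistribution I z ↔
      (ψ.components z.base X).1 = 0 ∧ ∀ i ∈ I, (ψ.components z.base X).2 i = 0 := Iff.rfl

theorem ofComponents_mem_coordDistribution {z : JetBundle n τ} (hz : z.base ∈ ψ.chart.source)
    {w : EventModel n} :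
    ψ.ofComponents z.base w ∈ ψ.coordDistribution I z ↔ w.1 = 0 ∧ ∀ i ∈ I, w.2 i = 0 := by
  rw [mem_coordDistribution, components_ofComponents hz]

/-- The coordinates of `ψ` with index in `I`, as functions of the coordinates `φ`. -/
noncomputable def subTransition (φ ψ : AdaptedChart (n := n) τ) (I : Set (Fin n)) :
    EventModel n → I → ℝ := fun q i => (φ.transition ψ q).2 i

theorem isSubbundleOver_coordDistribution :
    (ψ.coordDistribution I).IsSubbundleOver ψ.chart.source := by
  classical
  intro z hz
  set e : Fin (Fintype.card (Iᶜ : Set (Fin n))) ≃ (Iᶜ : Set (Fin n)) :=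
    (Fintype.equivFin _).symm
  set b : Fin (Fintype.card (Iᶜ : Set (Fin n))) → EventModel n := fun a => (0, Pi.single (e a) 1)
  have hne : ∀ a, ∀ i ∈ I, i ≠ (e a : Fin n) := fun a i hi h => (e a).2 (h ▸ hi)
  have hb : LinearIndependent ℝ b := by
    have h1 : LinearIndependent ℝ fun a => (Pi.single ((e a : Fin n)) 1 : Fin n → ℝ) := by
      have := (Pi.basisFun ℝ (Fin n)).linearIndependent.comp (fun a => (e a : Fin n))
        (Subtype.val_injective.comp e.injective)
      simpa [Function.comp_def] using this
    exact h1.map' (LinearMap.inr ℝ ℝ (Fin n → ℝ)) (LinearMap.ker_eq_bot.2 LinearMap.inr_injective)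
  refine ⟨{z | z.base ∈ ψ.chart.source}, isOpen_base_preimage ψ.chart.open_source, hz, _,
    fun a => ψ.constField (b a), fun a => smoothOver_constField _, fun y hy => ⟨?_, ?_⟩⟩
  · exact hb.map' (componentsEquiv hy).symm.toLinearMap (LinearEquiv.ker _)
  · apply le_antisymm
    · rw [Submodule.span_le]
      rintro _ ⟨a, rfl⟩
      refine (ofComponents_mem_coordDistribution hy).2 ⟨rfl, fun i hi => ?_⟩
      exact Pi.single_eq_of_ne (hne a i hi) _
    · intro X hX
      have hsum : ψ.components y.base X = ∑ a, (ψ.components y.base X).2 (e a) • b a := by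
        set w := ψ.components y.base X
        have h2 : ∑ a, w.2 (e a) • (Pi.single ((e a : Fin n)) 1 : Fin n → ℝ) = w.2 := by
          funext i
          rw [Finset.sum_apply]
          by_cases hi : i ∈ I
          · rw [show w.2 i = 0 from hX.2 i hi]
            exact Finset.sum_eq_zero fun a _ => by
              rw [Pi.smul_apply, Pi.single_eq_of_ne (hne a i hi), smul_zero]
          · obtain ⟨a₀, ha₀⟩ := e.surjective ⟨i, hi⟩
            have hi' : i = e a₀ := (congrArg Subtype.val ha₀).symm
            rw [Finset.sum_eq_single a₀]
            · rw [← hi', Pi.smul_apply, Pi.single_eq_same, smul_eq_mul, mul_one]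
            · intro a _ ha
              rw [Pi.smul_apply, Pi.single_eq_of_ne, smul_zero]
              intro h
              exact ha (e.injective (Subtype.ext (h.symm.trans hi')))
            · exact fun h => absurd (Finset.mem_univ _) h
        refine Prod.ext ?_ ?_
        · rw [Prod.fst_sum]
          simp [b]
          exact hX.1
        · rw [Prod.snd_sum]
          exact h2.symm
      have hX' : X = ∑ a, (ψ.components y.base X).2 (e a) • ψ.constField (b a) y := by
        have := congrArg (componentsEquiv hy).symm hsum
        rw [map_sum] at this
        simp only [map_smul] at this
        exact ((componentsEquiv hy).symm_apply_apply X).symm.trans this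
      rw [hX']
      exact Submodule.sum_mem _ fun a _ => Submodule.smul_mem _ _
        (Submodule.subset_span ⟨a, rfl⟩)

variable [Fintype I]

variable (I) in
/-- The projection of `(t, x)` to the coordinates `xⁱ` with index in `I`. -/
noncomputable def projCLM : EventModel n →L[ℝ] (I → ℝ) :=
  ContinuousLinearMap.pi fun i =>
    (ContinuousLinearMap.proj (R := ℝ) (φ := fun _ : Fin n => ℝ) (i : Fin n)) ∘L
      ContinuousLinearMap.snd ℝ ℝ (Fin n → ℝ)

@[simp]
theorem projCLM_apply (w : EventModel n) (i : I) : projCLM I w i = w.2 i := rfl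

theorem contDiffAt_subTransition {m : M} (h1 : m ∈ φ.chart.source) (h2 : m ∈ ψ.chart.source) :
    ContDiffAt ℝ ∞ (φ.subTransition ψ I) (φ.chart m) :=
  ContDiffAt.comp (g := projCLM I) _ (projCLM I).contDiff.contDiffAt (contDiffAt_transition h1 h2)

theorem fderiv_subTransition {m : M} (h1 : m ∈ φ.chart.source) (h2 : m ∈ ψ.chart.source) :
    fderiv ℝ (φ.subTransition ψ I) (φ.chart m) =
      projCLM I ∘L fderiv ℝ (φ.transition ψ) (φ.chart m) :=
  (HasFDerivAt.comp (g := projCLM I) _ (projCLM I).hasFDerivAt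
    ((contDiffAt_transition h1 h2).differentiableAt (by simp)).hasFDerivAt).fderiv

theorem eventually_chart_symm_mem {m : M} (h1 : m ∈ φ.chart.source) (h2 : m ∈ ψ.chart.source) :
    ∀ᶠ q in 𝓝 (φ.chart m), q ∈ φ.chart.target ∧ φ.chart.symm q ∈ ψ.chart.source := by
  have ha : φ.chart.symm (φ.chart m) ∈ ψ.chart.source := by rwa [φ.chart.left_inv h1]
  exact Filter.inter_mem (φ.chart.open_target.mem_nhds (φ.chart.map_source h1))
    ((φ.chart.continuousAt_symm (φ.chart.map_source h1)).preimage_mem_nhds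
      (ψ.chart.open_source.mem_nhds ha))

theorem fderiv_fderiv_subTransition {m : M} (h1 : m ∈ φ.chart.source) (h2 : m ∈ ψ.chart.source)
    (a b : EventModel n) : fderiv ℝ (fderiv ℝ (φ.subTransition ψ I)) (φ.chart m) a b =
      projCLM I (fderiv ℝ (fderiv ℝ (φ.transition ψ)) (φ.chart m) a b) := by
  have hev : fderiv ℝ (φ.subTransition ψ I) =ᶠ[𝓝 (φ.chart m)]
      fun q => projCLM I ∘L fderiv ℝ (φ.transition ψ) q := by
    filter_upwards [eventually_chart_symm_mem h1 h2] with q ⟨hq, hq'⟩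
    have := fderiv_subTransition (I := I) (φ.chart.map_target hq) hq'
    rwa [φ.chart.right_inv hq] at this
  have hd := (((contDiffAt_transition h1 h2).fderiv_right (m := ∞) (by simp)).differentiableAt
    (by simp)).hasFDerivAt
  have hd' : HasFDerivAt (fun q => projCLM I ∘L fderiv ℝ (φ.transition ψ) q) _ (φ.chart m) :=
    (hasFDerivAt_const (projCLM I) (φ.chart m)).clm_comp hd
  rw [hev.fderiv_eq, hd'.fderiv]
  simp

/-- Parallelism and Φ-invariance are tested in every adapted chart, whereas the distribution is
defined through `ψ`. Here it becomes the vertical kernel of dy, with y the selected `ψ`-coordinates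
seen in `φ`. -/
theorem mem_coordDistribution_iff_fderiv {z : JetBundle n τ} (h1 : z.base ∈ φ.chart.source)
    (h2 : z.base ∈ ψ.chart.source) {X : TangentSpace 𝓘(ℝ, EventModel n) z.base} :
    X ∈ ψ.coordDistribution I z ↔ (φ.components z.base X).1 = 0 ∧
      fderiv ℝ (φ.subTransition ψ I) (φ.chart z.base) (0, (φ.components z.base X).2) = 0 := by
  rw [mem_coordDistribution, ← mem_verticalSpace_iff h2, mem_verticalSpace_iff h1]
  refine and_congr_right fun h0 => ?_
  have h3 : ((0, (φ.components z.base X).2) : EventModel n) = φ.components z.base X :=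
    Prod.ext h0.symm rfl
  rw [h3, fderiv_subTransition h1 h2, ContinuousLinearMap.comp_apply,
    ← components_eq_fderiv_transition h1 h2]
  exact ⟨fun h => funext fun i => h i i.2, fun h i hi => congrFun h ⟨i, hi⟩⟩

/-- Supplies the surjectivity on vertical vectors that the argument for the Jacobi endomorphism
requires. -/
theorem exists_fderiv_subTransition_eq {m : M} (h1 : m ∈ φ.chart.source)
    (h2 : m ∈ ψ.chart.source) (η : I → ℝ) :
    ∃ e : Fin n → ℝ, fderiv ℝ (φ.subTransition ψ I) (φ.chart m) (0, e) = η := by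
  classical
  set w : EventModel n := (0, fun i => if h : i ∈ I then η ⟨i, h⟩ else 0)
  set X := ψ.ofComponents m w
  have hX : ψ.components m X = w := components_ofComponents h2 w
  have h0 : (φ.components m X).1 = 0 := by
    rw [← mem_verticalSpace_iff h1, mem_verticalSpace_iff h2, hX]
  refine ⟨(φ.components m X).2, ?_⟩
  have h3 : ((0, (φ.components m X).2) : EventModel n) = φ.components m X := Prod.ext h0.symm rfl
  rw [h3, fderiv_subTransition h1 h2, ContinuousLinearMap.comp_apply,
    ← components_eq_fderiv_transition h1 h2, hX]
  funext i
  simp [w]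

end AdaptedChart

namespace SODE

open AdaptedChart

variable {Γ : SODE n τ} {φ ψ : AdaptedChart (n := n) τ} {I : Set (Fin n)} [Fintype I]

/-- The transformation law of the forces turns closure in the chart `ψ` into a relation ÿ = g(t, y,
ẏ) in the chart `φ`, with a reduced right-hand side that is smooth at the point in question. -/
theorem ClosedSubsystem.exists_closesAt (hI : Γ.ClosedSubsystem ψ I) {z : JetBundle n τ}
    (h1 : z.base ∈ φ.chart.source) (h2 : z.base ∈ ψ.chart.source) :
    ∃ g : ℝ × (I → ℝ) × (I → ℝ) → (I → ℝ),
      ContDiffAt ℝ ∞ g ((φ.jetCoord z).1, φ.subTransition ψ I (jetPos (φ.jetCoord z)),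
        fderiv ℝ (φ.subTransition ψ I) (jetPos (φ.jetCoord z)) (jetVel (φ.jetCoord z))) ∧
      ∀ᶠ p in 𝓝 (φ.jetCoord z), ClosesAt (Γ.force φ) (φ.subTransition ψ I) g p := by
  classical
  obtain ⟨g₀, hg₀⟩ := hI
  set P := ψ.jetCoord z
  -- The given reduced force `g₀` carries no regularity. It is replaced by the restriction of the
  -- smooth force to the slice where the coordinates outside `I` keep their values at `z`; closure
  -- shows that both agree.
  set ext : (I → ℝ) → (Fin n → ℝ) → Fin n → ℝ := fun η x i => if h : i ∈ I then η ⟨i, h⟩ else x i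
  have hext : ∀ η x (i : I), ext η x i = η i := fun η x i => by simp [ext]
  have hext' : ∀ x : Fin n → ℝ, ext (fun i => x i) x = x := fun x => by
    funext i; by_cases h : i ∈ I <;> simp [ext, h]
  have hexts : ∀ x, ContDiff ℝ ∞ fun η => ext η x := fun x => by
    refine contDiff_pi.2 fun i => ?_
    by_cases h : i ∈ I
    · simp only [ext, h, dif_pos]; fun_prop
    · simp only [ext, h, dif_neg, not_false_eq_true]; fun_prop
  set ι : ℝ × (I → ℝ) × (I → ℝ) → JetModel n := fun a =>
    (a.1, ext a.2.1 P.2.1, ext a.2.2 P.2.2)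
  have hιs : ContDiff ℝ ∞ ι := contDiff_fst.prodMk
    (((hexts _).comp (contDiff_fst.comp contDiff_snd)).prodMk
      ((hexts _).comp (contDiff_snd.comp contDiff_snd)))
  have hy : ∀ (z : JetBundle n τ), z.base ∈ φ.chart.source → z.base ∈ ψ.chart.source →
      (((φ.jetCoord z).1, φ.subTransition ψ I (jetPos (φ.jetCoord z)),
        fderiv ℝ (φ.subTransition ψ I) (jetPos (φ.jetCoord z)) (jetVel (φ.jetCoord z))) :
        ℝ × (I → ℝ) × (I → ℝ)) =
      ((ψ.jetCoord z).1, (fun i : I => (ψ.jetCoord z).2.1 i),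
        fun i : I => (ψ.jetCoord z).2.2 i) := by
    intro z h1 h2
    refine Prod.ext ?_ (Prod.ext ?_ ?_)
    · exact (φ.fst_eq _ h1).trans (ψ.fst_eq _ h2).symm
    · funext i
      show (ψ.chart (φ.chart.symm (φ.chart z.base))).2 i = (ψ.chart z.base).2 i
      rw [φ.chart.left_inv h1]
    · show fderiv ℝ (φ.subTransition ψ I) (φ.chart z.base) (jetVel (φ.jetCoord z)) = _
      rw [fderiv_subTransition h1 h2, ContinuousLinearMap.comp_apply, ← components_velocity h1]
      exact congrArg (projCLM I) (components_eq_fderiv_transition h1 h2 z.1.snd).symm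
  have hιP : ι (P.1, (fun i => P.2.1 i), fun i => P.2.2 i) = P := by
    simp only [ι, hext']
  refine ⟨fun a i => Γ.force ψ (ι a) i, ?_, ?_⟩
  · rw [hy z h1 h2]
    refine contDiffAt_pi.2 fun i => ?_
    have h3 : ContDiffAt ℝ ∞ (Γ.force ψ) (ι (P.1, (fun i => P.2.1 i), fun i => P.2.2 i)) := by
      rw [hιP]; exact contDiffAt_force (jetCoord_mem h2)
    exact contDiffAt_pi.1 (h3.comp _ hιs.contDiffAt) i
  · have hc : ContinuousAt (fun P' : JetModel n =>
        ι (P'.1, (fun i => P'.2.1 i), fun i => P'.2.2 i)) P :=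
      (hιs.continuous.comp (by fun_prop)).continuousAt
    have hev := hc.preimage_mem_nhds (by
      rw [hιP]; exact isOpen_jetTarget.mem_nhds (jetCoord_mem h2))
    obtain ⟨W, hW, hzW, hWP⟩ := exists_isOpen_of_eventually h2 hev
    filter_upwards [eventually_jetPoint_mem hW h1 hzW] with p ⟨hp, hpW⟩
    obtain ⟨h3, h4⟩ := hWP _ hpW
    have h5 := base_jetPoint_mem hp
    set z' := φ.jetPoint p hp
    have hp' : φ.jetCoord z' = p := jetCoord_jetPoint hp
    have hpos : jetPos p = φ.chart z'.base := (chart_base_jetPoint hp).symm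
    rw [ClosesAt, ← hp', hy z' h5 h3]
    funext i
    have h6 : Γ.force ψ (ι ((ψ.jetCoord z').1, (fun i => (ψ.jetCoord z').2.1 i),
        fun i => (ψ.jetCoord z').2.2 i)) i = Γ.force ψ (ψ.jetCoord z') i := by
      rw [hg₀ _ h4 i, hg₀ _ (jetCoord_mem h3) i]
      simp only [ι, hext]
    rw [h6, force_transition h5 h3, jetPos_jetCoord, fderiv_fderiv_subTransition h5 h3,
      fderiv_subTransition h5 h3]
    rfl

/-- The kernel calculus applies in each chart. The indices `i` and `j` witness that the fibres are
neither the full vertical space nor zero. -/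
theorem ClosedSubsystem.isParallelVertical (hI : Γ.ClosedSubsystem ψ I) {i j : Fin n}
    (hi : i ∈ I) (hj : j ∉ I) :
    (ψ.coordDistribution I).IsParallelVertical ψ.chart.source Γ where
  subbundle := isSubbundleOver_coordDistribution
  vertical z hz X hX := (mem_verticalSpace_iff hz X).2 hX.1
  nontrivial z hz := by
    constructor
    · intro h
      have h1 : ψ.ofComponents z.base (0, Pi.single j 1) ∈ ψ.coordDistribution I z :=
        (ofComponents_mem_coordDistribution hz).2
          ⟨rfl, fun k hk => Pi.single_eq_of_ne (show k ≠ j from fun h => hj (h ▸ hk)) _⟩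
      rw [h, Submodule.mem_bot] at h1
      have h2 := congrArg (componentsEquiv hz) h1
      rw [map_zero] at h2
      have h3 : ((0, Pi.single j 1) : EventModel n) = 0 :=
        (components_ofComponents hz _).symm.trans h2
      have := congrFun (congrArg Prod.snd h3) j
      simp at this
    · intro h
      have h1 : ψ.ofComponents z.base (0, Pi.single i 1) ∈ verticalSpace τ z.base := by
        rw [mem_verticalSpace_iff hz, components_ofComponents hz]
      rw [← h, ofComponents_mem_coordDistribution hz] at h1
      have := h1.2 i hi
      simp at this
  parallel W σ hW hWU hσ hσD z hz φ hzφ u := by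
    have h2 := hWU z hz
    obtain ⟨g, hg, hcl⟩ := hI.exists_closesAt hzφ h2
    have hf : ContDiffAt ℝ ∞ (Γ.force φ) (φ.jetCoord z) := contDiffAt_force (jetCoord_mem hzφ)
    have hs := (hσ φ z hz hzφ).differentiableAt (by simp)
    have hmem : ∀ᶠ p in 𝓝 (φ.jetCoord z), (φ.fieldRep σ p).1 = 0 ∧
        fderiv ℝ (φ.subTransition ψ I) (jetPos p) (0, (φ.fieldRep σ p).2) = 0 := by
      filter_upwards [eventually_jetPoint_mem hW hzφ hz] with p ⟨hp, hpW⟩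
      have := (mem_coordDistribution_iff_fderiv (base_jetPoint_mem hp) (hWU _ hpW)).1 (hσD _ hpW)
      rwa [← fieldRep_of_mem σ hp, chart_base_jetPoint hp] at this
    rw [mem_coordDistribution_iff_fderiv hzφ h2, covDeriv, components_ofComponents hzφ,
      covDerivComponents_of_vertical (hf.of_le (natCast_le_infty 2)) hs (hmem.mono fun p h => h.1)]
    exact ⟨rfl, ClosesAt.fderiv_vertCovDeriv_eq_zero
      ((contDiffAt_subTransition hzφ h2).of_le (natCast_le_infty 4))
      (hf.of_le (natCast_le_infty 2)) (hg.of_le (natCast_le_infty 2)) hcl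
      hs.snd (hmem.mono fun p h => h.2) u⟩
  jacobiInvariant z hz φ hzφ X hX := by
    obtain ⟨g, hg, hcl⟩ := hI.exists_closesAt hzφ hz
    have hf : ContDiffAt ℝ ∞ (Γ.force φ) (φ.jetCoord z) := contDiffAt_force (jetCoord_mem hzφ)
    rw [mem_coordDistribution_iff_fderiv hzφ hz] at hX ⊢
    rw [jacobi, components_ofComponents hzφ, sum_jacobiCoeff_mul (hf.of_le (natCast_le_infty 2))]
    exact ⟨rfl, ClosesAt.fderiv_vertJacobi_eq_zero
      ((contDiffAt_subTransition hzφ hz).of_le (natCast_le_infty 4))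
      (hf.of_le (natCast_le_infty 2)) (hg.of_le (natCast_le_infty 2)) hcl
      (exists_fderiv_subTransition_eq hzφ hz) hX.2⟩

theorem LocallySubmersive.exists_isParallelVertical (h : Γ.LocallySubmersive) (m : M) :
    ∃ U : Set M, IsOpen U ∧ m ∈ U ∧
      ∃ 𝒟 : DistributionAlong n τ, 𝒟.IsParallelVertical U Γ := by
  obtain ⟨φ, hm, d, h0, hn, hcl⟩ := h m
  exact ⟨φ.chart.source, φ.chart.open_source, hm, _,
    hcl.isParallelVertical (i := ⟨0, h0.trans hn⟩) (j := ⟨d, hn⟩) h0 (lt_irrefl d)⟩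

theorem LocallyDecouples.exists_isParallelVertical (h : Γ.LocallyDecouples) (m : M) :
    ∃ U : Set M, IsOpen U ∧ m ∈ U ∧
      ∃ 𝒟₁ 𝒟₂ : DistributionAlong n τ, 𝒟₁.IsParallelVertical U Γ ∧
        𝒟₂.IsParallelVertical U Γ ∧ DistributionAlong.AreComplementaryOver U 𝒟₁ 𝒟₂ := by
  obtain ⟨φ, hm, d, h0, hn, hcl, hcl'⟩ := h m
  refine ⟨φ.chart.source, φ.chart.open_source, hm, _, _,
    hcl.isParallelVertical (i := ⟨0, h0.trans hn⟩) (j := ⟨d, hn⟩) h0 (lt_irrefl d),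
    hcl'.isParallelVertical (i := ⟨d, hn⟩) (j := ⟨0, h0.trans hn⟩) (le_refl d) (not_le.2 h0),
    fun z hz => ⟨?_, le_antisymm (sup_le ?_ ?_) ?_⟩⟩
  · rw [eq_bot_iff]
    intro X hX
    have h1 : φ.components z.base X = 0 := by
      refine Prod.ext hX.1.1 (funext fun i => ?_)
      rcases lt_or_ge (i : ℕ) d with hi | hi
      · exact hX.1.2 i hi
      · exact hX.2.2 i hi
    exact (componentsEquiv hz).map_eq_zero_iff.1 h1
  · exact fun X hX => (mem_verticalSpace_iff hz X).2 hX.1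
  · exact fun X hX => (mem_verticalSpace_iff hz X).2 hX.1
  · intro X hX
    rw [mem_verticalSpace_iff hz] at hX
    set w := φ.components z.base X
    set w₁ : EventModel n := (0, fun i => if (i : ℕ) < d then 0 else w.2 i)
    set w₂ : EventModel n := (0, fun i => if (i : ℕ) < d then w.2 i else 0)
    have hw : w = w₁ + w₂ := by
      refine Prod.ext (by simp [w₁, w₂, hX]) (funext fun i => ?_)
      by_cases hi : (i : ℕ) < d <;> simp [w₁, w₂, hi]
    have hX' : X = φ.ofComponents z.base w₁ + φ.ofComponents z.base w₂ := by
      have h1 := congrArg (componentsEquiv hz).symm hw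
      rw [map_add] at h1
      exact ((componentsEquiv hz).symm_apply_apply X).symm.trans h1
    rw [hX']
    refine Submodule.add_mem_sup ?_ ?_
    · refine (ofComponents_mem_coordDistribution hz).2 ⟨rfl, fun i (hi : (i : ℕ) < d) => ?_⟩
      simp [w₁, hi]
    · refine (ofComponents_mem_coordDistribution hz).2 ⟨rfl, fun i (hi : d ≤ (i : ℕ)) => ?_⟩
      simp [w₂, not_lt.2 hi]

end SODE

end CoordinateDistributions

/-! ### Construction of adapted charts from prescribed functions. -/

section ChartConstruction

set_option linter.unusedSectionVars false

open Set Filter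

variable {n : ℕ} {M : Type*} [TopologicalSpace M] [ChartedSpace (EventModel n) M]
  [IsManifold 𝓘(ℝ, EventModel n) ∞ M] {τ : M → ℝ}

/-- Smooth functions with independent differentials are the coordinates of a chart with values
in a ball. -/
theorem exists_chart_of_injective_fderiv {c : OpenPartialHomeomorph M (EventModel n)}
    (hc : c ∈ IsManifold.maximalAtlas 𝓘(ℝ, EventModel n) ∞ M) {m : M} (hm : m ∈ c.source)
    {Y : EventModel n → EventModel n} (hY : ∀ᶠ q in 𝓝 (c m), ContDiffAt ℝ ∞ Y q)
    (hinj : ∀ w, fderiv ℝ Y (c m) w = 0 → w = 0) {G : Set M} (hG : G ∈ 𝓝 m) :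
    ∃ e : OpenPartialHomeomorph M (EventModel n),
      e ∈ IsManifold.maximalAtlas 𝓘(ℝ, EventModel n) ∞ M ∧ m ∈ e.source ∧ e.source ⊆ G ∧
      e.source ⊆ c.source ∧ (∀ x ∈ e.source, e x = Y (c x)) ∧ Convex ℝ e.target := by
  obtain ⟨f', hf'⟩ : ∃ f' : EventModel n ≃L[ℝ] EventModel n,
      (f' : EventModel n →L[ℝ] EventModel n) = fderiv ℝ Y (c m) :=
    ⟨(LinearEquiv.ofInjectiveEndo (fderiv ℝ Y (c m) : EventModel n →ₗ[ℝ] EventModel n)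
      ((injective_iff_map_eq_zero _).2 hinj)).toContinuousLinearEquiv, by
        apply ContinuousLinearMap.ext; intro x; rfl⟩
  obtain ⟨e₀, hme₀, he₀, he₀s, he₀t⟩ := exists_openPartialHomeomorph_of_contDiffAt hY (f' := f')
    (by rw [hf']; exact (hY.self_of_nhds.differentiableAt (by simp)).hasFDerivAt)
  set e₁ := c.trans e₀
  have hm₁ : m ∈ e₁.source := by rw [c.trans_source]; exact ⟨hm, hme₀⟩
  have ht : e₁.target ∩ e₁.symm ⁻¹' interior G ∈ 𝓝 (e₁ m) := by
    refine (e₁.symm.isOpen_inter_preimage isOpen_interior).mem_nhds ⟨e₁.map_source hm₁, ?_⟩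
    show e₁.symm (e₁ m) ∈ interior G
    rw [e₁.left_inv hm₁]
    exact mem_interior_iff_mem_nhds.2 hG
  obtain ⟨r, hr, hball⟩ := Metric.mem_nhds_iff.1 ht
  -- The restriction is made in the target: a ball is convex, and the later integration along
  -- segments depends on this.
  set e : OpenPartialHomeomorph M (EventModel n) :=
    (e₁.symm.restrOpen (Metric.ball (e₁ m) r) Metric.isOpen_ball).symm
  have hcoe : ∀ x, e x = e₁ x := fun x => rfl
  have hcoe' : ∀ x, e.symm x = e₁.symm x := fun x => rfl
  have htarget : e.target = Metric.ball (e₁ m) r := by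
    show e₁.target ∩ Metric.ball (e₁ m) r = _
    exact inter_eq_right.2 fun x hx => (hball hx).1
  have hmem : ∀ x ∈ e.source, x ∈ e₁.source ∧ x ∈ G := by
    intro x hx
    have h1 := e.map_source hx
    rw [htarget] at h1
    have h2 := hball h1
    have h3 : e₁.symm (e x) = x := e.left_inv hx
    rw [← h3]
    exact ⟨e₁.map_target h2.1, interior_subset h2.2⟩
  have hsrc : ∀ x ∈ e.source, x ∈ c.source ∧ c x ∈ e₀.source := fun x hx => by
    have := (hmem x hx).1
    rwa [c.trans_source] at this
  refine ⟨e, ?_, ?_, fun x hx => (hmem x hx).2, fun x hx => (hsrc x hx).1, fun x _ => he₀ (c x), ?_⟩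
  · refine e.mem_maximalAtlas_of_contMDiffOn (fun x hx => ?_) fun q hq => ?_
    · have h1 : ContMDiffAt 𝓘(ℝ, EventModel n) 𝓘(ℝ, EventModel n) ∞ Y (c x) :=
        (he₀s _ (hsrc x hx).2).contMDiffAt
      refine ((h1.comp x (contMDiffAt_of_mem_maximalAtlas hc (hsrc x hx).1)).congr_of_eventuallyEq
        (Eventually.of_forall fun x => he₀ (c x))).contMDiffWithinAt
    · have h1 := (hmem _ (e.map_target hq)).1
      have hq₁ : q ∈ e₁.target := by rw [htarget] at hq; exact (hball hq).1
      have hq₀ : q ∈ e₀.target ∧ e₀.symm q ∈ c.target := by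
        rw [c.trans_target] at hq₁; exact hq₁
      have h2 : ContMDiffAt 𝓘(ℝ, EventModel n) 𝓘(ℝ, EventModel n) ∞ e₀.symm q :=
        (he₀t _ hq₀.1).contMDiffAt
      exact ((contMDiffAt_symm_of_mem_maximalAtlas hc hq₀.2).comp q h2).contMDiffWithinAt
  · have h1 : e₁ m ∈ e.target := by rw [htarget]; exact Metric.mem_ball_self hr
    have h2 := e.map_target h1
    have h3 : e.symm (e₁ m) = m := e₁.left_inv hm₁
    rwa [h3] at h2
  · rw [htarget]; exact convex_ball _ _

/-- A nonzero linear form can be completed to a linear coordinate system. -/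
theorem exists_complement_linearForm (ℓ : EventModel n →L[ℝ] ℝ) (hℓ : Function.Surjective ℓ) :
    ∃ A : EventModel n →L[ℝ] (Fin n → ℝ), ∀ w, ℓ w = 0 → A w = 0 → w = 0 := by
  set S := LinearMap.ker (ℓ : EventModel n →ₗ[ℝ] ℝ)
  have hdim : Module.finrank ℝ S = n := by
    have h1 := (ℓ : EventModel n →ₗ[ℝ] ℝ).finrank_range_add_finrank_ker
    rw [LinearMap.range_eq_top.2 hℓ, finrank_top] at h1
    simp at h1
    exact h1
  obtain ⟨C, hC⟩ := S.exists_isCompl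
  have e : S ≃ₗ[ℝ] (Fin n → ℝ) := LinearEquiv.ofFinrankEq _ _ (by simp [hdim])
  refine ⟨LinearMap.toContinuousLinearMap
    ((e : S →ₗ[ℝ] (Fin n → ℝ)) ∘ₗ S.projectionOnto C hC), fun w hw hA => ?_⟩
  have h1 : S.projectionOnto C hC w = 0 := e.map_eq_zero_iff.1 hA
  have h2 : S.projectionOnto C hC (⟨w, hw⟩ : S) = ⟨w, hw⟩ :=
    Submodule.projectionOnto_apply_left hC ⟨w, hw⟩
  exact congrArg Subtype.val (h2.symm.trans h1)

/-- Adapted charts exist around every point of a manifold submersed over the line. -/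
theorem exists_adaptedChart (hτ : ContMDiff 𝓘(ℝ, EventModel n) 𝓘(ℝ, ℝ) ∞ τ)
    (hsub : ∀ m : M, Function.Surjective (mfderiv 𝓘(ℝ, EventModel n) 𝓘(ℝ, ℝ) τ m)) {m : M}
    {G : Set M} (hG : G ∈ 𝓝 m) :
    ∃ φ : AdaptedChart (n := n) τ, m ∈ φ.chart.source ∧ φ.chart.source ⊆ G := by
  set c := chartAt (EventModel n) m
  have hc : c ∈ IsManifold.maximalAtlas 𝓘(ℝ, EventModel n) ∞ M :=
    IsManifold.chart_mem_maximalAtlas m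
  have hm : m ∈ c.source := mem_chart_source _ m
  have hcm : c m ∈ c.target := c.map_source hm
  have hs : ∀ q ∈ c.target, ContDiffAt ℝ ∞ (fun q => τ (c.symm q)) q := fun q hq =>
    ((hτ.contMDiffAt (x := c.symm q)).comp q
      (contMDiffAt_symm_of_mem_maximalAtlas hc hq)).contDiffAt
  have hcd : c.MDifferentiable 𝓘(ℝ, EventModel n) 𝓘(ℝ, EventModel n) :=
    ⟨(contMDiffOn_of_mem_maximalAtlas hc).mdifferentiableOn (by simp),
      (contMDiffOn_symm_of_mem_maximalAtlas hc).mdifferentiableOn (by simp)⟩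
  have hsurj : Function.Surjective (fderiv ℝ (fun q => τ (c.symm q)) (c m)) := by
    have h1 : HasMFDerivAt 𝓘(ℝ, EventModel n) 𝓘(ℝ, ℝ) (fun q => τ (c.symm q)) (c m) _ :=
      HasMFDerivAt.comp (c m) ((hτ.mdifferentiable (by simp)) (c.symm (c m))).hasMFDerivAt
        (hcd.mdifferentiableAt_symm hcm).hasMFDerivAt
    rw [← mfderiv_eq_fderiv, h1.mfderiv]
    exact (hsub _).comp (hcd.symm.mfderiv_surjective hcm)
  obtain ⟨A, hA⟩ := exists_complement_linearForm _ hsurj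
  have hY : ∀ q ∈ c.target, ContDiffAt ℝ ∞ (fun q => (τ (c.symm q), A q)) q := fun q hq =>
    (hs q hq).prodMk A.contDiff.contDiffAt
  have hY' : HasFDerivAt (fun q => (τ (c.symm q), A q)) _ (c m) :=
    ((hs _ hcm).differentiableAt (by simp)).hasFDerivAt.prodMk A.hasFDerivAt
  obtain ⟨e, he, hme, heG, hec, heY, -⟩ := exists_chart_of_injective_fderiv hc hm
    (Y := fun q => (τ (c.symm q), A q))
    (by filter_upwards [c.open_target.mem_nhds hcm] with q hq using hY q hq)
    (fun w hw => by
      rw [hY'.fderiv] at hw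
      exact hA w (congrArg Prod.fst hw) (congrArg Prod.snd hw)) hG
  refine ⟨⟨e, he, fun x hx => ?_⟩, hme, heG⟩
  rw [heY x hx, c.left_inv (hec hx)]

/-- Functions with independent vertical differentials are the coordinates of an adapted chart. -/
theorem AdaptedChart.exists_of_vertical_injective (φ : AdaptedChart (n := n) τ) {m : M}
    (hm : m ∈ φ.chart.source) {d k : ℕ} (hdk : d + k = n) {y₁ : EventModel n → Fin d → ℝ}
    {y₂ : EventModel n → Fin k → ℝ} (hy₁ : ∀ᶠ q in 𝓝 (φ.chart m), ContDiffAt ℝ ∞ y₁ q)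
    (hy₂ : ∀ᶠ q in 𝓝 (φ.chart m), ContDiffAt ℝ ∞ y₂ q)
    (hinj : ∀ s, fderiv ℝ y₁ (φ.chart m) (0, s) = 0 → fderiv ℝ y₂ (φ.chart m) (0, s) = 0 → s = 0)
    {G : Set M} (hG : G ∈ 𝓝 m) :
    ∃ ψ : AdaptedChart (n := n) τ, m ∈ ψ.chart.source ∧ ψ.chart.source ⊆ G ∧
      ψ.chart.source ⊆ φ.chart.source ∧ Convex ℝ ψ.chart.target ∧
      (∀ x ∈ ψ.chart.source, ∀ (i : Fin n) (hi : (i : ℕ) < d),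
        (ψ.chart x).2 i = y₁ (φ.chart x) ⟨i, hi⟩) ∧
      (∀ x ∈ ψ.chart.source, ∀ (i : Fin n) (hi : d ≤ (i : ℕ)),
        (ψ.chart x).2 i = y₂ (φ.chart x) ⟨i - d, by omega⟩) := by
  set y : EventModel n → Fin n → ℝ := fun q i =>
    if hi : (i : ℕ) < d then y₁ q ⟨i, hi⟩ else y₂ q ⟨i - d, by omega⟩
  have hy : ∀ᶠ q in 𝓝 (φ.chart m), ContDiffAt ℝ ∞ y q := by
    filter_upwards [hy₁, hy₂] with q h1 h2
    refine contDiffAt_pi.2 fun i => ?_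
    by_cases hi : (i : ℕ) < d
    · simp only [y, hi, dif_pos]; exact contDiffAt_pi.1 h1 _
    · simp only [y, hi, dif_neg, not_false_eq_true]; exact contDiffAt_pi.1 h2 _
  have hYs : ∀ᶠ q in 𝓝 (φ.chart m), ContDiffAt ℝ ∞ (fun q => (q.1, y q)) q := by
    filter_upwards [hy] with q hq using contDiffAt_fst.prodMk hq
  have hyd := hy.self_of_nhds.differentiableAt (by simp)
  have hY' : HasFDerivAt (fun q : EventModel n => (q.1, y q)) _ (φ.chart m) :=
    hasFDerivAt_fst.prodMk hyd.hasFDerivAt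
  obtain ⟨e, he, hme, heG, hec, heY, hconv⟩ := exists_chart_of_injective_fderiv φ.mem_maximalAtlas
    hm hYs (fun w hw => by
      rw [hY'.fderiv] at hw
      -- Time is kept as first coordinate, so a vector killed by the differential is vertical and
      -- the hypothesis on vertical vectors suffices.
      have h0 : w.1 = 0 := congrArg Prod.fst hw
      have h1 : fderiv ℝ y (φ.chart m) w = 0 := congrArg Prod.snd hw
      have hw' : w = (0, w.2) := Prod.ext h0 rfl
      rw [hw'] at h1
      have hcoord : ∀ {l : ℕ} {g : EventModel n → Fin l → ℝ}, DifferentiableAt ℝ g (φ.chart m) →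
          ∀ (a : Fin l) (u : EventModel n),
          fderiv ℝ (fun q => g q a) (φ.chart m) u = fderiv ℝ g (φ.chart m) u a := by
        intro l g hg a u
        exact DFunLike.congr_fun (hasFDerivAt_pi'.1 hg.hasFDerivAt a).fderiv u
      have h2 : w.2 = 0 := by
        refine hinj w.2 (funext fun a => ?_) (funext fun a => ?_)
        · have h3 := congrFun h1 ⟨a, by omega⟩
          rw [← hcoord hyd] at h3
          rw [← hcoord (hy₁.self_of_nhds.differentiableAt (by simp))]
          simpa [y] using h3
        · have h3 := congrFun h1 ⟨d + a, by omega⟩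
          rw [← hcoord hyd] at h3
          rw [← hcoord (hy₂.self_of_nhds.differentiableAt (by simp))]
          simpa [y] using h3
      rw [hw', h2]; rfl) hG
  refine ⟨⟨e, he, fun x hx => ?_⟩, hme, heG, hec, hconv, fun x hx i hi => ?_, fun x hx i hi => ?_⟩
  · rw [heY x hx]; exact φ.fst_eq x (hec hx)
  · show (e x).2 i = _
    rw [heY x hx]; simp [y, hi]
  · show (e x).2 i = _
    rw [heY x hx]; simp [y, not_lt.2 hi]

end ChartConstruction

/-! ### Coordinate expressions of vertical distributions. -/

section ParallelDistributions

set_option linter.unusedSectionVars false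

open Set Filter

variable {n : ℕ} {M : Type*} [TopologicalSpace M] [ChartedSpace (EventModel n) M]
  [IsManifold 𝓘(ℝ, EventModel n) ∞ M] {τ : M → ℝ}

namespace AdaptedChart

variable {φ ψ : AdaptedChart (n := n) τ} {𝒟 : DistributionAlong n τ} {U : Set M}
  {z : JetBundle n τ}

open Classical in
/-- A vertical distribution in coordinates. -/
noncomputable def localDistribution (φ : AdaptedChart (n := n) τ) (𝒟 : DistributionAlong n τ)
    (p : JetModel n) : Submodule ℝ (Fin n → ℝ) :=
  if hp : p ∈ φ.jetTarget then
    (𝒟 (φ.jetPoint p hp)).comap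
      ((componentsEquiv (base_jetPoint_mem hp)).symm.toLinearMap ∘ₗ LinearMap.inr ℝ ℝ (Fin n → ℝ))
  else ⊥

theorem mem_localDistribution (hz : z.base ∈ φ.chart.source) {s : Fin n → ℝ} :
    s ∈ φ.localDistribution 𝒟 (φ.jetCoord z) ↔ φ.ofComponents z.base (0, s) ∈ 𝒟 z := by
  -- The fibre in the definition sits over a reconstructed jet that equals `z` only propositionally,
  -- so the statement is generalized before substituting.
  have h : ∀ (y : JetBundle n τ) (hy : y.base ∈ φ.chart.source), y = z →
      (s ∈ (𝒟 y).comap ((componentsEquiv hy).symm.toLinearMap ∘ₗ LinearMap.inr ℝ ℝ (Fin n → ℝ)) ↔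
        φ.ofComponents z.base (0, s) ∈ 𝒟 z) := by
    rintro y hy rfl
    exact Iff.rfl
  rw [localDistribution, dif_pos (jetCoord_mem hz)]
  exact h _ _ (jetPoint_jetCoord hz)

theorem mem_iff_of_le_verticalSpace (hz : z.base ∈ φ.chart.source)
    (hv : 𝒟 z ≤ verticalSpace τ z.base) {X : TangentSpace 𝓘(ℝ, EventModel n) z.base} :
    X ∈ 𝒟 z ↔ (φ.components z.base X).1 = 0 ∧
      (φ.components z.base X).2 ∈ φ.localDistribution 𝒟 (φ.jetCoord z) := by
  rw [mem_localDistribution hz]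
  have h : (φ.components z.base X).1 = 0 →
      φ.ofComponents z.base (0, (φ.components z.base X).2) = X := fun h0 => by
    rw [show ((0, (φ.components z.base X).2) : EventModel n) = φ.components z.base X from
      Prod.ext h0.symm rfl, ofComponents_components hz]
  refine ⟨fun hX => ?_, fun hX => h hX.1 ▸ hX.2⟩
  have h0 := (mem_verticalSpace_iff hz X).1 (hv hX)
  exact ⟨h0, (h h0).symm ▸ hX⟩

theorem eventually_exists_jetCoord_eq {W : Set (JetBundle n τ)} (hW : IsOpen W)
    (hz : z.base ∈ φ.chart.source) (hzW : z ∈ W) :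
    ∀ᶠ p in 𝓝 (φ.jetCoord z), ∃ y ∈ W, y.base ∈ φ.chart.source ∧ φ.jetCoord y = p := by
  filter_upwards [eventually_jetPoint_mem hW hz hzW] with p ⟨hp, hpW⟩
  exact ⟨_, hpW, base_jetPoint_mem hp, jetCoord_jetPoint hp⟩

theorem hasSmoothFrameAt_localDistribution (hU : IsOpen U) (hD : 𝒟.IsSubbundleOver U)
    (hv : 𝒟.IsVerticalOver U) (hz : z.base ∈ φ.chart.source) (hzU : z.base ∈ U) :
    HasSmoothFrameAt (φ.localDistribution 𝒟) (φ.jetCoord z) := by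
  obtain ⟨W, hW, hzW, k, σ, hσ, hσD⟩ := hD z hzU
  refine ⟨k, fun a p => (φ.fieldRep (σ a) p).2, ?_⟩
  filter_upwards [eventually_exists_jetCoord_eq (hW.inter (isOpen_base_preimage hU)) hz ⟨hzW, hzU⟩]
    with p ⟨y, ⟨hyW, hyU⟩, hy, hyp⟩
  subst hyp
  obtain ⟨hli, hspan⟩ := hσD y hyW
  have hmem : ∀ a, (φ.components y.base (σ a y)).1 = 0 ∧
      (φ.components y.base (σ a y)).2 ∈ φ.localDistribution 𝒟 (φ.jetCoord y) := fun a =>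
    (mem_iff_of_le_verticalSpace hy (hv y hyU)).1 (hspan ▸ Submodule.subset_span ⟨a, rfl⟩)
  simp only [fieldRep_jetCoord _ hy]
  refine ⟨fun a => (hσ a φ y hyW hy).snd, ?_, le_antisymm ?_ fun s hs => ?_⟩
  · have h1 := hli.map' (componentsEquiv hy).toLinearMap (LinearEquiv.ker _)
    have h2 : ⇑(componentsEquiv hy).toLinearMap ∘ (fun a => σ a y) =
        ⇑(LinearMap.inr ℝ ℝ (Fin n → ℝ)) ∘ fun a => (φ.components y.base (σ a y)).2 :=
      funext fun a => Prod.ext (hmem a).1 rfl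
    rw [h2] at h1
    exact LinearIndependent.of_comp _ h1
  · rw [Submodule.span_le]
    rintro _ ⟨a, rfl⟩
    exact (hmem a).2
  · rw [mem_localDistribution hy, ← hspan] at hs
    obtain ⟨c, hc⟩ := (Submodule.mem_span_range_iff_exists_fun ℝ).1 hs
    refine (Submodule.mem_span_range_iff_exists_fun ℝ).2 ⟨c, ?_⟩
    have h1 := congrArg (componentsEquiv hy) hc
    rw [map_sum] at h1
    simp only [map_smul] at h1
    have h2 := h1.trans (components_ofComponents hy _)
    have h3 := congrArg Prod.snd h2
    rw [Prod.snd_sum] at h3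
    exact h3

/-- A coordinate section near one point is promoted to a field on an open set of jets, to which the
geometric condition applies. Nothing is lost because covariant differentiation depends only on the
germ. -/
theorem isParallelAt_localDistribution {Γ : SODE n τ} (hU : IsOpen U) (hD : 𝒟.IsParallelOver U Γ)
    (hz : z.base ∈ φ.chart.source) (hzU : z.base ∈ U) :
    IsParallelAt (Γ.force φ) (φ.localDistribution 𝒟) (φ.jetCoord z) := by
  intro s hs u
  obtain ⟨W, hW, hzW, hWs⟩ := exists_isOpen_of_eventually hz hs
  set σ : FieldAlong n τ := fun y => φ.ofComponents y.base (0, s (φ.jetCoord y))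
  have hσ : σ.SmoothOver W := smoothOver_of_components (S := fun p => (0, s p))
    (fun y hy => (hWs y hy).1) fun y hy => contDiffAt_const.prodMk (hWs y hy).2.1
  have hσs : φ.fieldRep σ =ᶠ[𝓝 (φ.jetCoord z)] fun p => (0, s p) := by
    filter_upwards [eventually_exists_jetCoord_eq hW hz hzW] with p ⟨y, hyW, hy, hyp⟩
    rw [← hyp, fieldRep_jetCoord _ hy, components_ofComponents hy]
  have h1 := hD (W ∩ {y | y.base ∈ U}) σ (hW.inter (isOpen_base_preimage hU)) (fun y hy => hy.2)
    (fun φ y hy => hσ φ y hy.1) (fun y hy => (mem_localDistribution (hWs y hy.1).1).1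
      (hWs y hy.1).2.2) z ⟨hzW, hzU⟩ φ hz u
  rw [SODE.covDeriv, SODE.covDerivComponents_of_vertical
    ((SODE.contDiffAt_force (jetCoord_mem hz)).of_le (natCast_le_infty 2))
    ((hσ φ z hzW hz).differentiableAt (by simp)) (hσs.mono fun p hp => congrArg Prod.fst hp),
    ← mem_localDistribution hz] at h1
  have h2 : (fun p => (φ.fieldRep σ p).2) =ᶠ[𝓝 (φ.jetCoord z)] s :=
    hσs.mono fun p hp => congrArg Prod.snd hp
  rwa [vertCovDeriv, h2.fderiv_eq, h2.eq_of_nhds] at h1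

theorem vertJacobi_mem_localDistribution {Γ : SODE n τ} (hD : 𝒟.IsJacobiInvariantOver U Γ)
    (hz : z.base ∈ φ.chart.source) (hzU : z.base ∈ U) {s : Fin n → ℝ}
    (hs : s ∈ φ.localDistribution 𝒟 (φ.jetCoord z)) :
    vertJacobi (Γ.force φ) (φ.jetCoord z) s ∈ φ.localDistribution 𝒟 (φ.jetCoord z) := by
  rw [mem_localDistribution hz] at hs ⊢
  have h1 := hD z hzU φ hz _ hs
  rwa [SODE.jacobi, components_ofComponents hz, SODE.sum_jacobiCoeff_mul
    ((SODE.contDiffAt_force (jetCoord_mem hz)).of_le (natCast_le_infty 2))] at h1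

theorem exists_jetCoord_eq {p : JetModel n} (hp : p ∈ φ.jetTarget) :
    ∃ z : JetBundle n τ, z.base ∈ φ.chart.source ∧ φ.jetCoord z = p :=
  ⟨_, base_jetPoint_mem hp, jetCoord_jetPoint hp⟩

/-- A parallel vertical distribution is, locally, the vertical kernel of the differential of a
smooth map on the base. -/
theorem exists_ker_fderiv_eq_localDistribution {Γ : SODE n τ} (hU : IsOpen U)
    (hD : 𝒟.IsParallelVertical U Γ) (hφU : φ.chart.source ⊆ U) (hz : z.base ∈ φ.chart.source) :
    ∃ (d : ℕ) (y : EventModel n → Fin d → ℝ),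
      d + Module.finrank ℝ (φ.localDistribution 𝒟 (φ.jetCoord z)) = n ∧
      ∀ᶠ q in 𝓝 (φ.chart z.base), ContDiffAt ℝ ∞ y q ∧
        ∀ s v, fderiv ℝ y q (0, s) = 0 ↔ s ∈ φ.localDistribution 𝒟 (q.1, q.2, v) := by
  have hframe : ∀ p, jetPos p ∈ φ.chart.target →
      HasSmoothFrameAt (φ.localDistribution 𝒟) p := by
    intro p hp
    obtain ⟨y, hy, rfl⟩ := exists_jetCoord_eq (φ := φ) (p := p) hp
    exact hasSmoothFrameAt_localDistribution hU hD.subbundle hD.vertical hy (hφU hy)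
  have hpar : ∀ p, jetPos p ∈ φ.chart.target →
      IsParallelAt (Γ.force φ) (φ.localDistribution 𝒟) p := by
    intro p hp
    obtain ⟨y, hy, rfl⟩ := exists_jetCoord_eq (φ := φ) (p := p) hp
    exact isParallelAt_localDistribution hU hD.parallel hy (hφU hy)
  have hev := isOpen_jetTarget.mem_nhds (jetCoord_mem hz)
  obtain ⟨d, y, hd, hy⟩ := exists_ker_fderiv_eq_of_isParallelAt (hframe _ (jetCoord_mem hz))
    (by filter_upwards [hev] with p hp using SODE.contDiffAt_force (Γ := Γ) hp)
    (by filter_upwards [hev] with p hp using hpar p hp)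
  refine ⟨d, y, hd, ?_⟩
  filter_upwards [hy, φ.chart.open_target.mem_nhds (φ.chart.map_source hz)] with q hq hqt
  -- The kernel was identified for one frozen velocity; independence of velocities extends this to
  -- all `v`.
  exact ⟨hq.1, fun s v => by rw [hq.2 s, eq_of_isParallelAt hframe hpar hqt v]⟩

theorem localDistribution_ne_bot (hz : z.base ∈ φ.chart.source)
    (hv : 𝒟 z ≤ verticalSpace τ z.base) (h : 𝒟 z ≠ ⊥) :
    φ.localDistribution 𝒟 (φ.jetCoord z) ≠ ⊥ := by
  obtain ⟨X, hX, hX0⟩ := Submodule.exists_mem_ne_zero_of_ne_bot h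
  obtain ⟨h0, h1⟩ := (mem_iff_of_le_verticalSpace hz hv).1 hX
  intro hbot
  rw [hbot, Submodule.mem_bot] at h1
  exact hX0 ((componentsEquiv hz).map_eq_zero_iff.1 (Prod.ext h0 h1))

theorem localDistribution_ne_top (hz : z.base ∈ φ.chart.source)
    (hv : 𝒟 z ≤ verticalSpace τ z.base) (h : 𝒟 z ≠ verticalSpace τ z.base) :
    φ.localDistribution 𝒟 (φ.jetCoord z) ≠ ⊤ := by
  intro htop
  refine h (le_antisymm hv fun X hX => (mem_iff_of_le_verticalSpace hz hv).2
    ⟨(mem_verticalSpace_iff hz X).1 hX, ?_⟩)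
  rw [htop]
  trivial

theorem isCompl_localDistribution {𝒟₁ 𝒟₂ : DistributionAlong n τ} (hz : z.base ∈ φ.chart.source)
    (hinf : 𝒟₁ z ⊓ 𝒟₂ z = ⊥) (hsup : 𝒟₁ z ⊔ 𝒟₂ z = verticalSpace τ z.base) :
    IsCompl (φ.localDistribution 𝒟₁ (φ.jetCoord z)) (φ.localDistribution 𝒟₂ (φ.jetCoord z)) := by
  refine IsCompl.of_eq (eq_bot_iff.2 fun s hs => ?_) (eq_top_iff.2 fun s _ => ?_)
  · have h1 : φ.ofComponents z.base (0, s) ∈ 𝒟₁ z ⊓ 𝒟₂ z :=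
      ⟨(mem_localDistribution hz).1 hs.1, (mem_localDistribution hz).1 hs.2⟩
    rw [hinf, Submodule.mem_bot] at h1
    exact congrArg Prod.snd ((componentsEquiv hz).symm.map_eq_zero_iff.1 h1)
  · have h1 : φ.ofComponents z.base (0, s) ∈ 𝒟₁ z ⊔ 𝒟₂ z := by
      rw [hsup, mem_verticalSpace_iff hz, components_ofComponents hz]
    obtain ⟨X, hX, Y, hY, hXY⟩ := Submodule.mem_sup.1 h1
    have hX' := (mem_iff_of_le_verticalSpace hz (le_sup_left.trans hsup.le)).1 hX
    have hY' := (mem_iff_of_le_verticalSpace hz (le_sup_right.trans hsup.le)).1 hY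
    have h2 := congrArg (φ.components z.base) hXY
    rw [components_add, components_ofComponents hz] at h2
    exact Submodule.mem_sup.2 ⟨_, hX'.2, _, hY'.2, congrArg Prod.snd h2⟩

/-- A vertical distribution given by the vertical kernel of the differential of some of the
coordinates is a coordinate distribution. -/
theorem eq_coordDistribution {I : Set (Fin n)} [Fintype I] {d : ℕ}
    {y : EventModel n → Fin d → ℝ} {r : I → Fin d} (hr : Function.Surjective r)
    (hφ : z.base ∈ φ.chart.source) (hψ : z.base ∈ ψ.chart.source)
    (hv : 𝒟 z ≤ verticalSpace τ z.base)
    (hy : ∀ x ∈ ψ.chart.source, ∀ i : I, (ψ.chart x).2 i = y (φ.chart x) (r i))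
    (hyd : DifferentiableAt ℝ y (φ.chart z.base))
    (hker : ∀ s, fderiv ℝ y (φ.chart z.base) (0, s) = 0 ↔
      s ∈ φ.localDistribution 𝒟 (φ.jetCoord z)) :
    𝒟 z = ψ.coordDistribution I z := by
  have hev : φ.subTransition ψ I =ᶠ[𝓝 (φ.chart z.base)] fun q i => y q (r i) := by
    filter_upwards [eventually_chart_symm_mem hφ hψ] with q ⟨hq, hq'⟩
    funext i
    rw [subTransition, transition, hy _ hq', φ.chart.right_inv hq]
  have hd : HasFDerivAt (fun q (i : I) => y q (r i)) (ContinuousLinearMap.pi fun i : I =>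
      (ContinuousLinearMap.proj (R := ℝ) (φ := fun _ : Fin d => ℝ) (r i)) ∘L
        fderiv ℝ y (φ.chart z.base)) (φ.chart z.base) :=
    hasFDerivAt_pi.2 fun i => hasFDerivAt_pi'.1 hyd.hasFDerivAt (r i)
  ext X
  rw [mem_iff_of_le_verticalSpace hφ hv, mem_coordDistribution_iff_fderiv hφ hψ, ← hker,
    hev.fderiv_eq, hd.fderiv]
  refine and_congr_right fun _ => ⟨fun h => funext fun i => congrFun h (r i), fun h => ?_⟩
  funext a
  obtain ⟨i, rfl⟩ := hr a
  exact congrFun h i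

end AdaptedChart

end ParallelDistributions

/-! ### Forces with an invariant coordinate subbundle. -/

section ClosedModel

open Set Filter

variable {n : ℕ}

/-- Forces whose coordinate subbundle is parallel and invariant under the Jacobi endomorphism
only depend on the complementary coordinates. -/
theorem force_eq_of_invariant {f : JetModel n → Fin n → ℝ} {O : Set (JetModel n)} (hO : IsOpen O)
    (hconv : Convex ℝ O) (hf : ∀ p ∈ O, ContDiffAt ℝ 2 f p) {I : Set (Fin n)}
    (hpar : ∀ p ∈ O, ∀ s : Fin n → ℝ, (∀ i ∈ I, s i = 0) → ∀ u, ∀ i ∈ I,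
      vertCovDeriv f (fun _ => s) u p i = 0)
    (hjac : ∀ p ∈ O, ∀ s : Fin n → ℝ, (∀ i ∈ I, s i = 0) → ∀ i ∈ I, vertJacobi f p s i = 0)
    {p p' : JetModel n} (hp : p ∈ O) (hp' : p' ∈ O) (ht : p'.1 = p.1)
    (hx : ∀ i ∈ I, p'.2.1 i = p.2.1 i) (hv : ∀ i ∈ I, p'.2.2 i = p.2.2 i) {i : Fin n}
    (hi : i ∈ I) : f p' i = f p i := by
  have h1 : ∀ p ∈ O, ∀ s : Fin n → ℝ, (∀ i ∈ I, s i = 0) → ∀ i ∈ I,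
      fderiv ℝ f p (0, 0, s) i = 0 := by
    intro p hp s hs i hi
    -- For this direction u_x − u⁰ v = 0, so a constant section has covariant derivative −½ f_v s.
    have := hpar p hp s hs (1, p.2.2, 0) i hi
    simpa [vertCovDeriv, Prod.mk_zero_zero] using this
  -- The previous vanishing holds on an open set and may be differentiated in any direction.
  have h2 : ∀ p ∈ O, ∀ s : Fin n → ℝ, (∀ i ∈ I, s i = 0) → ∀ i ∈ I, ∀ w,
      fderiv ℝ (fderiv ℝ f) p w (0, 0, s) i = 0 := by
    intro p hp s hs i hi w
    have hd := (((hf p hp).fderiv_right (m := 1) (by norm_num)).differentiableAt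
      (by simp)).hasFDerivAt
    have ha := hasFDerivAt_pi'.1 (hd.clm_apply
      (hasFDerivAt_const ((0, 0, s) : JetModel n) p)) i
    have hb : HasFDerivAt (fun q => fderiv ℝ f q (0, 0, s) i) (0 : JetModel n →L[ℝ] ℝ) p := by
      refine (hasFDerivAt_const (0 : ℝ) p).congr_of_eventuallyEq ?_
      filter_upwards [hO.mem_nhds hp] with q hq using h1 q hq s hs i hi
    have := DFunLike.congr_fun (ha.unique hb) w
    simpa using this
  -- In Φ the term Γ(f_v) vanishes by `h2`. The term f_v f_v a vanishes because f_v a again has no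
  -- components in `I`. Only −f_x a remains.
  have h3 : ∀ p ∈ O, ∀ a b : Fin n → ℝ, (∀ i ∈ I, a i = 0) → (∀ i ∈ I, b i = 0) →
      fderiv ℝ f p (0, a, b) i = 0 := by
    intro p hp a b ha hb
    have hc := hjac p hp a ha i hi
    simp only [vertJacobi, Pi.add_apply, Pi.sub_apply, Pi.neg_apply, Pi.smul_apply, smul_eq_mul,
      h2 p hp a ha i hi, h1 p hp _ (h1 p hp a ha) i hi, mul_zero, add_zero, sub_zero,
      neg_eq_zero] at hc
    have hab : ((0, a, b) : JetModel n) = (0, a, 0) + (0, 0, b) := by simp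
    rw [hab, map_add, Pi.add_apply, hc, h1 p hp b hb i hi, add_zero]
  have hw : p' - p = (0, p'.2.1 - p.2.1, p'.2.2 - p.2.2) := by
    refine Prod.ext ?_ rfl
    exact sub_eq_zero.2 ht
  have hseg : ∀ r ∈ Icc (0 : ℝ) 1, p + r • (p' - p) ∈ O := fun r hr =>
    hconv.add_smul_sub_mem hp hp' hr
  have hder : ∀ r ∈ Icc (0 : ℝ) 1, HasDerivAt (fun r : ℝ => f (p + r • (p' - p)) i) 0 r := by
    intro r hr
    have ha : HasDerivAt (fun r : ℝ => p + r • (p' - p)) (p' - p) r := by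
      simpa using ((hasDerivAt_id r).smul_const (p' - p)).const_add p
    have hb := hasDerivAt_pi.1 ((((hf _ (hseg r hr)).differentiableAt
      (by simp)).hasFDerivAt).comp_hasDerivAt r ha) i
    have hc := h3 _ (hseg r hr) _ _ (fun j hj => sub_eq_zero.2 (hx j hj))
      (fun j hj => sub_eq_zero.2 (hv j hj))
    exact hb.congr_deriv ((congrArg (fun w => fderiv ℝ f (p + r • (p' - p)) w i) hw).trans hc)
  have := constant_of_has_deriv_right_zero (fun r hr => (hder r hr).continuousAt.continuousWithinAt)
    (fun r hr => (hder r (Ico_subset_Icc_self hr)).hasDerivWithinAt) 1 (right_mem_Icc.2 zero_le_one)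
  simpa using this

end ClosedModel

/-! ### From parallel invariant distributions to closed subsystems. -/

section Reconstruction

set_option linter.unusedSectionVars false

open Set Filter AdaptedChart

variable {n : ℕ} {M : Type*} [TopologicalSpace M] [ChartedSpace (EventModel n) M]
  [IsManifold 𝓘(ℝ, EventModel n) ∞ M] {τ : M → ℝ}

theorem AdaptedChart.exists_base_eq {φ : AdaptedChart (n := n) τ} {m : M}
    (hm : m ∈ φ.chart.source) : ∃ z : JetBundle n τ, z.base = m :=
  ⟨φ.jetPoint ((φ.chart m).1, (φ.chart m).2, 0) (φ.chart.map_source hm), φ.chart.left_inv hm⟩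

namespace SODE

variable {Γ : SODE n τ}

/-- If a parallel and Jacobi invariant distribution is a coordinate distribution, then the
complementary equations are closed. -/
theorem closedSubsystem_of_eq_coordDistribution {ψ : AdaptedChart (n := n) τ} {I : Set (Fin n)}
    {𝒟 : DistributionAlong n τ} {U : Set M} (hU : IsOpen U) (hD : 𝒟.IsParallelVertical U Γ)
    (hψU : ψ.chart.source ⊆ U) (hconv : Convex ℝ ψ.chart.target)
    (heq : ∀ z : JetBundle n τ, z.base ∈ ψ.chart.source → 𝒟 z = ψ.coordDistribution I z) :
    Γ.ClosedSubsystem ψ I := by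
  classical
  have hmem : ∀ z : JetBundle n τ, z.base ∈ ψ.chart.source → ∀ s : Fin n → ℝ,
      s ∈ ψ.localDistribution 𝒟 (ψ.jetCoord z) ↔ ∀ i ∈ I, s i = 0 := by
    intro z hz s
    rw [mem_localDistribution hz, heq z hz, ofComponents_mem_coordDistribution hz]
    exact and_iff_right rfl
  have hconst : ∀ p ∈ ψ.jetTarget, ∀ p' ∈ ψ.jetTarget, p'.1 = p.1 →
      (∀ i ∈ I, p'.2.1 i = p.2.1 i) → (∀ i ∈ I, p'.2.2 i = p.2.2 i) →
      ∀ i ∈ I, Γ.force ψ p' i = Γ.force ψ p i := by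
    intro p hp p' hp' ht hx hv i hi
    refine force_eq_of_invariant isOpen_jetTarget
      (fun a ha b hb c d hc hd hcd => hconv ha hb hc hd hcd)
      (fun p hp => (contDiffAt_force hp).of_le (natCast_le_infty 2)) ?_ ?_ hp hp' ht hx hv hi
    · intro p hp s hs u
      obtain ⟨z, hz, rfl⟩ := exists_jetCoord_eq hp
      refine (hmem z hz _).1 (isParallelAt_localDistribution hU hD.parallel hz (hψU hz) _ ?_ u)
      filter_upwards [isOpen_jetTarget.mem_nhds hp] with p' hp'
      obtain ⟨y, hy, rfl⟩ := exists_jetCoord_eq hp'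
      exact ⟨contDiffAt_const, (hmem y hy s).2 hs⟩
    · intro p hp s hs
      obtain ⟨z, hz, rfl⟩ := exists_jetCoord_eq hp
      exact (hmem z hz _).1 (vertJacobi_mem_localDistribution hD.jacobiInvariant hz (hψU hz)
        ((hmem z hz s).2 hs))
  -- The reduced force is evaluated at any point with the given reduced coordinates; `hconst` makes
  -- the choice immaterial. The value 0 is used only for data not attained in the chart.
  refine ⟨fun t x v i => if h : ∃ p ∈ ψ.jetTarget, p.1 = t ∧ (fun j : I => p.2.1 j) = x ∧
    (fun j : I => p.2.2 j) = v then Γ.force ψ h.choose i else 0, fun p hp i => ?_⟩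
  have h : ∃ p' ∈ ψ.jetTarget, p'.1 = p.1 ∧ (fun j : I => p'.2.1 j) = (fun j : I => p.2.1 j) ∧
    (fun j : I => p'.2.2 j) = (fun j : I => p.2.2 j) := ⟨p, hp, rfl, rfl, rfl⟩
  refine Eq.trans ?_ (dif_pos h).symm
  obtain ⟨h1, h2, h3, h4⟩ := h.choose_spec
  exact (hconst p hp _ h1 h2 (fun i hi => congrFun h3 ⟨i, hi⟩) (fun i hi => congrFun h4 ⟨i, hi⟩)
    i i.2).symm

theorem locallySubmersive_of_isParallelVertical
    (hτ : ContMDiff 𝓘(ℝ, EventModel n) 𝓘(ℝ, ℝ) ∞ τ)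
    (hsub : ∀ m : M, Function.Surjective (mfderiv 𝓘(ℝ, EventModel n) 𝓘(ℝ, ℝ) τ m))
    (h : ∀ m : M, ∃ U : Set M, IsOpen U ∧ m ∈ U ∧
      ∃ 𝒟 : DistributionAlong n τ, 𝒟.IsParallelVertical U Γ) : Γ.LocallySubmersive := by
  intro m
  obtain ⟨U, hU, hmU, 𝒟, hD⟩ := h m
  obtain ⟨φ, hm, hφU⟩ := exists_adaptedChart hτ hsub (hU.mem_nhds hmU)
  obtain ⟨z, rfl⟩ := exists_base_eq hm
  obtain ⟨d, y, hd, hy⟩ := exists_ker_fderiv_eq_localDistribution hU hD hφU hm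
  set K := φ.localDistribution 𝒟 (φ.jetCoord z)
  have hv := hD.vertical
  have hk0 : 1 ≤ Module.finrank ℝ K := Submodule.one_le_finrank_iff.2
    (localDistribution_ne_bot hm (hv z hmU) (hD.nontrivial z hmU).1)
  have hkn : Module.finrank ℝ K < n := by
    simpa using Submodule.finrank_lt
      (localDistribution_ne_top hm (hv z hmU) (hD.nontrivial z hmU).2)
  obtain ⟨d', T, -, hT⟩ := exists_equiv_prod_of_submodule K
  -- Linear functions that are coordinates on the kernel of dy at the chosen point complete y to a
  -- chart.
  set y' : EventModel n →L[ℝ] (Fin (Module.finrank ℝ K) → ℝ) :=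
    ContinuousLinearMap.fst ℝ _ _ ∘L
      (T : (Fin n → ℝ) →L[ℝ] (Fin (Module.finrank ℝ K) → ℝ) × (Fin d' → ℝ)) ∘L
      ContinuousLinearMap.snd ℝ _ _
  obtain ⟨ψ, hmψ, hψG, hψφ, hconv, hψ, -⟩ := φ.exists_of_vertical_injective hm hd
    (hy.mono fun q hq => hq.1) (Eventually.of_forall fun q => y'.contDiff.contDiffAt)
    (fun s h1 h2 => by
      rw [y'.fderiv] at h2
      exact T.map_eq_zero_iff.1 (Prod.ext h2 ((hT s).2 ((hy.self_of_nhds.2 s _).1 h1))))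
    -- The chart is confined to the neighbourhood where the distribution is the kernel of dy, so the
    -- identification below holds on its whole domain.
    ((φ.chart.continuousAt hm).eventually hy)
  refine ⟨ψ, hmψ, d, by omega, by omega, closedSubsystem_of_eq_coordDistribution hU hD
    (hψφ.trans hφU) hconv fun z' hz' => ?_⟩
  have hz := hψφ hz'
  exact eq_coordDistribution (r := fun i => ⟨i, i.2⟩)
    (fun a => ⟨⟨⟨a, by omega⟩, a.2⟩, rfl⟩) hz hz' (hv z' (hφU hz))
    (fun x hx i => hψ x hx i i.2) ((hψG hz').1.differentiableAt (by simp))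
    fun s => (hψG hz').2 s _

theorem locallyDecouples_of_isParallelVertical
    (hτ : ContMDiff 𝓘(ℝ, EventModel n) 𝓘(ℝ, ℝ) ∞ τ)
    (hsub : ∀ m : M, Function.Surjective (mfderiv 𝓘(ℝ, EventModel n) 𝓘(ℝ, ℝ) τ m))
    (h : ∀ m : M, ∃ U : Set M, IsOpen U ∧ m ∈ U ∧
      ∃ 𝒟₁ 𝒟₂ : DistributionAlong n τ, 𝒟₁.IsParallelVertical U Γ ∧
        𝒟₂.IsParallelVertical U Γ ∧ DistributionAlong.AreComplementaryOver U 𝒟₁ 𝒟₂) :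
    Γ.LocallyDecouples := by
  intro m
  obtain ⟨U, hU, hmU, 𝒟₁, 𝒟₂, hD₁, hD₂, hD⟩ := h m
  obtain ⟨φ, hm, hφU⟩ := exists_adaptedChart hτ hsub (hU.mem_nhds hmU)
  obtain ⟨z, rfl⟩ := exists_base_eq hm
  obtain ⟨d₁, y₁, hd₁, hy₁⟩ := exists_ker_fderiv_eq_localDistribution hU hD₁ hφU hm
  obtain ⟨d₂, y₂, hd₂, hy₂⟩ := exists_ker_fderiv_eq_localDistribution hU hD₂ hφU hm
  have hK := isCompl_localDistribution hm (hD z hmU).1 (hD z hmU).2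
  have hdim := Submodule.finrank_add_eq_of_isCompl hK
  have hk₁ := Submodule.one_le_finrank_iff.2
    (localDistribution_ne_bot hm (hD₁.vertical z hmU) (hD₁.nontrivial z hmU).1)
  have hk₂ := Submodule.one_le_finrank_iff.2
    (localDistribution_ne_bot hm (hD₂.vertical z hmU) (hD₂.nontrivial z hmU).1)
  rw [Module.finrank_fin_fun] at hdim
  -- Each dᵢ is the corank of one distribution and the two ranks add up to n. The first integrals of
  -- both families therefore have the right total number, and the trivial intersection of the
  -- kernels makes them independent.
  have hd : d₁ + d₂ = n := by omega
  obtain ⟨ψ, hmψ, hψG, hψφ, hconv, hψ₁, hψ₂⟩ := φ.exists_of_vertical_injective hm hd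
    (hy₁.mono fun q hq => hq.1) (hy₂.mono fun q hq => hq.1)
    (fun s h1 h2 => (Submodule.mem_bot ℝ).1 (hK.inf_eq_bot ▸
      ⟨(hy₁.self_of_nhds.2 s _).1 h1, (hy₂.self_of_nhds.2 s _).1 h2⟩))
    ((φ.chart.continuousAt hm).eventually (hy₁.and hy₂))
  refine ⟨ψ, hmψ, d₁, by omega, by omega,
    closedSubsystem_of_eq_coordDistribution hU hD₁ (hψφ.trans hφU) hconv fun z' hz' => ?_,
    closedSubsystem_of_eq_coordDistribution hU hD₂ (hψφ.trans hφU) hconv fun z' hz' => ?_⟩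
  · have hz := hψφ hz'
    have hG := (hψG hz').1
    exact eq_coordDistribution (r := fun i => ⟨i, i.2⟩)
      (fun a => ⟨⟨⟨a, by omega⟩, a.2⟩, rfl⟩) hz hz' (hD₁.vertical z' (hφU hz))
      (fun x hx i => hψ₁ x hx i i.2) (hG.1.differentiableAt (by simp)) fun s => hG.2 s _
  · have hz := hψφ hz'
    have hG := (hψG hz').2
    exact eq_coordDistribution (I := {i : Fin n | d₁ ≤ (i : ℕ)})
      (r := fun i => ⟨(i : Fin n) - d₁, by have := i.1.2; have := i.2; omega⟩)
      (fun a => ⟨⟨⟨d₁ + a, by omega⟩, Nat.le_add_right _ _⟩, Fin.ext (Nat.add_sub_cancel_left ..)⟩)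
      hz hz' (hD₂.vertical z' (hφU hz))
      (fun x hx i => hψ₂ x hx i i.2) (hG.1.differentiableAt (by simp)) fun s => hG.2 s _

end SODE

end Reconstruction

theorem mainTheorem9 {n : ℕ} {M : Type*} [TopologicalSpace M] [ChartedSpace (EventModel n) M]
    [IsManifold 𝓘(ℝ, EventModel n) ∞ M] (τ : M → ℝ)
    (hτ : ContMDiff 𝓘(ℝ, EventModel n) 𝓘(ℝ, ℝ) ∞ τ)
    (hsub : ∀ m : M, Function.Surjective (mfderiv 𝓘(ℝ, EventModel n) 𝓘(ℝ, ℝ) τ m))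
    (Γ : SODE n τ) :
    (Γ.LocallySubmersive ↔
      ∀ m : M, ∃ U : Set M, IsOpen U ∧ m ∈ U ∧
        ∃ 𝒟 : DistributionAlong n τ, 𝒟.IsParallelVertical U Γ) ∧
    (Γ.LocallyDecouples ↔
      ∀ m : M, ∃ U : Set M, IsOpen U ∧ m ∈ U ∧
        ∃ 𝒟₁ 𝒟₂ : DistributionAlong n τ, 𝒟₁.IsParallelVertical U Γ ∧
          𝒟₂.IsParallelVertical U Γ ∧ DistributionAlong.AreComplementaryOver U 𝒟₁ 𝒟₂) ∧
    ((∃ 𝒟 : DistributionAlong n τ, 𝒟.IsParallelVertical Set.univ Γ) → Γ.LocallySubmersive) ∧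
    ((∃ 𝒟₁ 𝒟₂ : DistributionAlong n τ, 𝒟₁.IsParallelVertical Set.univ Γ ∧
        𝒟₂.IsParallelVertical Set.univ Γ ∧
        DistributionAlong.AreComplementaryOver Set.univ 𝒟₁ 𝒟₂) → Γ.LocallyDecouples) :=
  ⟨⟨fun h m => h.exists_isParallelVertical m, SODE.locallySubmersive_of_isParallelVertical hτ hsub⟩,
    ⟨fun h m => h.exists_isParallelVertical m, SODE.locallyDecouples_of_isParallelVertical hτ hsub⟩,
    fun h => SODE.locallySubmersive_of_isParallelVertical hτ hsub fun _ =>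
      ⟨Set.univ, isOpen_univ, trivial, h⟩,
    fun h => SODE.locallyDecouples_of_isParallelVertical hτ hsub fun _ =>
      ⟨Set.univ, isOpen_univ, trivial, h⟩⟩
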